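/- Let $X$ be a complex manifold with sheaf of holomorphic differential operators $\mathscr{D}_X$, and let $D\subset X$ be a simple normal crossings divisor with irreducible components $D_1,\dots,D_r$. For $\boldsymbol n\in\mathbb Z^r$ put $$V^{\boldsymbol n}\mathscr D_X=\{P\in\mathscr D_X\mid P\cdot\mathcal I_{D_i}^{m}\subset \mathcal I_{D_i}^{m+n_i}\ \text{for all } m\ge 0 \text{ and } 1\le i\le r\},$$ where $\mathcal I_{D_i}$ is the ideal sheaf of $D_i$ and $\mathcal I_{D_i}^{l}=\mathcal O_X$ for $l\le 0$. Order $\mathbb R^r$ componentwise. *Walls.* A set of walls in $\mathbb R^r$ is a set $\mathcal W$, finite modulo translation by $\mathbb Z^r$, of affine hyperplanes of the form $\boldsymbol L^{-1}(\gamma)=\{\boldsymbol\alpha\mid L_1\alpha_1+\cdots+L_r\alpha_r=\gamma\}$ with $0\ne\boldsymbol L\in\mathbb Q_{\ge 0}^r$ and $\gamma\in\mathbb R$. A chamber of $\mathcal W$ is a non-empty subset of $\mathbb R^r$ cut out by choosing, for each wall $\boldsymbol L^{-1}(\gamma)\in\mathcal W$, one of the conditions $\boldsymbol L(\boldsymbol\alpha)>\gamma$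 and $\boldsymbol L(\boldsymbol\alpha)\le\gamma$. A wall $\boldsymbol L^{-1}(\gamma)$ separates $\boldsymbol\alpha$ and $\boldsymbol\beta$ if $\boldsymbol L(\boldsymbol\alpha)\le\gamma<\boldsymbol L(\boldsymbol\beta)$ or vice versa. *Filtrations.* Let $\mathcal M$ be a coherent left $\mathscr D_X$-module. A multivariate $V$-filtration on $\mathcal M$ along $D$ is a family of subsheaves $V^{\boldsymbol\alpha}\mathcal M\subset\mathcal M$, $\boldsymbol\alpha\in\mathbb R^r$, with $V^{\boldsymbol\beta}\mathcal M\subset V^{\boldsymbol\alpha}\mathcal M$ whenever $\boldsymbol\alpha\le\boldsymbol\beta$, such that: 1. locally on $X$ there is a set of walls $\mathcal W$ of the filtration, i.e. a set of walls such that $V^{\boldsymbol\alpha}\mathcal M=V^{\boldsymbol\beta}\mathcal M$ whenever $\boldsymbol\alpha,\boldsymbol\beta$ lie in the same chamber of $\mathcal W$; 2. $\mathcal M=\bigcup_{\boldsymbol\alpha}V^{\boldsymbol\alpha}\mathcal M$; $V^{\boldsymbol n}\mathscr D_X\cdot V^{\boldsymbol\alpha}\mathcal M\subset V^{\boldsymbol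 n+\boldsymbol\alpha}\mathcal M$ for all $\boldsymbol n\in\mathbb Z^r$, $\boldsymbol\alpha\in\mathbb R^r$; each $V^{\boldsymbol\alpha}\mathcal M$ is a coherent $V^{\boldsymbol 0}\mathscr D_X$-module; and locally on $X$ there is an interval $[A,B]\subset\mathbb R$ such that, for all $\boldsymbol\alpha\in\mathbb R^r$, $$V^{\boldsymbol\alpha}\mathcal M=\sum_{\boldsymbol n\in\mathbb Z^r,\ \boldsymbol\gamma\in[A,B]^r,\ \boldsymbol n+\boldsymbol\gamma\ge\boldsymbol\alpha}V^{\boldsymbol n}\mathscr D_X\cdot V^{\boldsymbol\gamma}\mathcal M ;$$ 3. if $\mathcal W$ is a set of walls of the filtration (on an open subset of $X$) and $\boldsymbol\alpha\le\boldsymbol\beta$ are separated by exactly one wall $\boldsymbol L^{-1}(\gamma)\in\mathcal W$, then, locally on that open subset, there are $\gamma_1,\dots,\gamma_k\in\mathbb C$ with $\operatorname{Re}\gamma_j=\gamma$ such that $\prod_{j=1}^k(\boldsymbol L(\boldsymbol s)+\gamma_j)$ acts by zero on $V^{\boldsymbol\alpha}\mathcal M/V^{\boldsymbol\beta}\mathcal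 M$. Here, near a point $x$, $\boldsymbol L(\boldsymbol s)=\sum_i L_is_i$ and $s_i=-\partial_{t_i}t_i$, where the $D_i$ passing through $x$ are given by $t_i=0$ for members $t_i$ of a local coordinate system (any such system), and the sum is over the $i$ with $x\in D_i$. Then the following hold. (a) For every coherent $\mathscr D_X$-module $\mathcal M$, any two multivariate $V$-filtrations on $\mathcal M$ along $D$ coincide. (b) If $f\colon\mathcal M\to\mathcal N$ is a morphism of coherent $\mathscr D_X$-modules which admit multivariate $V$-filtrations $V^\bullet\mathcal M$ and $V^\bullet\mathcal N$ along $D$, then $f$ is strict with respect to them: $$f(V^{\boldsymbol\alpha}\mathcal M)=f(\mathcal M)\cap V^{\boldsymbol\alpha}\mathcal N\qquad\text{for all }\boldsymbol\alpha\in\mathbb R^r .$$ -/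

import Mathlib

open CategoryTheory TopologicalSpace Opposite
open scoped Manifold ContDiff

universe u v

namespace MultiV

noncomputable section Holomorphic

/-- The ring `𝒪_X(W)` of holomorphic functions on an open subset `W` of an `n`-dimensional complex
manifold `X`. -/
abbrev Hol (n : ℕ) {X : Type u} [TopologicalSpace X] [ChartedSpace (Fin n → ℂ) X] (W : Opens X) :
    Type u :=
  C^ω⟮𝓘(ℂ, Fin n → ℂ), W; 𝓘(ℂ, ℂ), ℂ⟯

variable {n : ℕ} {X : Type u} [TopologicalSpace X] [ChartedSpace (Fin n → ℂ) X]

/-- Restriction of holomorphic functions. -/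
def Hol.res {V W : Opens X} (h : W ≤ V) : Hol n V →ₐ[ℂ] Hol n W :=
  { ContMDiffMap.restrictRingHom 𝓘(ℂ, Fin n → ℂ) 𝓘(ℂ, ℂ) ℂ h with
    commutes' := fun _ => rfl }

theorem Hol.res_apply {V W : Opens X} (h : W ≤ V) (f : Hol n V) (w : W) :
    Hol.res h f w = f ⟨w.1, h w.2⟩ := rfl

/-- A function which is locally holomorphic is holomorphic. -/
theorem Hol.contMDiff_of_local {W : Opens X} (g : W → ℂ)
    (hg : ∀ w : W, ∃ (W' : Opens X) (h : W' ≤ W) (_ : w.1 ∈ W') (f : Hol n W'),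
      ∀ y : W', g ⟨y.1, h y.2⟩ = f y) :
    ContMDiff 𝓘(ℂ, Fin n → ℂ) 𝓘(ℂ, ℂ) ω g := by
  intro w
  obtain ⟨W', h, hw, f, hf⟩ := hg w
  have e1 : (fun y : W => Function.extend Subtype.val g 0 y.1) = g := by
    funext y
    exact Subtype.val_injective.extend_apply g 0 y
  have e2 : (fun y : W' => Function.extend Subtype.val g 0 y.1) = f := by
    funext y
    rw [← hf y]
    exact Subtype.val_injective.extend_apply g 0 (⟨y.1, h y.2⟩ : W)
  have h2 : ContMDiffAt 𝓘(ℂ, Fin n → ℂ) 𝓘(ℂ, ℂ) ω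
      (fun y : W' => Function.extend Subtype.val g 0 y.1) ⟨w.1, hw⟩ := by
    rw [e2]; exact f.contMDiff _
  have h3 := contMDiffAt_subtype_iff.1 h2
  rw [← e1]
  exact contMDiffAt_subtype_iff.2 h3

end Holomorphic

noncomputable section Operators

variable (n : ℕ) {X : Type u} [TopologicalSpace X] [ChartedSpace (Fin n → ℂ) X]

/-- The algebra of `ℂ`-linear endomorphisms of the sheaf `𝒪_X|_U`: families of endomorphisms of
`𝒪_X(W)`, for `W ⊆ U` open, compatible with restriction. -/
def holEndAlg (U : Opens X) :
    Subalgebra ℂ (∀ W : {W : Opens X // W ≤ U}, Module.End ℂ (Hol n W.1)) where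
  carrier := {P | ∀ (V W : {W : Opens X // W ≤ U}) (h : W.1 ≤ V.1) (f : Hol n V.1),
    Hol.res h (P V f) = P W (Hol.res h f)}
  mul_mem' := by
    intro P Q hP hQ V W h f
    change Hol.res h (P V (Q V f)) = P W (Q W (Hol.res h f))
    rw [hP V W h, hQ V W h]
  add_mem' := by
    intro P Q hP hQ V W h f
    change Hol.res h (P V f + Q V f) = P W (Hol.res h f) + Q W (Hol.res h f)
    rw [map_add, hP V W h, hQ V W h]
  algebraMap_mem' := by
    intro c V W h f
    change Hol.res h (c • f) = c • Hol.res h f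
    exact map_smul _ _ _

/-- The elements of `holEndAlg n U`, as a type. -/
def HolEnd (U : Opens X) : Type u := ↥(holEndAlg n U)

instance (U : Opens X) : Ring (HolEnd n U) := inferInstanceAs (Ring ↥(holEndAlg n U))

instance (U : Opens X) : Algebra ℂ (HolEnd n U) := inferInstanceAs (Algebra ℂ ↥(holEndAlg n U))

variable {n}

/-- Restriction of endomorphisms of `𝒪_X` to a smaller open set. -/
def HolEnd.res {V W : Opens X} (h : W ≤ V) : HolEnd n V →ₐ[ℂ] HolEnd n W where
  toFun P := ⟨fun W' => P.1 ⟨W'.1, W'.2.trans h⟩, fun V' W' h' f =>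
    P.2 ⟨V'.1, V'.2.trans h⟩ ⟨W'.1, W'.2.trans h⟩ h' f⟩
  map_one' := rfl
  map_mul' _ _ := rfl
  map_zero' := rfl
  map_add' _ _ := rfl
  commutes' _ := rfl

/-- Multiplication by a holomorphic function. -/
def HolEnd.mult {U : Opens X} (g : Hol n U) : HolEnd n U :=
  ⟨fun W => LinearMap.mulLeft ℂ (Hol.res W.2 g), fun V W h f => by
    change Hol.res h (Hol.res V.2 g * f) = Hol.res W.2 g * Hol.res h f
    rw [map_mul]; rfl⟩

/-- Holomorphic vector fields on `U`: the derivations of `𝒪_X|_U`. -/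
def HolEnd.IsVectorField {U : Opens X} (P : HolEnd n U) : Prop :=
  ∀ (W : {W : Opens X // W ≤ U}) (f g : Hol n W.1), P.1 W (f * g) = f * P.1 W g + g * P.1 W f

variable (n)

/-- The algebra of endomorphisms of `𝒪_X|_U` generated by functions and vector fields on `U`. -/
def generatedOps (U : Opens X) : Subalgebra ℂ (HolEnd n U) :=
  Algebra.adjoin ℂ (Set.range HolEnd.mult ∪ {P | HolEnd.IsVectorField P})

variable {n}

theorem generatedOps_res {V W : Opens X} (h : W ≤ V) {P : HolEnd n V}
    (hP : P ∈ generatedOps n V) : HolEnd.res h P ∈ generatedOps n W := by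
  have : (generatedOps n V).map (HolEnd.res h) ≤ generatedOps n W := by
    rw [generatedOps, AlgHom.map_adjoin, generatedOps]
    apply Algebra.adjoin_mono
    rintro _ ⟨Q, (⟨g, rfl⟩ | hQ), rfl⟩
    · exact Or.inl ⟨Hol.res h g, rfl⟩
    · exact Or.inr fun W' f g => hQ ⟨W'.1, W'.2.trans h⟩ f g
  exact this ⟨P, hP, rfl⟩

variable (n)

/-- The algebra `𝒟_X(U)` of holomorphic differential operators on `U`: endomorphisms of `𝒪_X|_U`
which are locally generated by functions and vector fields. -/
def diffOpAlg (U : Opens X) : Subalgebra ℂ (HolEnd n U) where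
  carrier := {P | ∀ x ∈ U, ∃ (W : Opens X) (h : W ≤ U), x ∈ W ∧ HolEnd.res h P ∈ generatedOps n W}
  mul_mem' := by
    intro P Q hP hQ x hx
    obtain ⟨W, h, hxW, hW⟩ := hP x hx
    obtain ⟨W', h', hxW', hW'⟩ := hQ x hx
    refine ⟨W ⊓ W', inf_le_left.trans h, ⟨hxW, hxW'⟩, ?_⟩
    rw [map_mul]
    exact mul_mem (generatedOps_res (W := W ⊓ W') inf_le_left hW)
      (generatedOps_res (W := W ⊓ W') inf_le_right hW')
  add_mem' := by
    intro P Q hP hQ x hx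
    obtain ⟨W, h, hxW, hW⟩ := hP x hx
    obtain ⟨W', h', hxW', hW'⟩ := hQ x hx
    refine ⟨W ⊓ W', inf_le_left.trans h, ⟨hxW, hxW'⟩, ?_⟩
    rw [map_add]
    exact add_mem (generatedOps_res (W := W ⊓ W') inf_le_left hW)
      (generatedOps_res (W := W ⊓ W') inf_le_right hW')
  algebraMap_mem' := by
    intro c x hx
    exact ⟨U, le_rfl, hx, (generatedOps n U).algebraMap_mem c⟩

/-- The elements of `diffOpAlg n U`, as a type. -/
def DiffOp (U : Opens X) : Type u := ↥(diffOpAlg n U)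

instance (U : Opens X) : Ring (DiffOp n U) := inferInstanceAs (Ring ↥(diffOpAlg n U))

instance (U : Opens X) : Algebra ℂ (DiffOp n U) := inferInstanceAs (Algebra ℂ ↥(diffOpAlg n U))

variable {n}

/-- Restriction of differential operators. -/
def DiffOp.res {V W : Opens X} (h : W ≤ V) : DiffOp n V →ₐ[ℂ] DiffOp n W :=
  AlgHom.codRestrict ((HolEnd.res h).comp (diffOpAlg n V).val) (diffOpAlg n W) (by
    intro P x hx
    obtain ⟨W', h', hxW', hP⟩ := P.2 x (h hx)
    exact ⟨W' ⊓ W, inf_le_right, ⟨hxW', hx⟩, generatedOps_res (W := W' ⊓ W) inf_le_left hP⟩)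

/-- The action of a differential operator on functions. -/
def DiffOp.act {U : Opens X} (P : DiffOp n U) {W : Opens X} (h : W ≤ U) (f : Hol n W) : Hol n W :=
  P.1.1 ⟨W, h⟩ f

theorem DiffOp.ext_act {U : Opens X} {P Q : DiffOp n U}
    (h : ∀ (W : Opens X) (hW : W ≤ U) (f : Hol n W), P.act hW f = Q.act hW f) : P = Q := by
  apply Subtype.ext
  apply Subtype.ext
  funext W
  apply LinearMap.ext
  intro f
  exact h W.1 W.2 f

theorem DiffOp.res_act {U V : Opens X} (h : V ≤ U) (P : DiffOp n U) {W : Opens X} (hW : W ≤ V)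
    (f : Hol n W) : (DiffOp.res h P).act hW f = P.act (hW.trans h) f := rfl

theorem DiffOp.act_res {U : Opens X} (P : DiffOp n U) {V W : Opens X} (hV : V ≤ U) (h : W ≤ V)
    (f : Hol n V) : Hol.res h (P.act hV f) = P.act (h.trans hV) (Hol.res h f) :=
  P.1.2 ⟨V, hV⟩ ⟨W, h.trans hV⟩ h f

/-- A holomorphic function, as a differential operator of order zero. -/
def DiffOp.mult {U : Opens X} (g : Hol n U) : DiffOp n U :=
  ⟨HolEnd.mult g, fun _ hx => ⟨U, le_rfl, hx, Algebra.subset_adjoin (Or.inl ⟨g, rfl⟩)⟩⟩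

/-- A vector field, as a differential operator. -/
def DiffOp.ofVectorField {U : Opens X} (P : HolEnd n U) (hP : P.IsVectorField) : DiffOp n U :=
  ⟨P, fun _ hx => ⟨U, le_rfl, hx, Algebra.subset_adjoin (Or.inr hP)⟩⟩

variable (n X)

/-- The presheaf of rings `U ↦ 𝒟_X(U)`. -/
def diffOpPresheaf : TopCat.Presheaf RingCat.{u} (TopCat.of X) where
  obj U := RingCat.of (DiffOp n (X := X) U.unop)
  map i := RingCat.ofHom (DiffOp.res (n := n) (X := X) i.unop.le).toRingHom
  map_id _ := rfl
  map_comp _ _ := rfl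

section Gluing

variable {n X} {ι : Type u} {U : ι → Opens X} (P : ∀ i, DiffOp n (U i))

/-- Values of the operator glued from compatible operators `P i` on the members of a cover. -/
def glueFun {W : Opens X} (hW : W ≤ iSup U) (f : Hol n W) (w : W) : ℂ :=
  (P (Opens.mem_iSup.1 (hW w.2)).choose).act inf_le_right
    (Hol.res (inf_le_left : W ⊓ U (Opens.mem_iSup.1 (hW w.2)).choose ≤ W) f)
    ⟨w.1, w.2, (Opens.mem_iSup.1 (hW w.2)).choose_spec⟩

theorem glueFun_eq (hP : ∀ i j, DiffOp.res (inf_le_left : U i ⊓ U j ≤ U i) (P i) =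
    DiffOp.res (inf_le_right : U i ⊓ U j ≤ U j) (P j)) {W : Opens X} (hW : W ≤ iSup U) (f : Hol n W) (w : W) (i : ι)
    {W' : Opens X} (h : W' ≤ W) (h' : W' ≤ U i) (hw : w.1 ∈ W') :
    glueFun P hW f w = (P i).act h' (Hol.res h f) ⟨w.1, hw⟩ := by
  set j := (Opens.mem_iSup.1 (hW w.2)).choose with hj
  have hwj : w.1 ∈ U j := (Opens.mem_iSup.1 (hW w.2)).choose_spec
  have h1 : (P j).act (inf_le_right.trans inf_le_right : W' ⊓ (W ⊓ U j) ≤ U j)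
      (Hol.res (inf_le_left.trans h) f) = (P i).act (inf_le_left.trans h')
      (Hol.res (inf_le_left.trans h) f) := by
    have h2 : W' ⊓ (W ⊓ U j) ≤ U j ⊓ U i :=
      le_inf (inf_le_right.trans inf_le_right) (inf_le_left.trans h')
    exact congrArg (fun Q => DiffOp.act Q h2 (Hol.res (inf_le_left.trans h) f)) (hP j i)
  have h3 := congrArg (fun g => g ⟨w.1, hw, w.2, hwj⟩) h1
  have h4 := DiffOp.act_res (P j) (inf_le_right : W ⊓ U j ≤ U j)
    (inf_le_right : W' ⊓ (W ⊓ U j) ≤ W ⊓ U j) (Hol.res inf_le_left f)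
  have h5 := DiffOp.act_res (P i) h' (inf_le_left : W' ⊓ (W ⊓ U j) ≤ W') (Hol.res h f)
  have h6 := congrArg (fun g => g ⟨w.1, hw, w.2, hwj⟩) h4
  have h7 := congrArg (fun g => g ⟨w.1, hw, w.2, hwj⟩) h5
  exact h6.trans (h3.trans h7.symm)

variable (hP : ∀ i j, DiffOp.res (inf_le_left : U i ⊓ U j ≤ U i) (P i) =
  DiffOp.res (inf_le_right : U i ⊓ U j ≤ U j) (P j))

/-- The endomorphism glued from compatible operators on the members of a cover. -/
def glueEnd : HolEnd n (iSup U) :=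
  ⟨fun W =>
    { toFun := fun f => ⟨glueFun P W.2 f, Hol.contMDiff_of_local _ fun w => by
        obtain ⟨i, hi⟩ := Opens.mem_iSup.1 (W.2 w.2)
        exact ⟨W.1 ⊓ U i, inf_le_left, ⟨w.2, hi⟩, (P i).act inf_le_right (Hol.res inf_le_left f),
          fun y => glueFun_eq P hP W.2 f ⟨y.1, y.2.1⟩ i inf_le_left inf_le_right y.2⟩⟩
      map_add' := fun f g => by
        ext w
        change glueFun P W.2 (f + g) w = glueFun P W.2 f w + glueFun P W.2 g w
        simp only [glueFun, DiffOp.act, map_add]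
        rfl
      map_smul' := fun c f => by
        ext w
        change glueFun P W.2 (c • f) w = c • glueFun P W.2 f w
        simp only [glueFun, DiffOp.act, map_smul]
        rfl },
  fun V W h f => by
    ext w
    obtain ⟨i, hi⟩ := Opens.mem_iSup.1 (W.2 w.2)
    change glueFun P V.2 f ⟨w.1, h w.2⟩ = glueFun P W.2 (Hol.res h f) w
    rw [glueFun_eq P hP V.2 f ⟨w.1, h w.2⟩ i (W' := W.1 ⊓ U i) (inf_le_left.trans h) inf_le_right
      ⟨w.2, hi⟩, glueFun_eq P hP W.2 (Hol.res h f) w i (W' := W.1 ⊓ U i) inf_le_left inf_le_right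
      ⟨w.2, hi⟩]
    rfl⟩

theorem res_glueEnd (i : ι) : HolEnd.res (le_iSup U i) (glueEnd P hP) = (P i).1 := by
  apply Subtype.ext
  funext W
  apply LinearMap.ext
  intro f
  ext w
  exact glueFun_eq P hP (W.2.trans (le_iSup U i)) f w i le_rfl W.2 w.2

/-- The differential operator glued from compatible operators on the members of a cover. -/
def glueOp : DiffOp n (iSup U) :=
  ⟨glueEnd P hP, fun x hx => by
    obtain ⟨i, hi⟩ := Opens.mem_iSup.1 hx
    obtain ⟨W, h, hxW, hW⟩ := (P i).2 x hi
    refine ⟨W, h.trans (le_iSup U i), hxW, ?_⟩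
    rw [← res_glueEnd P hP i] at hW
    exact hW⟩

end Gluing

theorem diffOpPresheaf_isSheaf : (diffOpPresheaf n X).IsSheaf := by
  rw [TopCat.Presheaf.isSheaf_iff_isSheafUniqueGluing]
  intro ι U P hP
  have hP' : ∀ i j, DiffOp.res (inf_le_left : U i ⊓ U j ≤ U i) (P i : DiffOp n (X := X) (U i)) =
      DiffOp.res (inf_le_right : U i ⊓ U j ≤ U j) (P j : DiffOp n (X := X) (U j)) := hP
  refine ⟨glueOp (n := n) (X := X) P hP', fun i => Subtype.ext (res_glueEnd (n := n) P hP' i), ?_⟩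
  intro Q hQ
  have hQ' : ∀ i, DiffOp.res (n := n) (X := X) (le_iSup U i) Q = P i := hQ
  refine DiffOp.ext_act (n := n) (X := X) fun W hW f => ?_
  ext w
  obtain ⟨i, hi⟩ := Opens.mem_iSup.1 (hW w.2)
  refine Eq.trans ?_ (glueFun_eq (n := n) P hP' hW f w i (W' := W ⊓ U i) inf_le_left inf_le_right
    ⟨w.2, hi⟩).symm
  rw [← hQ' i]
  exact congrArg (fun g => g ⟨w.1, w.2, hi⟩)
    (DiffOp.act_res (n := n) (X := X) Q hW (inf_le_left : W ⊓ U i ≤ W) f)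

/-- The sheaf of rings `𝒟_X` of holomorphic differential operators. -/
def diffOpSheaf : Sheaf (Opens.grothendieckTopology (TopCat.of X)) RingCat.{u} :=
  ⟨diffOpPresheaf n X, diffOpPresheaf_isSheaf n X⟩

/-- The category of (left) `𝒟_X`-modules. -/
abbrev DModule : Type _ := SheafOfModules.{v} (diffOpSheaf n X)

end Operators

noncomputable section Coordinates

variable {n : ℕ} {X : Type u} [TopologicalSpace X] [ChartedSpace (Fin n → ℂ) X]

/-- The coordinate function `z_j` of a holomorphic chart `φ`. -/
def coord [IsManifold 𝓘(ℂ, Fin n → ℂ) ω X] (φ : OpenPartialHomeomorph X (Fin n → ℂ))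
    (hφ : φ ∈ IsManifold.maximalAtlas 𝓘(ℂ, Fin n → ℂ) ω X) {U : Opens X}
    (hU : (U : Set X) ⊆ φ.source) (j : Fin n) : Hol n U :=
  ⟨fun w => φ w.1 j, fun w => by
    have h1 : ContMDiffAt 𝓘(ℂ, Fin n → ℂ) 𝓘(ℂ, Fin n → ℂ) ω φ w.1 :=
      contMDiffAt_of_mem_maximalAtlas hφ (hU w.2)
    have h2 : ContMDiffAt 𝓘(ℂ, Fin n → ℂ) 𝓘(ℂ, ℂ) ω (fun y : X => φ y j) w.1 :=
      ((ContinuousLinearMap.proj (R := ℂ) (φ := fun _ : Fin n => ℂ)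
        j).contDiff.contMDiff.contMDiffAt).comp w.1 h1
    exact contMDiffAt_subtype_iff.2 h2⟩

/-- The extension by zero of a function on an open subset, read in a chart. -/
def inChart (φ : OpenPartialHomeomorph X (Fin n → ℂ)) {W : Opens X} (f : W → ℂ) :
    (Fin n → ℂ) → ℂ :=
  fun z => Function.extend Subtype.val f 0 (φ.symm z)

theorem inChart_contDiffAt [IsManifold 𝓘(ℂ, Fin n → ℂ) ω X]
    (φ : OpenPartialHomeomorph X (Fin n → ℂ))
    (hφ : φ ∈ IsManifold.maximalAtlas 𝓘(ℂ, Fin n → ℂ) ω X) {W : Opens X}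
    (hW : (W : Set X) ⊆ φ.source) (f : Hol n W) (w : W) :
    ContDiffAt ℂ ω (inChart φ f) (φ w.1) := by
  rw [← contMDiffAt_iff_contDiffAt]
  have e : (fun y : W => Function.extend Subtype.val f 0 y.1) = f := by
    funext y
    exact Subtype.val_injective.extend_apply f 0 y
  have h1 : ContMDiffAt 𝓘(ℂ, Fin n → ℂ) 𝓘(ℂ, ℂ) ω (Function.extend Subtype.val f 0) w.1 := by
    apply contMDiffAt_subtype_iff.1
    rw [e]
    exact f.contMDiff _
  have h2 : ContMDiffAt 𝓘(ℂ, Fin n → ℂ) 𝓘(ℂ, Fin n → ℂ) ω φ.symm (φ w.1) :=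
    contMDiffAt_symm_of_mem_maximalAtlas hφ (φ.map_source (hW w.2))
  refine ContMDiffAt.comp (φ w.1) ?_ h2
  rwa [φ.left_inv (hW w.2)]

set_option linter.unusedSectionVars false in
theorem inChart_eventuallyEq (φ : OpenPartialHomeomorph X (Fin n → ℂ)) {V W : Opens X}
    (hW : (W : Set X) ⊆ φ.source) (f : V → ℂ) (g : (Fin n → ℂ) → ℂ) (w : W) (hV : W ≤ V)
    (h : ∀ y : W, f ⟨y.1, hV y.2⟩ = g (φ y.1)) : inChart φ f =ᶠ[nhds (φ w.1)] g := by
  have h1 : φ.symm ⁻¹' (W : Set X) ∈ nhds (φ w.1) :=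
    (φ.continuousAt_symm (φ.map_source (hW w.2))).preimage_mem_nhds
      (by rw [φ.left_inv (hW w.2)]; exact W.2.mem_nhds w.2)
  filter_upwards [h1, φ.open_target.mem_nhds (φ.map_source (hW w.2))] with z hz hz'
  have h2 := h ⟨φ.symm z, hz⟩
  rw [φ.right_inv hz'] at h2
  rw [← h2]
  exact Subtype.val_injective.extend_apply f 0 (⟨φ.symm z, hV hz⟩ : V)

set_option linter.unusedSectionVars false in
theorem inChart_apply (φ : OpenPartialHomeomorph X (Fin n → ℂ)) {W : Opens X}
    (hW : (W : Set X) ⊆ φ.source) (f : W → ℂ) (w : W) : inChart φ f (φ w.1) = f w := by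
  rw [inChart, φ.left_inv (hW w.2)]
  exact Subtype.val_injective.extend_apply f 0 w

/-- The partial derivative `∂f/∂z_j` in a chart. -/
def partialFun (φ : OpenPartialHomeomorph X (Fin n → ℂ)) (j : Fin n) {W : Opens X} (f : W → ℂ)
    (w : W) : ℂ :=
  fderiv ℂ (inChart φ f) (φ w.1) (Pi.single j 1)

theorem partialFun_contMDiff [IsManifold 𝓘(ℂ, Fin n → ℂ) ω X]
    (φ : OpenPartialHomeomorph X (Fin n → ℂ))
    (hφ : φ ∈ IsManifold.maximalAtlas 𝓘(ℂ, Fin n → ℂ) ω X) (j : Fin n) {W : Opens X} (hW : (W : Set X) ⊆ φ.source) (f : Hol n W) :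
    ContMDiff 𝓘(ℂ, Fin n → ℂ) 𝓘(ℂ, ℂ) ω (partialFun φ j f) := by
  intro w
  have h1 : ContDiffAt ℂ ω (fun z => fderiv ℂ (inChart φ f) z (Pi.single j 1)) (φ w.1) :=
    ((inChart_contDiffAt φ hφ hW f w).fderiv_right (m := ω) le_rfl).clm_apply contDiffAt_const
  have h2 : ContMDiffAt 𝓘(ℂ, Fin n → ℂ) 𝓘(ℂ, Fin n → ℂ) ω φ w.1 :=
    contMDiffAt_of_mem_maximalAtlas hφ (hW w.2)
  exact contMDiffAt_subtype_iff.2 (h1.contMDiffAt.comp w.1 h2)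

theorem partialFun_congr (φ : OpenPartialHomeomorph X (Fin n → ℂ)) (j : Fin n) {V W : Opens X} (hW : (W : Set X) ⊆ φ.source) (hV : W ≤ V) (f : V → ℂ)
    (g : (Fin n → ℂ) → ℂ) (w : W) (h : ∀ y : W, f ⟨y.1, hV y.2⟩ = g (φ y.1)) :
    partialFun φ j f ⟨w.1, hV w.2⟩ = fderiv ℂ g (φ w.1) (Pi.single j 1) := by
  rw [partialFun, (inChart_eventuallyEq φ hW f g w hV h).fderiv_eq]

theorem inChart_differentiableAt [IsManifold 𝓘(ℂ, Fin n → ℂ) ω X]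
    (φ : OpenPartialHomeomorph X (Fin n → ℂ))
    (hφ : φ ∈ IsManifold.maximalAtlas 𝓘(ℂ, Fin n → ℂ) ω X) {W : Opens X}
    (hW : (W : Set X) ⊆ φ.source) (f : Hol n W)
    (w : W) : DifferentiableAt ℂ (inChart φ f) (φ w.1) :=
  (inChart_contDiffAt φ hφ hW f w).differentiableAt (by simp)

variable [IsManifold 𝓘(ℂ, Fin n → ℂ) ω X] (φ : OpenPartialHomeomorph X (Fin n → ℂ))
  (hφ : φ ∈ IsManifold.maximalAtlas 𝓘(ℂ, Fin n → ℂ) ω X) {U : Opens X}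
  (hU : (U : Set X) ⊆ φ.source) (j : Fin n)

/-- The vector field `∂/∂z_j` of a holomorphic chart `φ`, as an endomorphism of `𝒪_X|_U`. -/
def partialEnd : HolEnd n U :=
  ⟨fun W =>
    { toFun := fun f => ⟨partialFun φ j f,
        partialFun_contMDiff φ hφ j (Set.Subset.trans W.2 hU) f⟩
      map_add' := fun f g => by
        have hW : (W.1 : Set X) ⊆ φ.source := Set.Subset.trans W.2 hU
        ext w
        change partialFun φ j (f + g) w = partialFun φ j f w + partialFun φ j g w
        refine (partialFun_congr φ j hW le_rfl (f + g) (inChart φ f + inChart φ g) w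
          fun y => ?_).trans ?_
        · exact (congrArg₂ (· + ·) (inChart_apply φ hW f y) (inChart_apply φ hW g y)).symm
        · rw [fderiv_add (inChart_differentiableAt φ hφ hW f w)
            (inChart_differentiableAt φ hφ hW g w)]; rfl
      map_smul' := fun c f => by
        have hW : (W.1 : Set X) ⊆ φ.source := Set.Subset.trans W.2 hU
        ext w
        change partialFun φ j (c • f) w = c • partialFun φ j f w
        refine (partialFun_congr φ j hW le_rfl (c • f) (c • inChart φ f) w fun y => ?_).trans ?_
        · exact (congrArg (c • ·) (inChart_apply φ hW f y)).symm
        · rw [fderiv_const_smul (inChart_differentiableAt φ hφ hW f w)]; rfl },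
  fun V W h f => by
    have hW : (W.1 : Set X) ⊆ φ.source := Set.Subset.trans W.2 hU
    ext w
    refine (partialFun_congr φ j hW h f (inChart φ (Hol.res h f)) w fun y => ?_)
    rw [inChart_apply φ hW]; rfl⟩

theorem partialEnd_isVectorField : (partialEnd φ hφ hU j).IsVectorField := by
  intro W f g
  have hW : (W.1 : Set X) ⊆ φ.source := Set.Subset.trans W.2 hU
  ext w
  change partialFun φ j (f * g) w = f w * partialFun φ j g w + g w * partialFun φ j f w
  refine (partialFun_congr φ j hW le_rfl (f * g) (inChart φ f * inChart φ g) w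
    fun y => ?_).trans ?_
  · exact (congrArg₂ (· * ·) (inChart_apply φ hW f y) (inChart_apply φ hW g y)).symm
  · rw [fderiv_mul (inChart_differentiableAt φ hφ hW f w) (inChart_differentiableAt φ hφ hW g w)]
    simp only [add_apply, smul_apply,
      inChart_apply φ hW, smul_eq_mul]
    rfl

/-- The vector field `∂/∂z_j` of a holomorphic chart `φ`, as a differential operator. -/
def partialOp : DiffOp n U :=
  DiffOp.ofVectorField (partialEnd φ hφ hU j) (partialEnd_isVectorField φ hφ hU j)

end Coordinates

noncomputable section Divisors

/-- A holomorphic chart around `x` in which those `Z i` that pass through `x` are distinct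
coordinate hyperplanes. -/
structure AdaptedChart (n : ℕ) {X : Type u} [TopologicalSpace X] [ChartedSpace (Fin n → ℂ) X]
    {r : ℕ} (Z : Fin r → Set X) (x : X) where
  chart : OpenPartialHomeomorph X (Fin n → ℂ)
  mem_maximalAtlas : chart ∈ IsManifold.maximalAtlas 𝓘(ℂ, Fin n → ℂ) ω X
  mem_source : x ∈ chart.source
  idx : {i : Fin r // x ∈ Z i} ↪ Fin n
  mem_iff : ∀ i, ∀ y ∈ chart.source, y ∈ Z i.1 ↔ chart y (idx i) = 0

/-- A simple normal crossings divisor `D = D_1 ∪ ⋯ ∪ D_r` with irreducible components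
`D_1, …, D_r` (for smooth components, irreducible means connected). -/
structure SNCDivisor (n : ℕ) (X : Type u) [TopologicalSpace X] [ChartedSpace (Fin n → ℂ) X]
    (r : ℕ) where
  comp : Fin r → Set X
  isClosed_comp : ∀ i, IsClosed (comp i)
  isConnected_comp : ∀ i, IsConnected (comp i)
  exists_adaptedChart : ∀ x, Nonempty (AdaptedChart n comp x)

variable {n : ℕ} {X : Type u} [TopologicalSpace X] [ChartedSpace (Fin n → ℂ) X]

variable (n) in
/-- The ideal of holomorphic functions on `W` vanishing on `Z ∩ W`. -/
def vanishingIdeal (Z : Set X) (W : Opens X) : Ideal (Hol n W) where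
  carrier := {f | ∀ w : W, w.1 ∈ Z → f w = 0}
  zero_mem' := fun _ _ => rfl
  add_mem' := by
    intro f g hf hg w hw
    change f w + g w = 0
    rw [hf w hw, hg w hw, add_zero]
  smul_mem' := by
    intro c f hf w hw
    change c w * f w = 0
    rw [hf w hw, mul_zero]

/-- `f` is a section over `W` of the `m`-th power of the ideal sheaf of `Z`. -/
def VanishesToOrder (Z : Set X) (m : ℕ) {W : Opens X} (f : Hol n W) : Prop :=
  ∀ x ∈ W, ∃ (W' : Opens X) (h : W' ≤ W), x ∈ W' ∧ Hol.res h f ∈ vanishingIdeal n Z W' ^ m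

variable (n) in
/-- The sections over `U` of `V^k_Z 𝒟_X`: the operators mapping `I^m` to `I^(m + k)` for all `m ≥ 0`, where `I` is the
ideal sheaf of `Z` and `I^l = 𝒪_X` for `l ≤ 0`. -/
def vOpAlong (Z : Set X) (k : ℤ) (U : Opens X) : Set (DiffOp n U) :=
  {P | ∀ (W : Opens X) (h : W ≤ U) (m : ℕ) (f : Hol n W), VanishesToOrder Z m f →
    VanishesToOrder Z ((m : ℤ) + k).toNat (P.act h f)}

/-- `V^𝐤 𝒟_X = V^{k_1}_{D_1} 𝒟_X ∩ ⋯ ∩ V^{k_r}_{D_r} 𝒟_X`. -/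
def SNCDivisor.vOp {r : ℕ} (D : SNCDivisor n X r) (k : Fin r → ℤ) (U : Opens X) :
    Set (DiffOp n U) :=
  {P | ∀ i, P ∈ vOpAlong n (D.comp i) (k i) U}

variable [IsManifold 𝓘(ℂ, Fin n → ℂ) ω X] {r : ℕ} {Z : Fin r → Set X} {x : X}
  (c : AdaptedChart n Z x) {U : Opens X} (hU : (U : Set X) ⊆ c.chart.source)

/-- The operator `s_i = -∂_{t_i} t_i`, where `t_i` is the coordinate defining `Z i`. -/
def AdaptedChart.sOp (i : {i : Fin r // x ∈ Z i}) : DiffOp n U :=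
  -(partialOp c.chart c.mem_maximalAtlas hU (c.idx i) *
    DiffOp.mult (coord c.chart c.mem_maximalAtlas hU (c.idx i)))

open Classical in
/-- The operator `L(s) = ∑ L_i s_i`, the sum being over the components passing through `x`: these are
the components of the divisor near `x`, where `V^n_Z 𝒟_X = 𝒟_X` for the others. -/
def AdaptedChart.slopeOp (L : Fin r → ℚ) : DiffOp n U :=
  ∑ i : {i : Fin r // x ∈ Z i}, (L i.1 : ℂ) • c.sOp hU i

end Divisors

section Walls

variable {r : ℕ}

/-- The slopes of walls: nonzero vectors in `ℚ_{≥ 0}^r`. -/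
def IsSlope (L : Fin r → ℚ) : Prop := 0 ≤ L ∧ L ≠ 0

/-- The linear form `L(α) = ∑ L_i α_i`. -/
noncomputable def slopeForm (L : Fin r → ℚ) (α : Fin r → ℝ) : ℝ := ∑ i, (L i : ℝ) * α i

/-- The affine hyperplane `L⁻¹(γ)`. -/
def hyperplane (L : Fin r → ℚ) (γ : ℝ) : Set (Fin r → ℝ) := {α | slopeForm L α = γ}

/-- A set of walls in `ℝ^r`: a set of hyperplanes with slopes in `ℚ_{≥ 0}^r`, finite modulo
translation by `ℤ^r`. -/
def IsSetOfWalls (𝒲 : Set (Set (Fin r → ℝ))) : Prop :=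
  (∀ H ∈ 𝒲, ∃ (L : Fin r → ℚ) (γ : ℝ), IsSlope L ∧ H = hyperplane L γ) ∧
  ∃ F : Set (Set (Fin r → ℝ)), F.Finite ∧
    ∀ H ∈ 𝒲, ∃ H' ∈ F, ∃ m : Fin r → ℤ, H = (fun (α : Fin r → ℝ) i => α i + (m i : ℝ)) '' H'

/-- The chambers of a set of walls. -/
def IsChamber (𝒲 : Set (Set (Fin r → ℝ))) (σ : Set (Fin r → ℝ)) : Prop :=
  σ.Nonempty ∧ ∃ 𝒲pos 𝒲neg : Set (Set (Fin r → ℝ)),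
    𝒲pos ∪ 𝒲neg = 𝒲 ∧ Disjoint 𝒲pos 𝒲neg ∧
    σ = {α | ∀ (L : Fin r → ℚ) (γ : ℝ), IsSlope L →
      (hyperplane L γ ∈ 𝒲pos → γ < slopeForm L α) ∧
      (hyperplane L γ ∈ 𝒲neg → slopeForm L α ≤ γ)}

/-- The hyperplane `H` separates `α` and `β`. -/
def Separates (H : Set (Fin r → ℝ)) (α β : Fin r → ℝ) : Prop :=
  ∃ (L : Fin r → ℚ) (γ : ℝ), IsSlope L ∧ H = hyperplane L γ ∧
    ((slopeForm L α ≤ γ ∧ γ < slopeForm L β) ∨ (slopeForm L β ≤ γ ∧ γ < slopeForm L α))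

end Walls

noncomputable section Modules

variable {n : ℕ} {X : Type u} [TopologicalSpace X] [ChartedSpace (Fin n → ℂ) X]

/-- The sections of a `𝒟_X`-module over `U`. -/
def Sec (M : DModule.{u, v} n X) (U : Opens X) : Type v := M.val.obj (op (U : Opens (TopCat.of X)))

instance (M : DModule.{u, v} n X) (U : Opens X) : AddCommGroup (Sec M U) :=
  inferInstanceAs (AddCommGroup (M.val.obj (op (U : Opens (TopCat.of X)))))

instance (M : DModule.{u, v} n X) (U : Opens X) : Module (DiffOp n U) (Sec M U) :=
  inferInstanceAs (Module ((diffOpSheaf n X).obj.obj (op (U : Opens (TopCat.of X))))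
    (M.val.obj (op (U : Opens (TopCat.of X)))))

/-- Restriction of sections of a `𝒟_X`-module. -/
def Sec.res {M : DModule.{u, v} n X} {V W : Opens X} (h : W ≤ V) : Sec M V →+ Sec M W where
  toFun s := M.val.map (homOfLE h : (W : Opens (TopCat.of X)) ⟶ V).op s
  map_zero' := map_zero (M.val.map (homOfLE h : (W : Opens (TopCat.of X)) ⟶ V).op).hom
  map_add' := map_add (M.val.map (homOfLE h : (W : Opens (TopCat.of X)) ⟶ V).op).hom

theorem Sec.res_res {M : DModule.{u, v} n X} {U V W : Opens X} (h : V ≤ U) (h' : W ≤ V)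
    (s : Sec M U) : Sec.res h' (Sec.res h s) = Sec.res (h'.trans h) s :=
  (PresheafOfModules.map_comp_apply M.val (homOfLE h : (V : Opens (TopCat.of X)) ⟶ U).op
    (homOfLE h' : (W : Opens (TopCat.of X)) ⟶ V).op s).symm

/-- The action of a morphism of `𝒟_X`-modules on sections. -/
def Sec.map {M N : DModule.{u, v} n X} (f : M ⟶ N) (U : Opens X) :
    Sec M U →ₗ[DiffOp n U] Sec N U :=
  (f.val.app (op (U : Opens (TopCat.of X)))).hom

theorem Sec.res_map {M N : DModule.{u, v} n X} (f : M ⟶ N) {V W : Opens X} (h : W ≤ V)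
    (s : Sec M V) : Sec.res h (Sec.map f V s) = Sec.map f W (Sec.res h s) :=
  (PresheafOfModules.naturality_apply f.val (homOfLE h : (W : Opens (TopCat.of X)) ⟶ V).op s).symm

/-- A subsheaf (of abelian groups) of a `𝒟_X`-module. -/
@[ext]
structure Subsheaf (M : DModule.{u, v} n X) where
  sections : ∀ U : Opens X, AddSubgroup (Sec M U)
  res_mem : ∀ {V W : Opens X} (h : W ≤ V) {s : Sec M V}, s ∈ sections V → Sec.res h s ∈ sections W
  mem_of_local : ∀ {U : Opens X} {s : Sec M U},
    (∀ x ∈ U, ∃ (W : Opens X) (h : W ≤ U), x ∈ W ∧ Sec.res h s ∈ sections W) → s ∈ sections U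

namespace Subsheaf

variable {M N : DModule.{u, v} n X}

instance : Top (Subsheaf M) := ⟨⟨fun _ => ⊤, fun _ _ _ => trivial, fun _ => trivial⟩⟩

instance : Min (Subsheaf M) :=
  ⟨fun S T => ⟨fun U => S.sections U ⊓ T.sections U,
    fun h _ hs => ⟨S.res_mem h hs.1, T.res_mem h hs.2⟩,
    fun hs => ⟨S.mem_of_local fun x hx => by
        obtain ⟨W, h, hxW, hW⟩ := hs x hx
        exact ⟨W, h, hxW, hW.1⟩,
      T.mem_of_local fun x hx => by
        obtain ⟨W, h, hxW, hW⟩ := hs x hx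
        exact ⟨W, h, hxW, hW.2⟩⟩⟩⟩

/-- The image sheaf of a subsheaf under a morphism: the sections which locally are images of
sections. -/
def map (f : M ⟶ N) (S : Subsheaf M) : Subsheaf N where
  sections U :=
    { carrier := {t | ∀ x ∈ U, ∃ (W : Opens X) (h : W ≤ U), x ∈ W ∧
        ∃ s ∈ S.sections W, Sec.map f W s = Sec.res h t}
      zero_mem' := fun x hx => ⟨U, le_rfl, hx, 0, zero_mem _, by rw [map_zero, map_zero]⟩
      add_mem' := by
        intro t t' ht ht' x hx
        obtain ⟨W, h, hxW, s, hs, hst⟩ := ht x hx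
        obtain ⟨W', h', hxW', s', hs', hst'⟩ := ht' x hx
        have i1 : W ⊓ W' ≤ W := inf_le_left
        have i2 : W ⊓ W' ≤ W' := inf_le_right
        refine ⟨W ⊓ W', i1.trans h, ⟨hxW, hxW'⟩, Sec.res i1 s + Sec.res i2 s',
          add_mem (S.res_mem i1 hs) (S.res_mem i2 hs'), ?_⟩
        rw [map_add, map_add, ← Sec.res_map, ← Sec.res_map, hst, hst', Sec.res_res, Sec.res_res]
      neg_mem' := by
        intro t ht x hx
        obtain ⟨W, h, hxW, s, hs, hst⟩ := ht x hx
        exact ⟨W, h, hxW, -s, neg_mem hs, by rw [map_neg, map_neg, hst]⟩ }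
  res_mem := by
    intro V W h t ht x hx
    obtain ⟨W', h', hxW', s, hs, hst⟩ := ht x (h hx)
    have i1 : W' ⊓ W ≤ W' := inf_le_left
    refine ⟨W' ⊓ W, inf_le_right, ⟨hxW', hx⟩, Sec.res i1 s, S.res_mem i1 hs, ?_⟩
    rw [← Sec.res_map, hst, Sec.res_res, Sec.res_res]
  mem_of_local := by
    intro U t ht x hx
    obtain ⟨W, h, hxW, hW⟩ := ht x hx
    obtain ⟨W', h', hxW', s, hs, hst⟩ := hW x hxW
    exact ⟨W', h'.trans h, hxW', s, hs, by rw [hst, Sec.res_res]⟩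

/-- The restrictions of two subsheaves to the open set `U` agree. -/
def EqOn (S T : Subsheaf M) (U : Opens X) : Prop :=
  ∀ W : Opens X, W ≤ U → S.sections W = T.sections W

/-- `S` is of finite type over the sheaf of subrings `B` of `𝒟_X`. -/
def IsFiniteTypeOver (B : ∀ U : Opens X, Set (DiffOp n U)) (S : Subsheaf M) : Prop :=
  ∀ x : X, ∃ U : Opens X, x ∈ U ∧ ∃ (k : ℕ) (g : Fin k → Sec M U), (∀ a, g a ∈ S.sections U) ∧
    ∀ (V : Opens X) (hV : V ≤ U), ∀ s ∈ S.sections V, ∀ y ∈ V,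
      ∃ (W : Opens X) (hW : W ≤ V), y ∈ W ∧ ∃ c : Fin k → DiffOp n W, (∀ a, c a ∈ B W) ∧
        Sec.res hW s = ∑ a, c a • Sec.res (hW.trans hV) (g a)

/-- For all finite families of sections of `S` over open sets, the sheaf of relations between
them with coefficients in `B` is of finite type over `B`. -/
def HasFiniteTypeRelationsOver (B : ∀ U : Opens X, Set (DiffOp n U)) (S : Subsheaf M) : Prop :=
  ∀ (U : Opens X) (k : ℕ) (g : Fin k → Sec M U), (∀ a, g a ∈ S.sections U) → ∀ x ∈ U,
    ∃ (U' : Opens X) (hU' : U' ≤ U), x ∈ U' ∧ ∃ (l : ℕ) (R : Fin l → Fin k → DiffOp n U'),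
      (∀ b a, R b a ∈ B U') ∧ (∀ b, ∑ a, R b a • Sec.res hU' (g a) = 0) ∧
      ∀ (V : Opens X) (hV : V ≤ U') (c : Fin k → DiffOp n V), (∀ a, c a ∈ B V) →
        ∑ a, c a • Sec.res (hV.trans hU') (g a) = 0 → ∀ y ∈ V,
          ∃ (W : Opens X) (hW : W ≤ V), y ∈ W ∧ ∃ d : Fin l → DiffOp n W, (∀ b, d b ∈ B W) ∧
            ∀ a, DiffOp.res hW (c a) = ∑ b, d b * DiffOp.res (hW.trans hV) (R b a)

/-- `S` is a coherent module over the sheaf of subrings `B` of `𝒟_X`. -/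
def IsCoherentOver (B : ∀ U : Opens X, Set (DiffOp n U)) (S : Subsheaf M) : Prop :=
  (∀ (U : Opens X), ∀ P ∈ B U, ∀ s ∈ S.sections U, P • s ∈ S.sections U) ∧
  S.IsFiniteTypeOver B ∧ S.HasFiniteTypeRelationsOver B

end Subsheaf

/-- Coherent `𝒟_X`-modules. -/
def IsCoherentDModule (M : DModule.{u, v} n X) : Prop :=
  (⊤ : Subsheaf M).IsCoherentOver fun _ => Set.univ

/-- Decreasing `ℝ^r`-indexed filtrations of a `𝒟_X`-module by subsheaves. -/
@[ext]
structure Filtration (r : ℕ) (M : DModule.{u, v} n X) where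
  step : (Fin r → ℝ) → Subsheaf M
  antitone : ∀ {α β : Fin r → ℝ}, α ≤ β → ∀ U : Opens X,
    (step β).sections U ≤ (step α).sections U

namespace Filtration

variable {r : ℕ} {M : DModule.{u, v} n X} (F : Filtration r M)

/-- `𝒲` is a set of walls of the restriction of the filtration to `U`. -/
def HasWallsOn (𝒲 : Set (Set (Fin r → ℝ))) (U : Opens X) : Prop :=
  IsSetOfWalls 𝒲 ∧
  ∀ σ, IsChamber 𝒲 σ → ∀ α ∈ σ, ∀ β ∈ σ, (F.step α).EqOn (F.step β) U

/-- Wall and chamber filtrations: locally on `X`, there is a set of walls. -/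
def IsWallAndChamber : Prop :=
  ∀ x : X, ∃ U : Opens X, x ∈ U ∧ ∃ 𝒲, F.HasWallsOn 𝒲 U

/-- `F` is exhaustive: every section of `M` is locally a section of some step of `F`. -/
def IsExhaustive : Prop :=
  ∀ (U : Opens X) (s : Sec M U), ∀ x ∈ U, ∃ (W : Opens X) (h : W ≤ U), x ∈ W ∧
    ∃ α, Sec.res h s ∈ (F.step α).sections W

/-- On `U`, the filtration is generated over `V^• 𝒟_X` by its restriction to `[A, B]^r`. -/
def IsGeneratedOn (D : SNCDivisor n X r) (A B : ℝ) (U : Opens X) : Prop :=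
  ∀ (α : Fin r → ℝ) (U' : Opens X), U' ≤ U → ∀ s : Sec M U',
    s ∈ (F.step α).sections U' ↔ ∀ x ∈ U', ∃ (W : Opens X) (h : W ≤ U'), x ∈ W ∧
      Sec.res h s ∈ AddSubgroup.closure {t : Sec M W | ∃ (k : Fin r → ℤ) (γ : Fin r → ℝ),
        (∀ i, γ i ∈ Set.Icc A B) ∧ (∀ i, α i ≤ (k i : ℝ) + γ i) ∧
        ∃ P ∈ D.vOp k W, ∃ w ∈ (F.step γ).sections W, t = P • w}

/-- Good wall and chamber filtrations over `V^• 𝒟_X`. -/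
structure IsGood (D : SNCDivisor n X r) : Prop where
  isWallAndChamber : F.IsWallAndChamber
  isExhaustive : F.IsExhaustive
  smul_mem : ∀ (k : Fin r → ℤ) (α : Fin r → ℝ) (U : Opens X), ∀ P ∈ D.vOp k U,
    ∀ s ∈ (F.step α).sections U, P • s ∈ (F.step fun i => (k i : ℝ) + α i).sections U
  isCoherent : ∀ α, (F.step α).IsCoherentOver (D.vOp 0)
  isGenerated : ∀ x : X, ∃ U : Opens X, x ∈ U ∧ ∃ A B : ℝ, F.IsGeneratedOn D A B U

/-- The eigenvalue condition: if `α ≤ β` are separated by a single wall `L⁻¹(γ)`, then locally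
`V^α / V^β` is annihilated by a product of operators `L(s) + γ_j` with `Re γ_j = γ`. -/
def EigenvalueCondition [IsManifold 𝓘(ℂ, Fin n → ℂ) ω X] (D : SNCDivisor n X r) : Prop :=
  ∀ (U : Opens X) (𝒲 : Set (Set (Fin r → ℝ))), F.HasWallsOn 𝒲 U →
    ∀ (α β : Fin r → ℝ) (L : Fin r → ℚ) (γ : ℝ), α ≤ β → IsSlope L →
      hyperplane L γ ∈ 𝒲 → Separates (hyperplane L γ) α β →
      (∀ H ∈ 𝒲, Separates H α β → H = hyperplane L γ) →
      ∀ x ∈ U, ∀ c : AdaptedChart n D.comp x,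
        ∃ (U' : Opens X) (_ : U' ≤ U) (hc : (U' : Set X) ⊆ c.chart.source), x ∈ U' ∧
          ∃ γs : List ℂ, (∀ z ∈ γs, z.re = γ) ∧
            ∀ (W : Opens X) (hW : W ≤ U'), ∀ s ∈ (F.step α).sections W,
              DiffOp.res hW
                  (γs.map fun z => c.slopeOp hc L + algebraMap ℂ (DiffOp n U') z).prod • s ∈
                (F.step β).sections W

/-- Multivariate `V`-filtrations along `D`. -/
structure IsMultivariateV [IsManifold 𝓘(ℂ, Fin n → ℂ) ω X] (D : SNCDivisor n X r) : Prop where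
  isGood : F.IsGood D
  eigenvalue : F.EigenvalueCondition D

end Filtration

end Modules

end MultiV

/-! Subsheaves and image sheaves are determined by their stalks. So it suffices to prove, at each
point `x`, that the stalk map `φ : M_x → N_x` satisfies `φ(V^α M_x) = φ(M_x) ∩ V^α N_x`. Uniqueness
is the inclusion `φ(V^α) ⊆ V^α` for the identity of a module with two filtrations, used in both
directions. The stalk statement combines two independent facts.

Comparability up to a shift. There is a constant `c` with `φ(V^α M_x) ⊆ V^(α-c) N_x` and `φ(M_x) ∩
V^α N_x ⊆ φ(V^(α-c) M_x)` for all `α`. The first inclusion only needs finitely many generators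
(`GoodFamily.exists_map_mem`). The second is an Artin-Rees argument (`GoodFamily.exists_mem_map`)
and needs the Rees ring `⨁ V^k 𝒟_x u^k` to be noetherian (`VData.rees_isNoetherianRing`). That ring
is generated over `𝒪_x` by the `u_i⁻¹`, the `t_i u_i` and the derivations in their degrees, with
commutators small enough for a noncommutative Hilbert basis theorem. `𝒪_x` itself is noetherian by
division of convergent power series (`exists_division`, `convSeries_isNoetherianRing`).

Removal of the shift. The operators `s_i` commute, and polynomials in them preserve every step of
the filtrations. Fix `z` with one complex coordinate for each component through `x`, and put `ξ =
-Re z`. Crossing a wall `L = γ` upwards is achieved by `∏ (L(s) + γ_j)`. Each factor has real part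
`γ - L(ξ)` at `z`, so the product is nonzero there unless the wall contains `ξ`. Moving down, or
inside a chamber, costs nothing. Hence one can pass from `V^p` to `V^q` by a polynomial not
vanishing at `z` whenever no wall through `ξ` has to be crossed upwards (`rel_of_not_crossed`,
`Filtration.IsMultivariateV.hasPaths`).

Given `α`, move away from `ξ` along the ray to `α + K(α - ξ)`, change filtration at the cost of the
shift `c`, and return to `α`. For large `K` no wall through `ξ` is crossed upwards (`HasPaths.le`).
So for every `z` some polynomial nonzero at `z` sends a given element of the first filtration into
step `α` of the second. The polynomials with this property form an ideal without zeros, which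
contains `1` by the Nullstellensatz (`mem_of_forall_eval_ne_zero`). -/

open scoped ENNReal

namespace MultiV

/-! ### Convergent power series: division and noetherianity -/

noncomputable section ConvergentSeries

open MvPowerSeries Filter

variable {σ : Type*} (w : σ → ℝ)

/-- The value of the monomial with exponent `b` at the point with coordinates `exp (-s w_i)`. -/
def monomialSize (s : ℝ) (b : σ →₀ ℕ) : ℝ≥0∞ := ENNReal.ofReal (Real.exp (-s * Finsupp.weight w b))

theorem monomialSize_add (s : ℝ) (a b : σ →₀ ℕ) :
    monomialSize w s (a + b) = monomialSize w s a * monomialSize w s b := by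
  rw [monomialSize, monomialSize, monomialSize, ← ENNReal.ofReal_mul (Real.exp_pos _).le,
    ← Real.exp_add, map_add, mul_add]

theorem monomialSize_zero (s : ℝ) : monomialSize w s 0 = 1 := by simp [monomialSize]

theorem monomialSize_ne_zero (s : ℝ) (b : σ →₀ ℕ) : monomialSize w s b ≠ 0 := by
  simp [monomialSize, Real.exp_pos]

theorem monomialSize_ne_top (s : ℝ) (b : σ →₀ ℕ) : monomialSize w s b ≠ ⊤ := ENNReal.ofReal_ne_top

/-- The weighted `ℓ¹`-norm of a power series, for the polyradius `exp (-s w_i)`. -/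
def seriesNorm (s : ℝ) (f : MvPowerSeries σ ℂ) : ℝ≥0∞ := ∑' b, ‖coeff b f‖ₑ * monomialSize w s b

theorem le_seriesNorm (s : ℝ) (f : MvPowerSeries σ ℂ) (b : σ →₀ ℕ) :
    ‖coeff b f‖ₑ * monomialSize w s b ≤ seriesNorm w s f :=
  ENNReal.le_tsum (f := fun b => ‖coeff b f‖ₑ * monomialSize w s b) b

theorem seriesNorm_add_le (s : ℝ) (f g : MvPowerSeries σ ℂ) :
    seriesNorm w s (f + g) ≤ seriesNorm w s f + seriesNorm w s g := by
  rw [seriesNorm, seriesNorm, seriesNorm, ← ENNReal.tsum_add]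
  refine ENNReal.tsum_le_tsum fun b => ?_
  rw [← add_mul, map_add]
  gcongr
  exact enorm_add_le _ _

theorem seriesNorm_zero (s : ℝ) : seriesNorm w s 0 = 0 := by simp [seriesNorm]

theorem seriesNorm_neg (s : ℝ) (f : MvPowerSeries σ ℂ) :
    seriesNorm w s (-f) = seriesNorm w s f := by simp [seriesNorm]

theorem seriesNorm_sum_le {ι : Type*} (t : Finset ι) (s : ℝ) (f : ι → MvPowerSeries σ ℂ) :
    seriesNorm w s (∑ i ∈ t, f i) ≤ ∑ i ∈ t, seriesNorm w s (f i) := by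
  classical
  induction t using Finset.induction_on with
  | empty => simp [seriesNorm_zero]
  | insert i t hi ih =>
    rw [Finset.sum_insert hi, Finset.sum_insert hi]
    exact (seriesNorm_add_le w s _ _).trans (add_le_add_right ih _)

theorem seriesNorm_monomial (s : ℝ) (a : σ →₀ ℕ) (c : ℂ) :
    seriesNorm w s (monomial a c) = ‖c‖ₑ * monomialSize w s a := by
  classical
  rw [seriesNorm, tsum_eq_single a]
  · rw [coeff_monomial_same]
  · intro b hb
    rw [coeff_monomial_ne hb, enorm_zero, zero_mul]

/-- `monomialSize` is multiplicative in the exponent, so the Cauchy product is bounded by the double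
sum regrouped along antidiagonals. Values in `ℝ≥0∞` make the regrouping unconditional. -/
theorem seriesNorm_mul_le (s : ℝ) (f g : MvPowerSeries σ ℂ) :
    seriesNorm w s (f * g) ≤ seriesNorm w s f * seriesNorm w s g := by
  classical
  calc seriesNorm w s (f * g)
      ≤ ∑' b, ∑' p : Finset.HasAntidiagonal.antidiagonal b, (‖coeff p.1.1 f‖ₑ * monomialSize w s p.1.1) *
          (‖coeff p.1.2 g‖ₑ * monomialSize w s p.1.2) := by
        refine ENNReal.tsum_le_tsum fun b => ?_
        rw [tsum_fintype, coeff_mul, ← Finset.sum_coe_sort]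
        refine (mul_le_mul_left (enorm_sum_le _ _) _).trans ?_
        rw [Finset.sum_mul]
        refine Finset.sum_le_sum fun p _ => ?_
        have hp : p.1.1 + p.1.2 = b := Finset.HasAntidiagonal.mem_antidiagonal.1 p.2
        rw [enorm_mul, show monomialSize w s b = _ from hp ▸ monomialSize_add w s p.1.1 p.1.2]
        exact (mul_mul_mul_comm _ _ _ _).le
    _ = ∑' p : (σ →₀ ℕ) × (σ →₀ ℕ), (‖coeff p.1 f‖ₑ * monomialSize w s p.1) *
          (‖coeff p.2 g‖ₑ * monomialSize w s p.2) := by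
        rw [← ENNReal.tsum_sigma' fun x : (b : σ →₀ ℕ) × Finset.HasAntidiagonal.antidiagonal b =>
          (‖coeff x.2.1.1 f‖ₑ * monomialSize w s x.2.1.1) *
          (‖coeff x.2.1.2 g‖ₑ * monomialSize w s x.2.1.2)]
        exact (Finset.HasAntidiagonal.sigmaAntidiagonalEquivProd (A := σ →₀ ℕ)).tsum_eq
          (fun p : (σ →₀ ℕ) × (σ →₀ ℕ) => (‖coeff p.1 f‖ₑ * monomialSize w s p.1) *
          (‖coeff p.2 g‖ₑ * monomialSize w s p.2))
    _ = seriesNorm w s f * seriesNorm w s g := by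
        rw [ENNReal.tsum_prod (f := fun a b => (‖coeff a f‖ₑ * monomialSize w s a) *
          (‖coeff b g‖ₑ * monomialSize w s b)), seriesNorm, seriesNorm, ← ENNReal.tsum_mul_right]
        refine tsum_congr fun a => ?_
        rw [ENNReal.tsum_mul_left]

variable {w} (hw : ∀ i, 0 < w i)

include hw in
theorem weight_nonneg (b : σ →₀ ℕ) : 0 ≤ Finsupp.weight w b := by
  rw [Finsupp.weight_apply]
  exact Finset.sum_nonneg fun i _ => smul_nonneg (Nat.zero_le _) (hw i).le

include hw in
-- Increasing `s` shrinks the polydisc. Hence finitely many convergent series have finite norm for a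
-- common `s`, which may be enlarged at will.
theorem seriesNorm_anti (f : MvPowerSeries σ ℂ) : Antitone fun s => seriesNorm w s f := by
  intro s t h
  refine ENNReal.tsum_le_tsum fun b => ?_
  gcongr
  refine ENNReal.ofReal_le_ofReal (Real.exp_le_exp.2 ?_)
  have := weight_nonneg hw b
  nlinarith

/-- The ring of convergent power series. -/
def convSeries : Subring (MvPowerSeries σ ℂ) where
  carrier := {f | ∃ s, seriesNorm w s f < ⊤}
  zero_mem' := ⟨0, by simp [seriesNorm_zero]⟩
  one_mem' := ⟨0, by
    change seriesNorm w 0 (monomial 0 1) < ⊤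
    rw [seriesNorm_monomial]; simp [monomialSize_zero]⟩
  add_mem' := by
    rintro f g ⟨s, hs⟩ ⟨t, ht⟩
    exact ⟨max s t, (seriesNorm_add_le w _ _ _).trans_lt (ENNReal.add_lt_top.2
      ⟨(seriesNorm_anti hw f (le_max_left _ _)).trans_lt hs,
        (seriesNorm_anti hw g (le_max_right _ _)).trans_lt ht⟩)⟩
  neg_mem' := by
    rintro f ⟨s, hs⟩
    exact ⟨s, by rwa [seriesNorm_neg]⟩
  mul_mem' := by
    rintro f g ⟨s, hs⟩ ⟨t, ht⟩
    exact ⟨max s t, (seriesNorm_mul_le w _ _ _).trans_lt (ENNReal.mul_lt_top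
      ((seriesNorm_anti hw f (le_max_left _ _)).trans_lt hs)
      ((seriesNorm_anti hw g (le_max_right _ _)).trans_lt ht))⟩

theorem monomial_mem_convSeries (a : σ →₀ ℕ) (c : ℂ) : monomial a c ∈ convSeries hw :=
  ⟨0, by
    rw [seriesNorm_monomial]
    exact ENNReal.mul_lt_top (by simp) (monomialSize_ne_top w 0 a).lt_top⟩

include hw in
theorem eventually_seriesNorm_lt_top {f : MvPowerSeries σ ℂ} (hf : f ∈ convSeries hw) :
    ∀ᶠ s in atTop, seriesNorm w s f < ⊤ := by
  obtain ⟨s, hs⟩ := hf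
  filter_upwards [eventually_ge_atTop s] with t ht
  exact (seriesNorm_anti hw f ht).trans_lt hs

include hw in
theorem finite_weight_le [Finite σ] (C : ℝ) : {b : σ →₀ ℕ | Finsupp.weight w b ≤ C}.Finite := by
  classical
  have := Fintype.ofFinite σ
  refine (Set.finite_Iic (Finsupp.equivFunOnFinite.symm fun i => ⌊C / w i⌋₊)).subset ?_
  intro b hb i
  refine (Nat.le_floor ?_ : b i ≤ ⌊C / w i⌋₊)
  rw [le_div_iff₀ (hw i)]
  refine le_trans ?_ hb
  rw [Finsupp.weight_eq_sum]
  simp only [nsmul_eq_mul]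
  exact Finset.single_le_sum (f := fun i => (b i : ℝ) * w i)
    (fun i _ => mul_nonneg (Nat.cast_nonneg _) (hw i).le) (Finset.mem_univ i)

include hw in
theorem exists_min_weight [Finite σ] {f : MvPowerSeries σ ℂ} (hf : f ≠ 0) :
    ∃ a, coeff a f ≠ 0 ∧ ∀ b, coeff b f ≠ 0 → Finsupp.weight w a ≤ Finsupp.weight w b := by
  obtain ⟨b, hb⟩ : ∃ b, coeff b f ≠ 0 := by
    by_contra! h
    exact hf (MvPowerSeries.ext h)
  obtain ⟨a, ha, h⟩ := Set.exists_min_image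
    {a : σ →₀ ℕ | Finsupp.weight w a ≤ Finsupp.weight w b ∧ coeff a f ≠ 0} (Finsupp.weight w)
    ((finite_weight_le hw _).subset fun _ h => h.1) ⟨b, le_rfl, hb⟩
  refine ⟨a, ha.2, fun c hc => ?_⟩
  rcases le_total (Finsupp.weight w c) (Finsupp.weight w b) with h' | h'
  · exact h c ⟨h', hc⟩
  · exact ha.1.trans h'

variable (w) in
/-- `a` is the initial exponent of `f`: the exponent of smallest weight. -/
def IsInitial (f : MvPowerSeries σ ℂ) (a : σ →₀ ℕ) : Prop :=
  coeff a f ≠ 0 ∧ ∀ b, coeff b f ≠ 0 → b ≠ a → Finsupp.weight w a < Finsupp.weight w b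

include hw in
-- Injectivity of the weight makes the part of least weight a single monomial.
theorem exists_isInitial [Finite σ] (hinj : Function.Injective (Finsupp.weight w : (σ →₀ ℕ) → ℝ))
    {f : MvPowerSeries σ ℂ} (hf : f ≠ 0) : ∃ a, IsInitial w f a := by
  obtain ⟨a, ha, h⟩ := exists_min_weight hw hf
  exact ⟨a, ha, fun b hb hne => lt_of_le_of_ne (h b hb) fun e => hne (hinj e.symm)⟩

include hw in
-- The other exponents have weight at least some `weight b > weight a`, so as `s → ∞` the rest
-- decays like `exp (-s * weight b)`, faster than the initial monomial. On small polydiscs a series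
-- is its initial term up to a small relative error; this drives both the division and the identity
-- theorem.
theorem eventually_seriesNorm_sub_le [Finite σ] {f : MvPowerSeries σ ℂ} (hf : f ∈ convSeries hw)
    {a : σ →₀ ℕ} (ha : IsInitial w f a) {ε : ℝ≥0∞} (hε : ε ≠ 0) :
    ∀ᶠ s in atTop, seriesNorm w s (f - monomial a (coeff a f)) ≤ ε * monomialSize w s a := by
  classical
  set p := f - monomial a (coeff a f) with hp
  rcases eq_or_ne p 0 with h0 | h0
  · simp [h0, seriesNorm_zero]
  obtain ⟨b, hb, hmin⟩ := exists_min_weight hw h0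
  obtain ⟨s₁, hs₁⟩ : p ∈ convSeries hw := sub_mem hf (monomial_mem_convSeries hw _ _)
  have hab : Finsupp.weight w a < Finsupp.weight w b := by
    have hne : b ≠ a := by
      rintro rfl
      simp [hp] at hb
    refine ha.2 b ?_ hne
    rwa [hp, map_sub, coeff_monomial_ne hne, sub_zero] at hb
  have hlim : Tendsto (fun t : ℝ => ENNReal.ofReal
      (Real.exp (-((t - s₁) * (Finsupp.weight w b - Finsupp.weight w a)))) *
      (seriesNorm w s₁ p / monomialSize w s₁ a)) atTop (nhds 0) := by
    rw [show (0 : ℝ≥0∞) = ENNReal.ofReal 0 * (seriesNorm w s₁ p / monomialSize w s₁ a) by simp]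
    refine ENNReal.Tendsto.mul_const (ENNReal.tendsto_ofReal ?_)
      (Or.inr (ENNReal.div_lt_top hs₁.ne (monomialSize_ne_zero w _ _)).ne)
    refine Real.tendsto_exp_neg_atTop_nhds_zero.comp ?_
    exact Tendsto.atTop_mul_const (sub_pos.2 hab) (tendsto_atTop_add_const_right _ _ tendsto_id)
  filter_upwards [hlim.eventually (eventually_le_nhds (pos_iff_ne_zero.2 hε)),
    eventually_ge_atTop s₁] with t ht hts
  -- Every exponent of `p` has weight at least that of `b`, so passing from `s₁` to `t` multiplies
  -- each term by at most this exponential.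
  have h1 : seriesNorm w t p ≤
      ENNReal.ofReal (Real.exp (-((t - s₁) * Finsupp.weight w b))) * seriesNorm w s₁ p := by
    rw [seriesNorm, seriesNorm, ← ENNReal.tsum_mul_left]
    refine ENNReal.tsum_le_tsum fun c => ?_
    rcases eq_or_ne (coeff c p) 0 with hc | hc
    · simp [hc]
    rw [mul_left_comm]
    gcongr
    rw [monomialSize, monomialSize, ← ENNReal.ofReal_mul (Real.exp_pos _).le, ← Real.exp_add]
    refine ENNReal.ofReal_le_ofReal (Real.exp_le_exp.2 ?_)
    nlinarith [hmin c hc]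
  have h2 : monomialSize w t a = ENNReal.ofReal (Real.exp (-((t - s₁) * Finsupp.weight w a))) *
      monomialSize w s₁ a := by
    rw [monomialSize, monomialSize, ← ENNReal.ofReal_mul (Real.exp_pos _).le, ← Real.exp_add]
    congr 2; ring
  refine h1.trans ?_
  rw [h2]
  refine le_trans (le_of_eq ?_) (mul_le_mul_left ht _)
  rw [mul_sub, neg_sub, sub_eq_neg_add (_ * _), Real.exp_add, ENNReal.ofReal_mul (Real.exp_pos _).le]
  have h3 : ENNReal.ofReal (Real.exp ((t - s₁) * Finsupp.weight w a)) *
      ENNReal.ofReal (Real.exp (-((t - s₁) * Finsupp.weight w a))) = 1 := by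
    rw [← ENNReal.ofReal_mul (Real.exp_pos _).le, ← Real.exp_add]; simp
  have h4 : seriesNorm w s₁ p / monomialSize w s₁ a * monomialSize w s₁ a = seriesNorm w s₁ p :=
    ENNReal.div_mul_cancel (monomialSize_ne_zero w _ _) (monomialSize_ne_top w _ _)
  calc _ = ENNReal.ofReal (Real.exp (-((t - s₁) * Finsupp.weight w b))) *
        (seriesNorm w s₁ p / monomialSize w s₁ a * monomialSize w s₁ a) *
        (ENNReal.ofReal (Real.exp ((t - s₁) * Finsupp.weight w a)) *
      ENNReal.ofReal (Real.exp (-((t - s₁) * Finsupp.weight w a)))) := by rw [h3, h4, mul_one]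
    _ = _ := by ring

/-- The series whose coefficient at `b` is the coefficient of `f` at `a + b` if `a + b ∈ A`. -/
def shiftSeries (A : Set (σ →₀ ℕ)) (a : σ →₀ ℕ) (f : MvPowerSeries σ ℂ) : MvPowerSeries σ ℂ :=
  fun b => A.indicator (fun c => coeff c f) (a + b)

theorem coeff_shiftSeries (A : Set (σ →₀ ℕ)) (a : σ →₀ ℕ) (f : MvPowerSeries σ ℂ) (b : σ →₀ ℕ) :
    coeff b (shiftSeries A a f) = A.indicator (fun c => coeff c f) (a + b) := rfl

theorem coeff_monomial_mul_shiftSeries (A : Set (σ →₀ ℕ)) (a : σ →₀ ℕ) (f : MvPowerSeries σ ℂ)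
    (hA : ∀ b ∈ A, a ≤ b) (b : σ →₀ ℕ) :
    coeff b (monomial a 1 * shiftSeries A a f) = A.indicator (fun c => coeff c f) b := by
  classical
  rw [coeff_monomial_mul, one_mul]
  split_ifs with h
  · rw [coeff_shiftSeries, add_tsub_cancel_of_le h]
  · rw [Set.indicator_of_notMem fun h' => h (hA b h')]

variable (w) in
-- The indicator of `A` is kept on the right because for disjoint sets `A` these bounds add up to at
-- most the norm of `f`. This makes the contraction factor in `exists_division` independent of the
-- number of divisors.
theorem monomialSize_mul_seriesNorm_shiftSeries_le (s : ℝ) (A : Set (σ →₀ ℕ)) (a : σ →₀ ℕ)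
    (f : MvPowerSeries σ ℂ) : monomialSize w s a * seriesNorm w s (shiftSeries A a f) ≤
      ∑' b, A.indicator (fun b => ‖coeff b f‖ₑ * monomialSize w s b) b := by
  classical
  rw [seriesNorm, ← ENNReal.tsum_mul_left]
  refine le_trans (ENNReal.tsum_le_tsum fun b => ?_) (ENNReal.tsum_comp_le_tsum_of_injective
    (add_right_injective a) _)
  rw [coeff_shiftSeries]
  by_cases h : a + b ∈ A
  · simp only [Set.indicator_of_mem h]
    rw [monomialSize_add, mul_left_comm]
  · simp [Set.indicator_of_notMem h]

variable (w) in
theorem seriesNorm_shiftSeries_le (s : ℝ) (A : Set (σ →₀ ℕ)) (a : σ →₀ ℕ)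
    (f : MvPowerSeries σ ℂ) :
    seriesNorm w s (shiftSeries A a f) ≤ (monomialSize w s a)⁻¹ * seriesNorm w s f := by
  rw [mul_comm, ← div_eq_mul_inv, ENNReal.le_div_iff_mul_le (Or.inl (monomialSize_ne_zero w s a))
    (Or.inl (monomialSize_ne_top w s a)), mul_comm]
  refine (monomialSize_mul_seriesNorm_shiftSeries_le w s A a f).trans ?_
  exact ENNReal.tsum_le_tsum fun b => Set.indicator_le_self' (by simp) b

/-- Completeness: the norm controls each coefficient up to a nonzero factor, so norm-summable series
converge coefficientwise, and the triangle inequality bounds the norm of the limit. -/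
theorem hasSum_coeff_of_seriesNorm {h : ℕ → MvPowerSeries σ ℂ} {s : ℝ}
    (hs : ∑' k, seriesNorm w s (h k) ≠ ⊤) :
    ∃ H : MvPowerSeries σ ℂ, seriesNorm w s H < ⊤ ∧
      ∀ b, HasSum (fun k => coeff b (h k)) (coeff b H) := by
  have h1 : ∀ b, ∑' k, ‖coeff b (h k)‖ₑ ≠ ⊤ := by
    intro b hb
    have h2 : (∑' k, ‖coeff b (h k)‖ₑ) * monomialSize w s b ≤ ∑' k, seriesNorm w s (h k) := by
      rw [← ENNReal.tsum_mul_right]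
      exact ENNReal.tsum_le_tsum fun k => le_seriesNorm w s (h k) b
    rw [hb, ENNReal.top_mul (monomialSize_ne_zero w s b)] at h2
    exact hs (top_le_iff.1 h2)
  have h3 : ∀ b, Summable fun k => coeff b (h k) := fun b => by
    refine Summable.of_norm ?_
    have := ENNReal.summable_toReal (h1 b)
    simpa using this
  refine ⟨fun b => ∑' k, coeff b (h k), ?_, fun b => (h3 b).hasSum⟩
  refine lt_of_le_of_lt ?_ hs.lt_top
  simp only [seriesNorm]
  rw [ENNReal.tsum_comm]
  refine ENNReal.tsum_le_tsum fun b => ?_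
  rw [ENNReal.tsum_mul_right]
  gcongr
  exact enorm_tsum_le_tsum_enorm

/-- Division of a convergent power series by convergent power series with given initial
exponents. -/
theorem exists_division [Finite σ] {ι : Type*} [Fintype ι] (g : ι → MvPowerSeries σ ℂ)
    (hg : ∀ i, g i ∈ convSeries hw) (a : ι → σ →₀ ℕ) (ha : ∀ i, IsInitial w (g i) (a i))
    (hone : ∀ i, coeff (a i) (g i) = 1) {f : MvPowerSeries σ ℂ} (hf : f ∈ convSeries hw) :
    ∃ (q : ι → MvPowerSeries σ ℂ) (r : MvPowerSeries σ ℂ), (∀ i, q i ∈ convSeries hw) ∧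
      f = ∑ i, g i * q i + r ∧ ∀ b i, a i ≤ b → coeff b r = 0 := by
  classical
  -- Each exponent is assigned to at most one divisor, so that the parts `Q i` and `P` below split a
  -- series without overlap; `none` marks the exponents left to the remainder.
  obtain ⟨c, hc⟩ : ∃ c : (σ →₀ ℕ) → Option ι, ∀ b, (∀ i, c b = some i → a i ≤ b) ∧
      (c b = none → ∀ i, ¬ a i ≤ b) := by
    refine ⟨fun b => if h : ∃ i, a i ≤ b then some h.choose else none, fun b => ?_⟩
    by_cases h : ∃ i, a i ≤ b
    · simp only [h, ↓reduceDIte, Option.some.injEq, reduceCtorEq, false_implies, and_true]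
      rintro i rfl
      exact h.choose_spec
    · simp only [h, ↓reduceDIte, reduceCtorEq, false_implies, implies_true, true_and]
      exact fun _ i hi => h ⟨i, hi⟩
  set Q : ι → MvPowerSeries σ ℂ → MvPowerSeries σ ℂ :=
    fun i => shiftSeries {b | c b = some i} (a i) with hQ
  set P : MvPowerSeries σ ℂ → MvPowerSeries σ ℂ := shiftSeries {b | c b = none} 0 with hP
  set p : ι → MvPowerSeries σ ℂ := fun i => g i - monomial (a i) 1 with hp
  have hdec : ∀ h, h = ∑ i, monomial (a i) 1 * Q i h + P h := by
    intro h
    ext b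
    rw [map_add, map_sum, hP, coeff_shiftSeries, zero_add]
    simp only [hQ]
    rw [Finset.sum_congr rfl fun i _ => coeff_monomial_mul_shiftSeries {b | c b = some i} (a i) h
      (fun b hb => (hc b).1 i hb) b]
    rcases hcb : c b with - | i
    · simp [Set.indicator, hcb]
    · simp [Set.indicator, hcb]
  -- For `s` large every tail `p i` has norm at most half of its initial monomial, which makes `h ↦
  -- -∑ p i * Q i h` contract by `1/2`.
  obtain ⟨s, hs1, hs2⟩ : ∃ s, (∀ i, seriesNorm w s (p i) ≤ 2⁻¹ * monomialSize w s (a i)) ∧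
      seriesNorm w s f < ⊤ := by
    refine (Eventually.and (eventually_all.2 fun i => ?_)
      (eventually_seriesNorm_lt_top hw hf)).exists
    have := eventually_seriesNorm_sub_le hw (hg i) (ha i) (ε := 2⁻¹) (by simp)
    rwa [hone] at this
  -- Division by the initial monomials alone is exact by `hdec`. Using their quotients with the true
  -- divisors `g i` leaves an error, which is divided again; `F k` is the error after `k` rounds.
  set F : ℕ → MvPowerSeries σ ℂ := fun k => (fun h => -∑ i, p i * Q i h)^[k] f with hF
  have hF0 : F 0 = f := rfl
  have hF1 : ∀ k, F (k + 1) = -∑ i, p i * Q i (F k) := fun k => by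
    simp only [hF, Function.iterate_succ_apply']
  have hnorm : ∀ h, seriesNorm w s (-∑ i, p i * Q i h) ≤ 2⁻¹ * seriesNorm w s h := by
    intro h
    rw [seriesNorm_neg]
    refine (seriesNorm_sum_le w _ _ _).trans ?_
    calc ∑ i, seriesNorm w s (p i * Q i h)
        ≤ ∑ i, 2⁻¹ * (monomialSize w s (a i) * seriesNorm w s (Q i h)) := by
          refine Finset.sum_le_sum fun i _ => ?_
          rw [← mul_assoc]
          exact (seriesNorm_mul_le w _ _ _).trans (mul_le_mul_left (hs1 i) _)
      _ ≤ ∑ i, 2⁻¹ * ∑' b, {b | c b = some i}.indicator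
            (fun b => ‖coeff b h‖ₑ * monomialSize w s b) b := by
          gcongr with i _
          exact monomialSize_mul_seriesNorm_shiftSeries_le w _ _ _ _
      _ ≤ 2⁻¹ * seriesNorm w s h := by
          rw [← Finset.mul_sum]
          gcongr
          rw [← Summable.tsum_finsetSum fun i _ => ENNReal.summable]
          refine ENNReal.tsum_le_tsum fun b => ?_
          rcases hcb : c b with - | i
          · simp [Set.indicator, hcb]
          · simp [Set.indicator, hcb]
  have hFn : ∀ k, seriesNorm w s (F k) ≤ 2⁻¹ ^ k * seriesNorm w s f := by
    intro k
    induction k with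
    | zero => simp [hF0]
    | succ k ih =>
      rw [hF1, pow_succ', mul_assoc]
      exact (hnorm _).trans (mul_le_mul_right ih _)
  have hFs : ∑' k, seriesNorm w s (F k) ≠ ⊤ := by
    refine ne_top_of_le_ne_top ?_ (ENNReal.tsum_le_tsum hFn)
    rw [ENNReal.tsum_mul_right, ENNReal.tsum_geometric]
    exact ENNReal.mul_ne_top (by simp) hs2.ne
  have hsh : ∀ A b, ∑' k, seriesNorm w s (shiftSeries A b (F k)) ≠ ⊤ := by
    intro A b
    refine ne_top_of_le_ne_top ?_ (ENNReal.tsum_le_tsum fun k =>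
      seriesNorm_shiftSeries_le w s A b (F k))
    rw [ENNReal.tsum_mul_left]
    exact ENNReal.mul_ne_top (ENNReal.inv_ne_top.2 (monomialSize_ne_zero w _ _)) hFs
  choose q hq1 hq2 using fun i => hasSum_coeff_of_seriesNorm (hsh {b | c b = some i} (a i))
  obtain ⟨r, hr1, hr2⟩ := hasSum_coeff_of_seriesNorm (hsh {b | c b = none} 0)
  obtain ⟨S, -, hS⟩ := hasSum_coeff_of_seriesNorm hFs
  refine ⟨q, r, fun i => ⟨s, hq1 i⟩, ?_, ?_⟩
  · ext b
    -- Summed over `k`, the left side telescopes to `f` and the right side gives quotients and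
    -- remainder.
    have hstep : ∀ k, F k - F (k + 1) = ∑ i, g i * Q i (F k) + P (F k) := by
      intro k
      rw [hF1, sub_neg_eq_add]
      nth_rewrite 1 [hdec (F k)]
      have : ∀ i, g i = monomial (a i) 1 + p i := fun i => by simp [hp]
      simp only [this, add_mul, Finset.sum_add_distrib]
      abel
    have h1 : HasSum (fun k => coeff b (F k - F (k + 1))) (coeff b f) := by
      have e1 := hS b
      have e2 := (hasSum_nat_add_iff' 1).2 (hS b)
      have := e1.sub e2
      simpa [hF0] using this
    have h2 : HasSum (fun k => coeff b (F k - F (k + 1))) (coeff b (∑ i, g i * q i + r)) := by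
      simp only [hstep, map_add, map_sum, coeff_mul]
      refine HasSum.add (hasSum_sum fun i _ => hasSum_sum fun x _ => ?_) (hr2 b)
      exact (hq2 i x.2).mul_left _
    exact h1.unique h2
  · intro b i hi
    have : ∀ k, coeff b (shiftSeries {b | c b = none} 0 (F k)) = 0 := by
      intro k
      rw [coeff_shiftSeries, zero_add, Set.indicator_of_notMem]
      exact fun h => (hc b).2 h i hi
    have h0 := hr2 b
    simp only [this] at h0
    exact h0.unique hasSum_zero

/-- A standard basis argument. Elements of the ideal with the minimal initial exponents generate it:
dividing by them leaves a remainder in the ideal, and if it were nonzero its initial exponent would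
dominate a minimal one, which division excludes. -/
theorem convSeries_isNoetherianRing [Finite σ]
    (hinj : Function.Injective (Finsupp.weight w : (σ →₀ ℕ) → ℝ)) :
    IsNoetherianRing (convSeries hw) := by
  classical
  rw [isNoetherianRing_iff_ideal_fg]
  intro I
  set E : Set (σ →₀ ℕ) := {a | ∃ f ∈ I, IsInitial w f.1 a} with hE
  -- Dickson's lemma: antichains of exponents are finite.
  have hfin : {a | Minimal (· ∈ E) a}.Finite :=
    WellQuasiOrderedLE.finite_of_isAntichain (setOfPred_minimal_antichain _)
  have := hfin.fintype
  have hgen : ∀ a : {a | Minimal (· ∈ E) a}, ∃ g ∈ I, IsInitial w g.1 a.1 ∧ coeff a.1 g.1 = 1 := by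
    rintro ⟨a, ⟨f, hf, hfa⟩, -⟩
    refine ⟨⟨_, monomial_mem_convSeries hw 0 (coeff a f.1)⁻¹⟩ * f, I.mul_mem_left _ hf, ?_⟩
    have hc : ∀ b, coeff b (monomial 0 (coeff a f.1)⁻¹ * f.1) = (coeff a f.1)⁻¹ * coeff b f.1 :=
      fun b => coeff_C_mul _ _ _
    have h0 := inv_ne_zero hfa.1
    refine ⟨⟨?_, fun b hb => ?_⟩, ?_⟩
    · change coeff a (monomial 0 (coeff a f.1)⁻¹ * f.1) ≠ 0
      rw [hc]
      exact mul_ne_zero h0 hfa.1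
    · change coeff b (monomial 0 (coeff a f.1)⁻¹ * f.1) ≠ 0 at hb
      rw [hc] at hb
      exact hfa.2 b (right_ne_zero_of_mul hb)
    · change coeff a (monomial 0 (coeff a f.1)⁻¹ * f.1) = 1
      rw [hc]
      exact inv_mul_cancel₀ hfa.1
  choose g hgI hg1 hg2 using hgen
  refine ⟨Finset.univ.image g, le_antisymm ?_ ?_⟩
  · rw [Ideal.span_le]
    intro x hx
    obtain ⟨i, -, rfl⟩ := Finset.mem_image.1 (Finset.mem_coe.1 hx)
    exact hgI i
  · intro f hf
    obtain ⟨q, r, hq, hfr, hr⟩ := exists_division hw (fun i => (g i).1) (fun i => (g i).2)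
      (fun i => i.1) hg1 hg2 f.2
    have hsum : (∑ i, g i * ⟨q i, hq i⟩) ∈ Ideal.span (Finset.univ.image g : Set (convSeries hw)) :=
      sum_mem fun i _ => Ideal.mul_mem_right _ _
        (Ideal.subset_span (Finset.mem_coe.2 (Finset.mem_image_of_mem g (Finset.mem_univ i))))
    have hsum' : (∑ i, g i * ⟨q i, hq i⟩) ∈ I := sum_mem fun i _ => Ideal.mul_mem_right _ _ (hgI i)
    have hval : r = (f - ∑ i, g i * ⟨q i, hq i⟩ : convSeries hw).1 := by
      simp [hfr]
    have hr0 : r = 0 := by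
      by_contra h0
      obtain ⟨b, hb⟩ := exists_isInitial hw hinj h0
      have hbE : b ∈ E := ⟨f - ∑ i, g i * ⟨q i, hq i⟩, sub_mem hf hsum', by rwa [← hval]⟩
      obtain ⟨a, hab, ha⟩ := exists_minimal_le_of_wellFoundedLT (· ∈ E) b hbE
      exact hb.1 (hr b ⟨a, ha⟩ hab)
    have : f = ∑ i, g i * ⟨q i, hq i⟩ := by
      rw [← sub_eq_zero]
      exact Subtype.ext (hval.symm.trans hr0)
    rw [this]
    exact hsum

/-- Weights for which different exponents have different weights. -/
theorem exists_injective_weight (n : ℕ) : ∃ w : Fin n → ℝ, (∀ i, 0 < w i) ∧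
    Function.Injective (Finsupp.weight w : (Fin n →₀ ℕ) → ℝ) := by
  -- `ℝ` has dimension continuum over `ℚ`. The absolute values of independent reals still separate
  -- exponents, since the signs can be moved into the rational coefficients.
  obtain ⟨v, hv⟩ : ∃ v : Fin n → ℝ, LinearIndependent ℚ v := by
    rw [← Module.le_rank_iff, Real.rank_rat_real]
    exact (Cardinal.nat_lt_continuum n).le
  refine ⟨fun i => |v i|, fun i => abs_pos.2 (hv.ne_zero i), fun a b hab => ?_⟩
  rw [Finsupp.weight_eq_sum, Finsupp.weight_eq_sum, ← sub_eq_zero, ← Finset.sum_sub_distrib] at hab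
  have hv0 := fun i => hv.ne_zero i
  rw [Fintype.linearIndependent_iff] at hv
  have h := hv (fun i => ((a i : ℚ) - b i) * SignType.sign (v i)) (by
    rw [← hab]
    refine Finset.sum_congr rfl fun i _ => ?_
    rw [Rat.smul_def, nsmul_eq_mul, nsmul_eq_mul, ← sub_mul, ← sign_mul_self]
    push_cast
    rw [mul_assoc]
    congr 2
    rcases lt_trichotomy (v i) 0 with h | h | h <;> simp [h])
  ext i
  rcases mul_eq_zero.1 (h i) with h | h
  · exact_mod_cast sub_eq_zero.1 h
  · exfalso
    have hne : v i ≠ 0 := hv0 i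
    rcases lt_or_gt_of_ne hne with h' | h' <;> simp [h'] at h

end ConvergentSeries

/-! ### Hilbert's basis theorem for noncommutative extensions -/

section HilbertBasis

open Polynomial

variable {A B : Type*} [Ring A] [Ring B]

/-- Moving `x` past the left coefficients replaces `a x^k` by `a x^(k+1) + δ(a) x^k`. The correction
`q` collects the second terms and so does not exceed the degree of `p`. -/
theorem exists_eval₂_eq_commutator_mul (i : A →+* B) (x : B)
    (hx : ∀ a, ∃ a', x * i a = i a * x + i a') (p : A[X]) :
    ∃ q : A[X], (∀ k : ℕ, p.degree < k → q.degree < k) ∧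
      x * p.eval₂ i x = (p * X + q).eval₂ i x := by
  choose δ hδ using hx
  refine ⟨∑ k ∈ p.support, monomial k (δ (p.coeff k)), fun k hk => ?_, ?_⟩
  · rw [← mem_degreeLT]
    refine sum_mem fun j hj => mem_degreeLT.2 ?_
    exact (degree_monomial_le _ _).trans_lt ((le_degree_of_mem_supp j hj).trans_lt hk)
  · rw [eval₂_add, eval₂_mul_X, eval₂_finsetSum]
    simp only [eval₂_monomial]
    conv_lhs => rw [eval₂_eq_sum, Polynomial.sum_def, Finset.mul_sum]
    rw [eval₂_eq_sum, Polynomial.sum_def, Finset.sum_mul, ← Finset.sum_add_distrib]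
    refine Finset.sum_congr rfl fun k _ => ?_
    rw [← mul_assoc, hδ, add_mul, mul_assoc, mul_assoc, ← pow_succ, ← pow_succ']

/-- The left ideal of coefficients of `x ^ k` of those elements of `J` which can be written as
polynomials in `x` of degree at most `k` with left coefficients in `A`. -/
def leadingCoeffIdeal (i : A →+* B) (x : B) (J : Ideal B) (k : ℕ) : Ideal A where
  carrier := {a | ∃ p : A[X], p.degree < (k + 1 : ℕ) ∧ p.coeff k = a ∧ p.eval₂ i x ∈ J}
  zero_mem' := ⟨0, by simp, by simp, by simp⟩
  add_mem' := by
    rintro _ _ ⟨p, hp, rfl, hpJ⟩ ⟨q, hq, rfl, hqJ⟩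
    exact ⟨p + q, (degree_add_le _ _).trans_lt (max_lt hp hq), coeff_add _ _ _, by
      rw [eval₂_add]; exact add_mem hpJ hqJ⟩
  smul_mem' := by
    rintro a _ ⟨p, hp, rfl, hpJ⟩
    refine ⟨a • p, (degree_smul_le _ _).trans_lt hp, by simp, ?_⟩
    have : (a • p).eval₂ i x = i a * p.eval₂ i x := by
      rw [eval₂_eq_sum, eval₂_eq_sum, Polynomial.sum_smul_index _ _ _ (by simp), Polynomial.sum_def,
        Polynomial.sum_def, Finset.mul_sum]
      simp [mul_assoc]
    rw [this]
    exact J.mul_mem_left _ hpJ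

theorem leadingCoeffIdeal_mono (i : A →+* B) (x : B) {J J' : Ideal B} (h : J ≤ J') (k : ℕ) :
    leadingCoeffIdeal i x J k ≤ leadingCoeffIdeal i x J' k :=
  fun _ ⟨p, h1, h2, h3⟩ => ⟨p, h1, h2, h h3⟩

/-- Left multiplication by `x` raises the degree by one and keeps the leading coefficient; the
commutator correction has too low a degree to interfere. -/
theorem leadingCoeffIdeal_succ (i : A →+* B) (x : B)
    (hx : ∀ a, ∃ a', x * i a = i a * x + i a') (J : Ideal B) :
    Monotone (leadingCoeffIdeal i x J) := by
  refine monotone_nat_of_le_succ fun k => ?_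
  rintro _ ⟨p, hp, rfl, hpJ⟩
  obtain ⟨q, hq, hpq⟩ := exists_eval₂_eq_commutator_mul i x hx p
  have hq' := hq _ hp
  refine ⟨p * X + q, ?_, ?_, ?_⟩
  · refine (degree_add_le _ _).trans_lt (max_lt ?_ (hq'.trans (by exact_mod_cast Nat.lt_succ_self _)))
    refine (degree_mul_le _ _).trans_lt ?_
    rcases eq_or_ne p 0 with rfl | hp0
    · simp
    · have : p.natDegree < k + 1 := by
        rw [degree_eq_natDegree hp0] at hp; exact_mod_cast hp
      refine (add_le_add_right degree_X_le _).trans_lt ?_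
      rw [degree_eq_natDegree hp0]
      exact_mod_cast Nat.succ_lt_succ this
  · rw [coeff_add, coeff_mul_X, coeff_eq_zero_of_degree_lt hq', add_zero]
  · rw [← hpq]
    exact J.mul_mem_left _ hpJ

/-- Induction on the degree: subtract from an element of `J'` an element of `J` with the same
leading coefficient. -/
theorem eq_of_leadingCoeffIdeal_eq (i : A →+* B) (x : B)
    (hsurj : ∀ b : B, ∃ p : A[X], p.eval₂ i x = b) {J J' : Ideal B} (h : J ≤ J')
    (hk : ∀ k, leadingCoeffIdeal i x J' k ≤ leadingCoeffIdeal i x J k) : J = J' := by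
  refine le_antisymm h fun b hb => ?_
  have key : ∀ (k : ℕ) (p : A[X]), p.degree < k → p.eval₂ i x ∈ J' → p.eval₂ i x ∈ J := by
    intro k
    induction k with
    | zero =>
      intro p hp _
      have : p = 0 := by
        rw [← degree_eq_bot]
        exact (Nat.WithBot.lt_zero_iff).1 (by exact_mod_cast hp)
      simp [this]
    | succ k ih =>
      intro p hp hpJ
      obtain ⟨q, hq, hqp, hqJ⟩ := hk k ⟨p, hp, rfl, hpJ⟩
      have hd : (p - q).degree < k := by
        rw [degree_lt_iff_coeff_zero]
        intro m hm
        rcases hm.eq_or_lt with rfl | hm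
        · simp [hqp]
        · rw [coeff_sub, coeff_eq_zero_of_degree_lt (hp.trans_le (by exact_mod_cast hm)),
            coeff_eq_zero_of_degree_lt (hq.trans_le (by exact_mod_cast hm)), sub_zero]
      have e : p.eval₂ i x = (p - q).eval₂ i x + q.eval₂ i x := by rw [← eval₂_add, sub_add_cancel]
      have hs : (p - q).eval₂ i x ∈ J' := by
        rw [show (p - q).eval₂ i x = p.eval₂ i x - q.eval₂ i x by rw [e]; simp]
        exact sub_mem hpJ (h hqJ)
      rw [e]
      exact add_mem (ih _ hd hs) hqJ
  obtain ⟨p, rfl⟩ := hsurj b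
  exact key (p.natDegree + 1) p (degree_le_natDegree.trans_lt (by exact_mod_cast Nat.lt_succ_self _)) hb

/-- A version of Hilbert's basis theorem for extensions of noncommutative rings generated by an
element which normalizes the smaller ring. -/
theorem isNoetherianRing_of_eval₂_surjective [IsNoetherianRing A] (i : A →+* B) (x : B)
    (hx : ∀ a, ∃ a', x * i a = i a * x + i a')
    (hsurj : ∀ b : B, ∃ p : A[X], p.eval₂ i x = b) : IsNoetherianRing B := by
  refine monotone_stabilizes_iff_noetherian.1 fun J => ?_
  have hA := monotone_stabilizes_iff_noetherian.2 (inferInstance : IsNoetherian A A)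
  have m2 := fun k => leadingCoeffIdeal_succ i x hx (J k)
  have m1 : ∀ k, Monotone fun l => leadingCoeffIdeal i x (J l) k :=
    fun k a b hab => leadingCoeffIdeal_mono i x (J.monotone hab) k
  -- The diagonal chain stabilizes at `n`, which settles all degrees `k ≥ n` at once. The finitely
  -- many degrees below `n` have their own stabilization indices `m k`.
  obtain ⟨n, hn⟩ := hA ⟨fun l => leadingCoeffIdeal i x (J l) l,
    fun a b hab => (m1 a hab).trans (m2 b hab)⟩
  choose m hm using fun k => hA ⟨_, m1 k⟩
  set N := max n ((Finset.range n).sup m) with hN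
  refine ⟨N, fun l hl => eq_of_leadingCoeffIdeal_eq i x hsurj (J.monotone hl) fun k => ?_⟩
  rcases lt_or_ge k n with hk | hk
  · have h1 : m k ≤ N := (Finset.le_sup (f := m) (Finset.mem_range.2 hk)).trans (le_max_right _ _)
    exact ((hm k l (h1.trans hl)).symm.trans (hm k N h1)).le
  · have h1 : n ≤ N := le_max_left _ _
    calc leadingCoeffIdeal i x (J l) k
        ≤ leadingCoeffIdeal i x (J (max l k)) (max l k) :=
          (m1 k (le_max_left _ _)).trans (m2 _ (le_max_right _ _))
      _ = leadingCoeffIdeal i x (J n) n := (hn _ (hk.trans (le_max_right _ _))).symm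
      _ ≤ leadingCoeffIdeal i x (J N) n := m1 n h1
      _ ≤ leadingCoeffIdeal i x (J N) k := m2 N hk

end HilbertBasis

/-! ### Adjoining finitely many elements with controlled commutators -/

section Adjoin

variable {T : Type*} [Ring T]

/-- The commutator condition allows all coefficients to be moved to the left of `x`, so every
element of the closure is a polynomial in `x` and the basis theorem applies. -/
theorem closure_insert_isNoetherianRing (A : Subring T) [IsNoetherianRing A] (x : T)
    (hx : ∀ a ∈ A, x * a - a * x ∈ A) :
    IsNoetherianRing (Subring.closure (insert x (A : Set T))) := by
  set B := Subring.closure (insert x (A : Set T)) with hB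
  have hAB : A ≤ B := fun a ha => Subring.subset_closure (Set.mem_insert_of_mem _ ha)
  have hxB : x ∈ B := Subring.subset_closure (Set.mem_insert _ _)
  set i : A →+* B := Subring.inclusion hAB
  set x' : B := ⟨x, hxB⟩
  have hx' : ∀ a, ∃ a', x' * i a = i a * x' + i a' := fun a =>
    ⟨⟨_, hx a.1 a.2⟩, Subtype.ext (by change x * a.1 = a.1 * x + (x * a.1 - a.1 * x); abel)⟩
  refine isNoetherianRing_of_eval₂_surjective i x' hx' ?_
  have hl : ∀ (a : A) (p : Polynomial A), ∃ q : Polynomial A, i a * p.eval₂ i x' = q.eval₂ i x' := by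
    intro a p
    refine ⟨a • p, ?_⟩
    rw [Polynomial.eval₂_eq_sum, Polynomial.eval₂_eq_sum,
      Polynomial.sum_smul_index _ _ _ (by simp), Polynomial.sum_def,
        Polynomial.sum_def, Finset.mul_sum]
    simp [mul_assoc]
  have hlx : ∀ (p : Polynomial A), ∃ q : Polynomial A, x' * p.eval₂ i x' = q.eval₂ i x' := by
    intro p
    obtain ⟨q, -, hq⟩ := exists_eval₂_eq_commutator_mul i x' hx' p
    exact ⟨_, hq⟩
  -- Quantifying over the right factor `p` lets the induction pass through products; at the end `p =
  -- 1`.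
  have key : ∀ t (ht : t ∈ B), ∀ p : Polynomial A, ∃ q : Polynomial A,
      (⟨t, ht⟩ : B) * p.eval₂ i x' = q.eval₂ i x' := by
    intro t ht
    induction ht using Subring.closure_induction with
    | mem t h =>
      rcases h with rfl | h
      · exact hlx
      · exact hl ⟨t, h⟩
    | zero => exact fun p => ⟨0, by rw [Polynomial.eval₂_zero]; exact zero_mul _⟩
    | one => exact fun p => ⟨p, one_mul _⟩
    | add s t hs ht h1 h2 =>
      intro p
      obtain ⟨q1, e1⟩ := h1 p
      obtain ⟨q2, e2⟩ := h2 p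
      refine ⟨q1 + q2, ?_⟩
      rw [Polynomial.eval₂_add, ← e1, ← e2, ← add_mul]; rfl
    | neg s hs h1 =>
      intro p
      obtain ⟨q1, e1⟩ := h1 p
      refine ⟨-q1, ?_⟩
      rw [Polynomial.eval₂_neg, ← e1, ← neg_mul]; rfl
    | mul s t hs ht h1 h2 =>
      intro p
      obtain ⟨q2, e2⟩ := h2 p
      obtain ⟨q1, e1⟩ := h1 q2
      refine ⟨q1, ?_⟩
      rw [← e1, ← e2, ← mul_assoc]; rfl
  intro b
  obtain ⟨q, hq⟩ := key b.1 b.2 1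
  exact ⟨q, by rw [← hq, Polynomial.eval₂_one, mul_one]⟩

/-- Commutation with `y` is a derivation, so it preserves a subring as soon as it maps generators
into it. -/
theorem commutator_mem_closure {s : Set T} (y : T)
    (h : ∀ a ∈ s, y * a - a * y ∈ Subring.closure s) :
    ∀ a ∈ Subring.closure s, y * a - a * y ∈ Subring.closure s := by
  intro a ha
  induction ha using Subring.closure_induction with
  | mem t ht => exact h t ht
  | zero => simp
  | one => simp
  | add s t hs ht h1 h2 =>
    rw [show y * (s + t) - (s + t) * y = (y * s - s * y) + (y * t - t * y) by noncomm_ring]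
    exact add_mem h1 h2
  | neg s hs h1 =>
    rw [show y * (-s) - (-s) * y = -(y * s - s * y) by noncomm_ring]
    exact neg_mem h1
  | mul s t hs ht h1 h2 =>
    rw [show y * (s * t) - (s * t) * y = (y * s - s * y) * t + s * (y * t - t * y) by noncomm_ring]
    exact add_mem (mul_mem h1 ht) (mul_mem hs h2)

/-- The elements are adjoined one at a time. Commutators within the list lie in the smallest ring
`A`, so the hypotheses persist after each enlargement. -/
theorem closure_list_isNoetherianRing (l : List T) : ∀ (A : Subring T) [IsNoetherianRing A],
    (∀ x ∈ l, ∀ a ∈ A, x * a - a * x ∈ A) → (∀ x ∈ l, ∀ y ∈ l, x * y - y * x ∈ A) →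
    IsNoetherianRing (Subring.closure ((A : Set T) ∪ {x | x ∈ l})) := by
  induction l with
  | nil =>
    intro A _ _ _
    have : Subring.closure ((A : Set T) ∪ {x | x ∈ ([] : List T)}) = A := by simp
    rw [this]; infer_instance
  | cons y l ih =>
    intro A _ h1 h2
    have := closure_insert_isNoetherianRing A y (h1 y (by simp))
    have hA : A ≤ Subring.closure (insert y (A : Set T)) :=
      fun a ha => Subring.subset_closure (Set.mem_insert_of_mem _ ha)
    have h := ih (Subring.closure (insert y (A : Set T)))
      (fun x hx => commutator_mem_closure x (by
        rintro a (rfl | ha)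
        · exact hA (h2 x (by simp [hx]) a (by simp))
        · exact hA (h1 x (by simp [hx]) a ha)))
      (fun x hx z hz => hA (h2 x (by simp [hx]) z (by simp [hz])))
    have e : Subring.closure ((A : Set T) ∪ {x | x ∈ y :: l}) = Subring.closure
        ((Subring.closure (insert y (A : Set T)) : Set T) ∪ {x | x ∈ l}) := ?_
    · rwa [e]
    rw [Subring.closure_union, Subring.closure_eq, Subring.closure_union, Subring.closure_eq]
    apply le_antisymm
    · refine sup_le (hA.trans le_sup_left) (Subring.closure_le.2 ?_)
      intro x hx
      rcases List.mem_cons.1 hx with rfl | hx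
      · exact (le_sup_left : Subring.closure (insert x (A : Set T)) ≤ _)
          (Subring.subset_closure (Set.mem_insert _ _))
      · exact (le_sup_right : Subring.closure {x | x ∈ l} ≤ _) (Subring.subset_closure hx)
    · refine sup_le (Subring.closure_le.2 ?_) ?_
      · rintro x (rfl | hx)
        · exact (le_sup_right : Subring.closure {z | z ∈ x :: l} ≤ _)
            (Subring.subset_closure (by simp))
        · exact (le_sup_left : A ≤ _) hx
      · refine le_trans (Subring.closure_mono ?_) le_sup_right
        intro x hx
        exact List.mem_cons_of_mem _ hx

end Adjoin

/-! ### Walls, chambers and generic paths -/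

section WallPaths

open Filter Topology

variable {r : ℕ}

theorem slopeForm_add (L : Fin r → ℚ) (α β : Fin r → ℝ) :
    slopeForm L (α + β) = slopeForm L α + slopeForm L β := by
  simp [slopeForm, mul_add, Finset.sum_add_distrib]

theorem slopeForm_smul (L : Fin r → ℚ) (t : ℝ) (α : Fin r → ℝ) :
    slopeForm L (t • α) = t * slopeForm L α := by
  simp only [slopeForm, Pi.smul_apply, smul_eq_mul, Finset.mul_sum]
  exact Finset.sum_congr rfl fun i _ => by ring

theorem slopeForm_neg (L : Fin r → ℚ) (α : Fin r → ℝ) : slopeForm L (-α) = -slopeForm L α := by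
  simp [slopeForm]

theorem slopeForm_sub (L : Fin r → ℚ) (α β : Fin r → ℝ) :
    slopeForm L (α - β) = slopeForm L α - slopeForm L β := by
  rw [sub_eq_add_neg, slopeForm_add, slopeForm_neg, sub_eq_add_neg]

theorem continuous_slopeForm (L : Fin r → ℚ) : Continuous (slopeForm L) :=
  continuous_finsetSum _ fun i _ => continuous_const.mul (continuous_apply i)

theorem slopeForm_mono {L : Fin r → ℚ} (hL : IsSlope L) : Monotone (slopeForm L) := by
  intro α β h
  refine Finset.sum_le_sum fun i _ => mul_le_mul_of_nonneg_left (h i) ?_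
  exact_mod_cast hL.1 i

theorem slopeForm_one_pos {L : Fin r → ℚ} (hL : IsSlope L) : 0 < slopeForm L 1 := by
  obtain ⟨i, hi⟩ := Function.ne_iff.1 hL.2
  refine Finset.sum_pos' (fun j _ => ?_) ⟨i, Finset.mem_univ i, ?_⟩
  · simpa using hL.1 j
  · have := lt_of_le_of_ne (hL.1 i) (Ne.symm hi)
    simpa using this

/-- The side of a wall is expressed through the hyperplane as a set and the direction `(1, …, 1)`,
which every slope sees positively. Hence it does not depend on the equation chosen for the wall. -/
theorem lt_slopeForm_iff {L : Fin r → ℚ} (hL : IsSlope L) (γ : ℝ) (α : Fin r → ℝ) :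
    γ < slopeForm L α ↔ ∃ t : ℝ, t < 0 ∧ α + t • (1 : Fin r → ℝ) ∈ hyperplane L γ := by
  have h1 := slopeForm_one_pos hL
  simp only [hyperplane, Set.mem_ofPred_eq, slopeForm_add, slopeForm_smul]
  constructor
  · intro h
    refine ⟨(γ - slopeForm L α) / slopeForm L 1, div_neg_of_neg_of_pos (by linarith) h1, ?_⟩
    field_simp
    ring
  · rintro ⟨t, ht, h⟩
    nlinarith

theorem lt_slopeForm_iff_of_hyperplane_eq {L L' : Fin r → ℚ} (hL : IsSlope L) (hL' : IsSlope L')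
    {γ γ' : ℝ} (h : hyperplane L γ = hyperplane L' γ') (α : Fin r → ℝ) :
    γ < slopeForm L α ↔ γ' < slopeForm L' α := by
  rw [lt_slopeForm_iff hL, lt_slopeForm_iff hL', h]

theorem image_add_hyperplane (L : Fin r → ℚ) (γ : ℝ) (m : Fin r → ℤ) :
    (fun (α : Fin r → ℝ) i => α i + (m i : ℝ)) '' hyperplane L γ =
      hyperplane L (γ + slopeForm L fun i => m i) := by
  ext α
  constructor
  · rintro ⟨β, hβ, rfl⟩
    change slopeForm L (β + fun i => (m i : ℝ)) = _
    rw [slopeForm_add, show slopeForm L β = γ from hβ]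
  · intro hα
    refine ⟨α - fun i => (m i : ℝ), ?_, by ext i; simp⟩
    change slopeForm L _ = γ
    rw [slopeForm_sub, show slopeForm L α = _ from hα, add_sub_cancel_right]

theorem hyperplane_smul (L : Fin r → ℚ) (γ : ℝ) {q : ℚ} (hq : q ≠ 0) :
    hyperplane (q • L) (q * γ) = hyperplane L γ := by
  ext α
  have e : slopeForm (q • L) α = q * slopeForm L α := by
    simp only [slopeForm, Pi.smul_apply, smul_eq_mul, Finset.mul_sum]
    exact Finset.sum_congr rfl fun i _ => by push_cast; ring
  have hq' : (q : ℝ) ≠ 0 := by exact_mod_cast hq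
  change slopeForm (q • L) α = q * γ ↔ slopeForm L α = γ
  rw [e, mul_right_inj' hq']

/-- A set of walls is contained in finitely many sequences of equidistant parallel hyperplanes. -/
theorem IsSetOfWalls.exists_finset {𝒲 : Set (Set (Fin r → ℝ))} (h𝒲 : IsSetOfWalls 𝒲) :
    ∃ T : Finset ((Fin r → ℚ) × ℝ), (∀ a ∈ T, IsSlope a.1) ∧
      ∀ H ∈ 𝒲, ∃ a ∈ T, ∃ k : ℤ, H = hyperplane a.1 (a.2 + k) := by
  classical
  obtain ⟨h1, F, hF, h2⟩ := h𝒲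
  have key : ∀ H', (∃ (L : Fin r → ℚ) (γ : ℝ), IsSlope L ∧ H' = hyperplane L γ) →
      ∃ a : (Fin r → ℚ) × ℝ, IsSlope a.1 ∧ ∀ m : Fin r → ℤ, ∃ k : ℤ,
        (fun (α : Fin r → ℝ) i => α i + (m i : ℝ)) '' H' = hyperplane a.1 (a.2 + k) := by
    rintro _ ⟨L, γ, hL, rfl⟩
    -- Clearing denominators makes the slope integral, so translation by `ℤ^r` changes the constant
    -- term by integers.
    obtain ⟨q, hq0, hq⟩ : ∃ q : ℕ, q ≠ 0 ∧ ∀ i, ∃ z : ℤ, (q : ℚ) * L i = z := by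
      refine ⟨∏ i, (L i).den, Finset.prod_ne_zero_iff.2 fun i _ => (L i).den_nz, fun i => ?_⟩
      obtain ⟨c, hc⟩ := Finset.dvd_prod_of_mem (fun i => (L i).den) (Finset.mem_univ i)
      refine ⟨c * (L i).num, ?_⟩
      rw [hc]
      push_cast
      rw [mul_comm ((L i).den : ℚ), mul_assoc, Rat.den_mul_eq_num]
    have hq0' : (q : ℚ) ≠ 0 := by exact_mod_cast hq0
    choose z hz using hq
    refine ⟨((q : ℚ) • L, (q : ℚ) * γ), ⟨smul_nonneg (Nat.cast_nonneg _) hL.1,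
      smul_ne_zero hq0' hL.2⟩, fun m => ⟨∑ i, z i * m i, ?_⟩⟩
    rw [← hyperplane_smul L γ hq0', image_add_hyperplane]
    congr 2
    rw [slopeForm]
    push_cast
    exact Finset.sum_congr rfl fun i _ => by
      rw [Pi.smul_apply, smul_eq_mul, hz]; simp
  choose! φ hφ1 hφ2 using key
  set F' := {H' ∈ F | ∃ (L : Fin r → ℚ) (γ : ℝ), IsSlope L ∧ H' = hyperplane L γ}
  have hF' : F'.Finite := hF.subset fun _ h => h.1
  refine ⟨hF'.toFinset.image φ, ?_, ?_⟩
  · intro a ha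
    obtain ⟨H', hH', rfl⟩ := Finset.mem_image.1 ha
    exact hφ1 _ (hF'.mem_toFinset.1 hH').2
  · intro H hH
    obtain ⟨H', hH', m, e⟩ := h2 H hH
    -- The representative `H'` is only known up to translation to be a wall; translating `H` back
    -- exhibits it as a hyperplane.
    have hH'' : ∃ (L : Fin r → ℚ) (γ : ℝ), IsSlope L ∧ H' = hyperplane L γ := by
      obtain ⟨L, γ, hL, e'⟩ := h1 H hH
      refine ⟨L, γ + slopeForm L fun i => ((-m i : ℤ) : ℝ), hL, ?_⟩
      rw [← image_add_hyperplane, ← e', e, Set.image_image]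
      simp
    obtain ⟨k, hk⟩ := hφ2 H' hH'' m
    exact ⟨φ H', Finset.mem_image_of_mem φ (hF'.mem_toFinset.2 ⟨hH', hH''⟩), k, e.trans hk⟩

/-- `α` and `β` are on the same side of every member of `𝒲`. -/
def SameSides (𝒲 : Set (Set (Fin r → ℝ))) (α β : Fin r → ℝ) : Prop :=
  ∀ (L : Fin r → ℚ) (γ : ℝ), IsSlope L → hyperplane L γ ∈ 𝒲 →
    (γ < slopeForm L α ↔ γ < slopeForm L β)

/-- The chamber is the one determined by `α`: the walls strictly below `α` are put on the positive
side, and `β` satisfies the same inequalities. -/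
theorem SameSides.exists_chamber {𝒲 : Set (Set (Fin r → ℝ))} {α β : Fin r → ℝ} (h : SameSides 𝒲 α β) : ∃ σ, IsChamber 𝒲 σ ∧ α ∈ σ ∧ β ∈ σ := by
  set P : Set (Set (Fin r → ℝ)) := {H ∈ 𝒲 | ∃ (L : Fin r → ℚ) (γ : ℝ), IsSlope L ∧
    H = hyperplane L γ ∧ γ < slopeForm L α} with hP
  set σ : Set (Fin r → ℝ) := {α | ∀ (L : Fin r → ℚ) (γ : ℝ), IsSlope L →
      (hyperplane L γ ∈ P → γ < slopeForm L α) ∧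
      (hyperplane L γ ∈ 𝒲 \ P → slopeForm L α ≤ γ)} with hσ
  have hα : α ∈ σ := by
    refine fun L γ hL => ⟨?_, fun h => ?_⟩
    · rintro ⟨-, L', γ', hL', e, hlt⟩
      exact (lt_slopeForm_iff_of_hyperplane_eq hL hL' e α).2 hlt
    · by_contra! hlt
      exact h.2 ⟨h.1, L, γ, hL, rfl, hlt⟩
  refine ⟨σ, ⟨⟨α, hα⟩, P, 𝒲 \ P, ?_, Set.disjoint_sdiff_right, rfl⟩, hα, ?_⟩
  · exact Set.union_sdiff_cancel fun _ h => h.1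
  · intro L γ hL
    refine ⟨fun hm => (h L γ hL hm.1).1 ((hα L γ hL).1 hm), fun hm => ?_⟩
    by_contra! hlt
    exact absurd ((hα L γ hL).2 hm) (not_le.2 ((h L γ hL hm.1).2 hlt))

/-- A transitive relation which holds locally on both sides of every point of `[0, 1]` relates `0`
and `1`. -/
theorem rel_zero_one_of_local {R : ℝ → ℝ → Prop} (htrans : ∀ {a b c}, R a b → R b c → R a c)
    (hl : ∀ t ∈ Set.Ioc (0 : ℝ) 1, ∀ᶠ t' in 𝓝[<] t, R t' t)
    (hr : ∀ t ∈ Set.Ico (0 : ℝ) 1, ∀ᶠ t' in 𝓝[>] t, R t t') : R 0 1 := by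
  -- Connectedness of the interval: the supremum `b` of the points reachable from `0` is reached by
  -- the left condition at `b`, and `b < 1` would contradict the right condition.
  set S : Set ℝ := {t | 0 < t ∧ t ≤ 1 ∧ R 0 t} with hS
  obtain ⟨t₀, ht₀⟩ : S.Nonempty := by
    obtain ⟨t, ht⟩ := ((hr 0 (by simp)).and (Ioo_mem_nhdsGT (zero_lt_one' ℝ))).exists
    exact ⟨t, ht.2.1, ht.2.2.le, ht.1⟩
  have hbdd : BddAbove S := ⟨1, fun t ht => ht.2.1⟩
  set b := sSup S with hb
  have hb0 : 0 < b := ht₀.1.trans_le (le_csSup hbdd ht₀)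
  have hb1 : b ≤ 1 := csSup_le ⟨t₀, ht₀⟩ fun t ht => ht.2.1
  have hRb : R 0 b := by
    have h := (nhdsLT_basis b).eventually_iff.1 (hl b ⟨hb0, hb1⟩)
    obtain ⟨c, hc, hcb⟩ := h
    obtain ⟨t, ht, htc⟩ := exists_lt_of_lt_csSup ⟨t₀, ht₀⟩ hc
    rcases (le_csSup hbdd ht).eq_or_lt with e | hlt
    · rw [hb, ← e]; exact ht.2.2
    · exact htrans ht.2.2 (hcb ⟨htc, hlt⟩)
  rcases hb1.eq_or_lt with e | hlt
  · rwa [e] at hRb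
  · obtain ⟨t, ht⟩ := ((hr b ⟨hb0.le, hlt⟩).and (Ioo_mem_nhdsGT hlt)).exists
    exact absurd (le_csSup hbdd ⟨hb0.trans ht.2.1, ht.2.2.le, htrans hRb ht.1⟩)
      (not_le.2 ht.2.1)

/-- Near `p`, only the walls through `p` are relevant. -/
theorem eventually_side (p : Fin r → ℝ) (L : Fin r → ℚ) (c : ℝ) :
    ∀ᶠ q in 𝓝 p, ∀ k : ℤ, slopeForm L p ≠ c + k →
      (c + k < slopeForm L q ↔ c + k < slopeForm L p) := by
  have hc : Continuous fun q => slopeForm L q - c := (continuous_slopeForm L).sub continuous_const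
  -- The two integers are the nearest ones strictly below and strictly above `slopeForm L p - c`, so
  -- one neighbourhood serves for all `k`.
  have h1 : ∀ᶠ q in 𝓝 p, ((⌈slopeForm L p - c⌉ - 1 : ℤ) : ℝ) < slopeForm L q - c := by
    refine hc.continuousAt.eventually (lt_mem_nhds ?_)
    push_cast
    linarith [Int.ceil_lt_add_one (slopeForm L p - c)]
  have h2 : ∀ᶠ q in 𝓝 p, slopeForm L q - c < ((⌊slopeForm L p - c⌋ + 1 : ℤ) : ℝ) := by
    refine hc.continuousAt.eventually (gt_mem_nhds ?_)
    push_cast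
    exact Int.lt_floor_add_one _
  filter_upwards [h1, h2] with q hq1 hq2 k hk
  constructor
  · intro h
    have h3 : (k : ℝ) < ((⌊slopeForm L p - c⌋ + 1 : ℤ) : ℝ) := by linarith
    have h4 : k ≤ ⌊slopeForm L p - c⌋ := Int.lt_add_one_iff.1 (by exact_mod_cast h3)
    have h5 := Int.le_floor.1 h4
    exact lt_of_le_of_ne (by linarith) (Ne.symm hk)
  · intro h
    have h3 : k < ⌈slopeForm L p - c⌉ := Int.lt_ceil.2 (by linarith)
    have h4 : (k : ℝ) ≤ ((⌈slopeForm L p - c⌉ - 1 : ℤ) : ℝ) := by exact_mod_cast Int.le_sub_one_of_lt h3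
    linarith

/-- An affine hyperplane is closed with dense complement. By Baire, countably many of them can be
avoided simultaneously. -/
theorem eventually_residual_ne (f : (Fin r → ℝ) →ₗ[ℝ] ℝ) (hf : f ≠ 0) (c : ℝ) :
    ∀ᶠ x in residual (Fin r → ℝ), f x ≠ c := by
  refine residual_of_dense_open
    (isOpen_ne_fun f.continuous_of_finiteDimensional continuous_const) ?_
  obtain ⟨v, hv⟩ : ∃ v, f v ≠ 0 := by
    by_contra! h
    exact hf (LinearMap.ext h)
  intro x
  rw [mem_closure_iff_nhds]
  intro s hs
  have hc : ContinuousAt (fun t : ℝ => x + t • v) 0 := by fun_prop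
  have hs' : ∀ᶠ t : ℝ in 𝓝[≠] 0, x + t • v ∈ s :=
    (hc.eventually (by simpa using hs)).filter_mono nhdsWithin_le_nhds
  have hne : ∀ᶠ t : ℝ in 𝓝[≠] 0, t ≠ (c - f x) / f v := by
    rcases eq_or_ne ((c - f x) / f v) 0 with h | h
    · rw [h]; exact self_mem_nhdsWithin
    · exact (isOpen_ne.mem_nhds h.symm : {t : ℝ | t ≠ (c - f x) / f v} ∈ 𝓝 0) |>
        fun h => mem_nhdsWithin_of_mem_nhds h
  obtain ⟨t, ht1, ht2⟩ := (hs'.and hne).exists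
  refine ⟨_, ht1, fun h => ht2 ?_⟩
  rw [map_add, map_smul, smul_eq_mul] at h
  rw [eq_div_iff hv]
  linarith

/-- The linear form `slopeForm L`, as a linear map. -/
noncomputable def slopeLinear (L : Fin r → ℚ) : (Fin r → ℝ) →ₗ[ℝ] ℝ where
  toFun := slopeForm L
  map_add' := slopeForm_add L
  map_smul' := slopeForm_smul L

/-- A relation which holds between points in the same chamber, decreasing pairs of points, and
pairs of points separated by a single wall which does not contain `ξ`, holds between `α` and `α'`
if no wall through `ξ` is crossed upwards on the way from `α` to `α'`. -/
theorem rel_of_not_crossed {𝒲 : Set (Set (Fin r → ℝ))} {T : Finset ((Fin r → ℚ) × ℝ)}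
    (hT : ∀ a ∈ T, IsSlope a.1) (h𝒲 : ∀ H ∈ 𝒲, ∃ a ∈ T, ∃ k : ℤ, H = hyperplane a.1 (a.2 + k))
    (ξ : Fin r → ℝ) {R : (Fin r → ℝ) → (Fin r → ℝ) → Prop}
    (htrans : ∀ {a b c}, R a b → R b c → R a c) (hanti : ∀ {p q}, q ≤ p → R p q)
    (hsame : ∀ {p q}, SameSides 𝒲 p q → R p q)
    (hcross : ∀ (p q : Fin r → ℝ) (L : Fin r → ℚ) (γ : ℝ), p ≤ q → IsSlope L →
      hyperplane L γ ∈ 𝒲 → Separates (hyperplane L γ) p q →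
      (∀ H ∈ 𝒲, Separates H p q → H = hyperplane L γ) → slopeForm L ξ ≠ γ → R p q)
    {α α' : Fin r → ℝ}
    (h : ∀ a ∈ T, ¬ (slopeForm a.1 α ≤ slopeForm a.1 ξ ∧ slopeForm a.1 ξ < slopeForm a.1 α')) :
    R α α' := by
  classical
  set v := α' - α with hv
  -- A wall belongs to its lower side, so a small move downwards changes no side, even from a point
  -- on a wall. This is why the translation `u` is taken nonnegative.
  have hsides : ∀ β : Fin r → ℝ, ∀ᶠ u in 𝓝 (0 : Fin r → ℝ), 0 ≤ u → ∀ a ∈ T, ∀ k : ℤ,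
      (a.2 + k < slopeForm a.1 (β - u) ↔ a.2 + k < slopeForm a.1 β) := by
    intro β
    have hc : ContinuousAt (fun u : Fin r → ℝ => β - u) 0 := by fun_prop
    have := hc.eventually ((Filter.eventually_all_finset T).2 fun a _ => by
      simpa using eventually_side β a.1 a.2)
    filter_upwards [this] with u hu hu0 a ha k
    by_cases hk : slopeForm a.1 β = a.2 + k
    · rw [← hk]
      exact iff_of_false (not_lt.2 (slopeForm_mono (hT a ha) (sub_le_self β hu0))) (lt_irrefl _)
    · exact hu a ha k hk
  -- a generic small translation
  obtain ⟨u, hu0, hu1, hu2, hu3, hu4⟩ : ∃ u : Fin r → ℝ, 0 ≤ u ∧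
      (∀ a ∈ T, ∀ k : ℤ, (a.2 + k < slopeForm a.1 (α - u) ↔ a.2 + k < slopeForm a.1 α)) ∧
      (∀ a ∈ T, ∀ k : ℤ, (a.2 + k < slopeForm a.1 (α' - u) ↔ a.2 + k < slopeForm a.1 α')) ∧
      -- The translated starting point lies on no wall, so walls parallel to the segment are never
      -- met. The next condition results from eliminating the time `t` from the equations of two
      -- walls met at the same time; it excludes this for walls that are not parallel.
      (∀ a ∈ T, ∀ k : ℤ, slopeForm a.1 u ≠ slopeForm a.1 α - (a.2 + k)) ∧
      (∀ a ∈ T, ∀ b ∈ T, ∀ k l : ℤ,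
        slopeForm b.1 v • slopeLinear a.1 - slopeForm a.1 v • slopeLinear b.1 ≠ 0 →
        (slopeForm b.1 v • slopeLinear a.1 - slopeForm a.1 v • slopeLinear b.1) u ≠
          slopeForm b.1 v * (slopeForm a.1 α - (a.2 + k)) -
            slopeForm a.1 v * (slopeForm b.1 α - (b.2 + l))) := by
    -- Countably many proper affine hyperplanes are removed; the remaining set is dense and meets
    -- the open set of small positive vectors.
    have hres : ∀ᶠ u in residual (Fin r → ℝ),
        (∀ a ∈ T, ∀ k : ℤ, slopeForm a.1 u ≠ slopeForm a.1 α - (a.2 + k)) ∧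
        (∀ a ∈ T, ∀ b ∈ T, ∀ k l : ℤ,
          slopeForm b.1 v • slopeLinear a.1 - slopeForm a.1 v • slopeLinear b.1 ≠ 0 →
          (slopeForm b.1 v • slopeLinear a.1 - slopeForm a.1 v • slopeLinear b.1) u ≠
            slopeForm b.1 v * (slopeForm a.1 α - (a.2 + k)) -
              slopeForm a.1 v * (slopeForm b.1 α - (b.2 + l))) := by
      refine Filter.Eventually.and ((Filter.eventually_all_finset T).2 fun a ha =>
        eventually_countable_forall.2 fun k => ?_) ((Filter.eventually_all_finset T).2 fun a _ =>
        (Filter.eventually_all_finset T).2 fun b _ => eventually_countable_forall.2 fun k =>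
          eventually_countable_forall.2 fun l => ?_)
      · refine eventually_residual_ne (slopeLinear a.1) (fun h0 => ?_) _
        exact (slopeForm_one_pos (hT a ha)).ne' (LinearMap.congr_fun h0 1)
      · by_cases h0 : slopeForm b.1 v • slopeLinear a.1 - slopeForm a.1 v • slopeLinear b.1 = 0
        · simp [h0]
        · filter_upwards [eventually_residual_ne _ h0 (slopeForm b.1 v *
            (slopeForm a.1 α - (a.2 + k)) - slopeForm a.1 v * (slopeForm b.1 α - (b.2 + l)))] with u hu
          exact fun _ => hu
    obtain ⟨O, hO, hOo, hO0⟩ := eventually_nhds_iff.1 ((hsides α).and (hsides α'))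
    have hpos : IsOpen {u : Fin r → ℝ | ∀ i, 0 < u i} := by
      have e : {u : Fin r → ℝ | ∀ i, 0 < u i} = ⋂ i, {u : Fin r → ℝ | 0 < u i} := by ext; simp
      rw [e]
      exact isOpen_iInter_of_finite fun i => isOpen_lt continuous_const (continuous_apply i)
    have hne : (O ∩ {u : Fin r → ℝ | ∀ i, 0 < u i}).Nonempty := by
      have hc : ContinuousAt (fun t : ℝ => fun _ : Fin r => t) 0 := by fun_prop
      have h1 : ∀ᶠ t : ℝ in 𝓝[>] 0, (fun _ : Fin r => t) ∈ O :=
        (hc.eventually (hOo.mem_nhds hO0)).filter_mono nhdsWithin_le_nhds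
      obtain ⟨t, ht, ht0⟩ := (h1.and self_mem_nhdsWithin).exists
      exact ⟨_, ht, fun _ => ht0⟩
    obtain ⟨u, ⟨huO, hu0⟩, hu⟩ :=
      (dense_of_mem_residual hres).inter_open_nonempty _ (hOo.inter hpos) hne
    have hu0' : 0 ≤ u := fun i => (hu0 i).le
    exact ⟨u, hu0', (hO u huO).1 hu0', (hO u huO).2 hu0', hu.1, hu.2⟩
  set x := α - u with hx
  have hx' : α' - u = x + (1 : ℝ) • v := by rw [hx, hv]; simp
  have hsame' : ∀ β, (∀ a ∈ T, ∀ k : ℤ, (a.2 + k < slopeForm a.1 (β - u) ↔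
      a.2 + k < slopeForm a.1 β)) → SameSides 𝒲 (β - u) β := by
    intro β hβ L γ hL hm
    obtain ⟨a, ha, k, e⟩ := h𝒲 _ hm
    rw [lt_slopeForm_iff_of_hyperplane_eq hL (hT a ha) e,
      lt_slopeForm_iff_of_hyperplane_eq hL (hT a ha) e]
    exact hβ a ha k
  -- The route is `α`, down to `α - u`, along the generic segment to `α' - u`, and within the sides
  -- of `α'` up to `α'`.
  refine htrans (hanti (sub_le_self α hu0)) (htrans ?_ (hsame (hsame' α' hu2)))
  rw [hx']
  suffices R (x + (0 : ℝ) • v) (x + (1 : ℝ) • v) by rwa [zero_smul, add_zero] at this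
  -- At each time at most one wall is met, and transversally: a vanishing elimination form makes two
  -- walls parallel, and a common point makes them equal.
  have huniq : ∀ t : ℝ, ∀ a ∈ T, ∀ b ∈ T, ∀ k l : ℤ, slopeForm a.1 (x + t • v) = a.2 + k →
      slopeForm b.1 (x + t • v) = b.2 + l → slopeForm a.1 v ≠ 0 ∧
      hyperplane a.1 (a.2 + k) = hyperplane b.1 (b.2 + l) := by
    intro t a ha b hb k l hak hbl
    have hak' := hak
    have hbl' := hbl
    rw [hx, slopeForm_add, slopeForm_sub, slopeForm_smul] at hak' hbl'
    have hne : ∀ c ∈ T, ∀ m : ℤ, slopeForm c.1 α - slopeForm c.1 u + t * slopeForm c.1 v = c.2 + m →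
        slopeForm c.1 v ≠ 0 := by
      intro c hc m hcm h0
      rw [h0, mul_zero, add_zero] at hcm
      exact hu3 c hc m (by linarith)
    refine ⟨hne a ha k hak', ?_⟩
    have h0 : slopeForm b.1 v • slopeLinear a.1 - slopeForm a.1 v • slopeLinear b.1 = 0 := by
      by_contra h0
      refine hu4 a ha b hb k l h0 ?_
      change slopeForm b.1 v * slopeForm a.1 u - slopeForm a.1 v * slopeForm b.1 u = _
      have e1 : slopeForm a.1 u = slopeForm a.1 α - (a.2 + k) + t * slopeForm a.1 v := by linarith
      have e2 : slopeForm b.1 u = slopeForm b.1 α - (b.2 + l) + t * slopeForm b.1 v := by linarith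
      rw [e1, e2]
      ring
    ext y
    have hy := LinearMap.congr_fun h0 (y - (x + t • v))
    change slopeForm b.1 v * slopeForm a.1 (y - (x + t • v)) -
      slopeForm a.1 v * slopeForm b.1 (y - (x + t • v)) = 0 at hy
    rw [slopeForm_sub a.1 y, slopeForm_sub b.1 y, hak, hbl] at hy
    change slopeForm a.1 y = a.2 + k ↔ slopeForm b.1 y = b.2 + l
    constructor
    · intro e
      rw [e, sub_self, mul_zero, zero_sub, neg_eq_zero] at hy
      exact sub_eq_zero.1 ((mul_eq_zero.1 hy).resolve_left (hne a ha k hak'))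
    · intro e
      rw [e, sub_self, mul_zero, sub_zero] at hy
      exact sub_eq_zero.1 ((mul_eq_zero.1 hy).resolve_left (hne b hb l hbl'))
  have hnear : ∀ p : Fin r → ℝ, ∀ᶠ q in 𝓝 p, ∀ (L : Fin r → ℚ) (γ : ℝ), IsSlope L →
      hyperplane L γ ∈ 𝒲 → p ∉ hyperplane L γ → (γ < slopeForm L q ↔ γ < slopeForm L p) := by
    intro p
    filter_upwards [(Filter.eventually_all_finset T).2 fun a _ => eventually_side p a.1 a.2] with
      q hq L γ hL hm hp
    obtain ⟨a, ha, k, e⟩ := h𝒲 _ hm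
    rw [lt_slopeForm_iff_of_hyperplane_eq hL (hT a ha) e,
      lt_slopeForm_iff_of_hyperplane_eq hL (hT a ha) e]
    exact hq a ha k fun h' => hp (e ▸ h')
  have hline : ∀ t : ℝ, ∀ᶠ t' in 𝓝 t, ∀ (L : Fin r → ℚ) (γ : ℝ), IsSlope L →
      hyperplane L γ ∈ 𝒲 → x + t • v ∉ hyperplane L γ →
      (γ < slopeForm L (x + t' • v) ↔ γ < slopeForm L (x + t • v)) := by
    intro t
    have hc : ContinuousAt (fun t : ℝ => x + t • v) t := by fun_prop
    exact hc.eventually (hnear (x + t • v))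
  -- A slight push in direction `(1, …, 1)` goes strictly above the walls through `p` and changes no
  -- other side.
  have hup : ∀ p : Fin r → ℝ, ∃ q : Fin r → ℝ, p ≤ q ∧
      (∀ L : Fin r → ℚ, IsSlope L → slopeForm L p < slopeForm L q) ∧
      ∀ (L : Fin r → ℚ) (γ : ℝ), IsSlope L →
      hyperplane L γ ∈ 𝒲 → p ∉ hyperplane L γ → (γ < slopeForm L q ↔ γ < slopeForm L p) := by
    intro p
    have hc : ContinuousAt (fun t : ℝ => p + t • (1 : Fin r → ℝ)) 0 := by fun_prop
    have h1 := (hc.eventually (by simpa using hnear p)).filter_mono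
      (nhdsWithin_le_nhds (s := Set.Ioi 0))
    obtain ⟨t, ht, ht0⟩ := (h1.and self_mem_nhdsWithin).exists
    have ht0 : 0 < t := ht0
    refine ⟨_, le_add_of_nonneg_right (smul_nonneg ht0.le zero_le_one), fun L hL => ?_, ht⟩
    rw [slopeForm_add, slopeForm_smul]
    have := mul_pos ht0 (slopeForm_one_pos hL)
    linarith
  have hside : ∀ (t : ℝ) (q q' : Fin r → ℝ) (a : (Fin r → ℚ) × ℝ) (k : ℤ), a ∈ T →
      slopeForm a.1 (x + t • v) = a.2 + k →
      (∀ (L : Fin r → ℚ) (γ : ℝ), IsSlope L → hyperplane L γ ∈ 𝒲 → x + t • v ∉ hyperplane L γ →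
        (γ < slopeForm L q ↔ γ < slopeForm L (x + t • v))) →
      (∀ (L : Fin r → ℚ) (γ : ℝ), IsSlope L → hyperplane L γ ∈ 𝒲 → x + t • v ∉ hyperplane L γ →
        (γ < slopeForm L q' ↔ γ < slopeForm L (x + t • v))) →
      (a.2 + k < slopeForm a.1 q ↔ a.2 + k < slopeForm a.1 q') → SameSides 𝒲 q q' := by
    intro t q q' a k ha hak hq hq' hqq L γ hL hm
    by_cases hp : x + t • v ∈ hyperplane L γ
    · obtain ⟨b, hb, l, e⟩ := h𝒲 _ hm
      have e' : hyperplane L γ = hyperplane a.1 (a.2 + k) := by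
        rw [e] at hp ⊢
        exact (huniq t a ha b hb k l hak hp).2.symm
      rwa [lt_slopeForm_iff_of_hyperplane_eq hL (hT a ha) e',
        lt_slopeForm_iff_of_hyperplane_eq hL (hT a ha) e']
    · rw [hq L γ hL hm hp, hq' L γ hL hm hp]
  have hmove : ∀ (L : Fin r → ℚ) (t t' : ℝ),
      slopeForm L (x + t' • v) = slopeForm L (x + t • v) + (t' - t) * slopeForm L v := by
    intro L t t'
    simp only [slopeForm_add, slopeForm_smul]
    ring
  refine rel_zero_one_of_local (R := fun t t' => R (x + t • v) (x + t' • v))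
    (fun h1 h2 => htrans h1 h2) ?_ ?_
  · intro t _
    filter_upwards [(hline t).filter_mono nhdsWithin_le_nhds, self_mem_nhdsWithin] with t' ht' hlt
    have hlt : t' < t := hlt
    by_cases hw : ∃ H ∈ 𝒲, x + t • v ∈ H
    · obtain ⟨H, hH, hp⟩ := hw
      obtain ⟨a, ha, k, rfl⟩ := h𝒲 H hH
      -- A wall reached from above costs nothing: the points just before it lie on the same sides as
      -- the pushed-up point `q`, from which one descends to the wall point. A wall reached from
      -- below already contains the arrival point on the side being left.
      rcases lt_or_ge (slopeForm a.1 v) 0 with hneg | hnn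
      · obtain ⟨q, hpq, hq1, hq2⟩ := hup (x + t • v)
        refine htrans (hsame (hside t _ q a k ha hp ht' hq2 (iff_of_true ?_ ?_))) (hanti hpq)
        · rw [hmove a.1 t, show slopeForm a.1 (x + t • v) = a.2 + k from hp]
          nlinarith
        · rw [← show slopeForm a.1 (x + t • v) = a.2 + k from hp]
          exact hq1 a.1 (hT a ha)
      · refine hsame (hside t _ _ a k ha hp ht' (fun _ _ _ _ _ => Iff.rfl) (iff_of_false ?_ ?_))
        · rw [hmove a.1 t, show slopeForm a.1 (x + t • v) = a.2 + k from hp]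
          nlinarith
        · rw [show slopeForm a.1 (x + t • v) = a.2 + k from hp]
          exact lt_irrefl _
    · exact hsame fun L γ hL hm => ht' L γ hL hm fun hp => hw ⟨_, hm, hp⟩
  · intro t ht
    filter_upwards [(hline t).filter_mono nhdsWithin_le_nhds, self_mem_nhdsWithin] with t' ht' hlt
    have hlt : t < t' := hlt
    by_cases hw : ∃ H ∈ 𝒲, x + t • v ∈ H
    · obtain ⟨H, hH, hp⟩ := hw
      obtain ⟨a, ha, k, rfl⟩ := h𝒲 H hH
      have hp' : slopeForm a.1 (x + t • v) = a.2 + k := hp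
      -- Leaving a wall upwards is the only genuine crossing. The wall point and the pushed-up point
      -- `q` are comparable and separated by this wall alone.
      rcases lt_or_ge 0 (slopeForm a.1 v) with hpos | hnp
      · obtain ⟨q, hpq, hq1, hq2⟩ := hup (x + t • v)
        refine htrans (hcross _ q a.1 (a.2 + k) hpq (hT a ha) hH ⟨a.1, a.2 + k, hT a ha, rfl,
          Or.inl ⟨hp'.le, hp' ▸ hq1 a.1 (hT a ha)⟩⟩ ?_ ?_)
          (hsame (hside t q _ a k ha hp hq2 ht' (iff_of_true ?_ ?_)))
        · rintro H' hH' ⟨L, γ, hL, rfl, hsep⟩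
          have hsep : slopeForm L (x + t • v) ≤ γ ∧ γ < slopeForm L q := by
            refine hsep.resolve_right fun h' => ?_
            exact absurd (slopeForm_mono hL hpq) (not_le.2 (h'.1.trans_lt h'.2))
          by_cases hpL : x + t • v ∈ hyperplane L γ
          · obtain ⟨b, hb, l, e⟩ := h𝒲 _ hH'
            rw [e] at hpL ⊢
            exact (huniq t a ha b hb k l hp hpL).2.symm
          · exact absurd ((hq2 L γ hL hH' hpL).1 hsep.2) (not_lt.2 hsep.1)
        -- If the wall contained `ξ`, then `α` would lie on its lower side and `α'` strictly above,
        -- which `h` forbids; the sides are transferred back from the translated endpoints.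
        · intro hξ
          refine h a ha ⟨?_, ?_⟩
          · rw [hξ, ← not_lt, ← hu1 a ha k, not_lt]
            have := hmove a.1 t 0
            rw [zero_smul, add_zero, hp'] at this
            nlinarith [ht.1]
          · rw [hξ, ← hu2 a ha k, hx', hmove a.1 t 1, hp']
            nlinarith [ht.2]
        · rw [← hp']
          exact hq1 a.1 (hT a ha)
        · rw [hmove a.1 t, hp']
          nlinarith
      · refine hsame (hside t _ _ a k ha hp (fun _ _ _ _ _ => Iff.rfl) ht' (iff_of_false ?_ ?_))
        · rw [hp']
          exact lt_irrefl _
        · rw [hmove a.1 t, hp']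
          nlinarith
    · exact hsame fun L γ hL hm => (ht' L γ hL hm fun hp => hw ⟨_, hm, hp⟩).symm

end WallPaths

/-! ### Germs of presheaves of sets, groups, rings and modules -/

noncomputable section Stalks

section Germs

variable {X : Type u} [TopologicalSpace X]

/-- A presheaf of sets on `X`. -/
class GermSystem (A : Opens X → Type*) where
  res : ∀ {U V : Opens X}, V ≤ U → A U → A V
  res_self : ∀ {U : Opens X} (a : A U), res le_rfl a = a
  res_res : ∀ {U V W : Opens X} (h : V ≤ U) (h' : W ≤ V) (a : A U),
    res h' (res h a) = res (h'.trans h) a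

open GermSystem

variable (A B C : Opens X → Type*) [GermSystem A] [GermSystem B] [GermSystem C] (x : X)

/-- Sections over open neighbourhoods of `x` are equivalent if they agree near `x`. -/
def germSetoid : Setoid ((U : {U : Opens X // x ∈ U}) × A U.1) where
  r a b := ∃ (W : Opens X) (h1 : W ≤ a.1.1) (h2 : W ≤ b.1.1), x ∈ W ∧ res h1 a.2 = res h2 b.2
  iseqv := ⟨fun a => ⟨a.1.1, le_rfl, le_rfl, a.1.2, rfl⟩,
    fun ⟨W, h1, h2, hW, e⟩ => ⟨W, h2, h1, hW, e.symm⟩, by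
    rintro a b c ⟨W, h1, h2, hW, e⟩ ⟨W', h1', h2', hW', e'⟩
    have i1 : W ⊓ W' ≤ W := inf_le_left
    have i2 : W ⊓ W' ≤ W' := inf_le_right
    refine ⟨W ⊓ W', i1.trans h1, i2.trans h2', ⟨hW, hW'⟩, ?_⟩
    rw [← res_res h1 i1, e, res_res, ← res_res h2' i2, ← e', res_res]⟩

/-- The stalk at `x`. -/
def Germ : Type _ := Quotient (germSetoid A x)

variable {x}

/-- The germ at `x` of a section. -/
def germOf {U : Opens X} (hx : x ∈ U) (a : A U) : Germ A x :=
  Quotient.mk (germSetoid A x) ⟨⟨U, hx⟩, a⟩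

variable {A B C}

theorem germOf_eq_iff {U V : Opens X} {hU : x ∈ U} {hV : x ∈ V} {a : A U} {b : A V} :
    germOf A hU a = germOf A hV b ↔
      ∃ (W : Opens X) (h1 : W ≤ U) (h2 : W ≤ V), x ∈ W ∧ res h1 a = res h2 b :=
  ⟨fun h => Quotient.exact h, fun h => Quotient.sound h⟩

theorem germOf_res {U V : Opens X} (h : V ≤ U) (hx : x ∈ V) (a : A U) :
    germOf A hx (res h a) = germOf A (h hx) a :=
  germOf_eq_iff.2 ⟨V, le_rfl, h, hx, by rw [res_res]⟩

theorem exists_germOf (a : Germ A x) : ∃ (U : Opens X) (hx : x ∈ U) (a' : A U),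
    germOf A hx a' = a := by
  obtain ⟨⟨⟨U, hU⟩, a'⟩, rfl⟩ := Quotient.exists_rep a
  exact ⟨U, hU, a', rfl⟩

theorem exists_germOf₂ (a : Germ A x) (b : Germ B x) : ∃ (U : Opens X) (hx : x ∈ U) (a' : A U)
    (b' : B U), germOf A hx a' = a ∧ germOf B hx b' = b := by
  obtain ⟨U, hU, a, rfl⟩ := exists_germOf a
  obtain ⟨V, hV, b, rfl⟩ := exists_germOf b
  exact ⟨U ⊓ V, ⟨hU, hV⟩, res inf_le_left a, res inf_le_right b, germOf_res _ _ _, germOf_res _ _ _⟩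

theorem exists_germOf₃ (a : Germ A x) (b : Germ B x) (c : Germ C x) : ∃ (U : Opens X) (hx : x ∈ U)
    (a' : A U) (b' : B U) (c' : C U), germOf A hx a' = a ∧ germOf B hx b' = b ∧
    germOf C hx c' = c := by
  obtain ⟨U, hU, a, b, rfl, rfl⟩ := exists_germOf₂ a b
  obtain ⟨V, hV, c, rfl⟩ := exists_germOf c
  exact ⟨U ⊓ V, ⟨hU, hV⟩, res inf_le_left a, res inf_le_left b, res inf_le_right c,
    germOf_res _ _ _, germOf_res _ _ _, germOf_res _ _ _⟩

/-- The map on stalks induced by a map of presheaves. -/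
def Germ.map (f : ∀ U, A U → B U)
    (hf : ∀ {U V : Opens X} (h : V ≤ U) (a : A U), res h (f U a) = f V (res h a)) :
    Germ A x → Germ B x :=
  Quotient.lift (fun a => germOf B a.1.2 (f _ a.2)) (by
    rintro a b ⟨W, h1, h2, hW, e⟩
    exact germOf_eq_iff.2 ⟨W, h1, h2, hW, by rw [hf, hf, e]⟩)

theorem Germ.map_germOf (f : ∀ U, A U → B U)
    (hf : ∀ {U V : Opens X} (h : V ≤ U) (a : A U), res h (f U a) = f V (res h a))
    {U : Opens X} (hx : x ∈ U) (a : A U) :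
    Germ.map f hf (germOf A hx a) = germOf B hx (f U a) := rfl

/-- The operation on stalks induced by an operation on presheaves. -/
def Germ.map₂ (f : ∀ U, A U → B U → C U) (hf : ∀ {U V : Opens X} (h : V ≤ U) (a : A U) (b : B U),
    res h (f U a b) = f V (res h a) (res h b)) : Germ A x → Germ B x → Germ C x :=
  Quotient.lift₂ (fun a b => germOf C (⟨a.1.2, b.1.2⟩ : x ∈ a.1.1 ⊓ b.1.1)
    (f _ (res inf_le_left a.2) (res inf_le_right b.2))) (by
    rintro a b a' b' ⟨W, h1, h2, hW, e⟩ ⟨W', h1', h2', hW', e'⟩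
    have i1 : W ⊓ W' ≤ W := inf_le_left
    have i2 : W ⊓ W' ≤ W' := inf_le_right
    refine germOf_eq_iff.2 ⟨W ⊓ W', inf_le_inf h1 h1', inf_le_inf h2 h2', ⟨hW, hW'⟩, ?_⟩
    rw [hf, hf]
    simp only [res_res]
    rw [← res_res h1 i1, e, ← res_res h1' i2, e', res_res, res_res])

theorem Germ.map₂_germOf (f : ∀ U, A U → B U → C U) (hf : ∀ {U V : Opens X} (h : V ≤ U) (a : A U)
    (b : B U), res h (f U a b) = f V (res h a) (res h b)) {U : Opens X} (hx : x ∈ U) (a : A U)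
    (b : B U) : Germ.map₂ f hf (germOf A hx a) (germOf B hx b) = germOf C hx (f U a b) := by
  refine germOf_eq_iff.2 ⟨U, le_inf le_rfl le_rfl, le_rfl, hx, ?_⟩
  rw [hf, res_res, res_res, res_self, res_self, res_self]

/-- Presheaves of abelian groups. -/
class AddGermSystem (A : Opens X → Type*) [∀ U, AddCommGroup (A U)] extends GermSystem A where
  res_add : ∀ {U V : Opens X} (h : V ≤ U) (a b : A U), res h (a + b) = res h a + res h b

/-- Presheaves of rings. -/
class RingGermSystem (A : Opens X → Type*) [∀ U, Ring (A U)] extends AddGermSystem A where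
  res_mul : ∀ {U V : Opens X} (h : V ≤ U) (a b : A U), res h (a * b) = res h a * res h b
  res_one : ∀ {U V : Opens X} (h : V ≤ U), res h (1 : A U) = 1

open AddGermSystem RingGermSystem

section Add

variable {A : Opens X → Type*} [∀ U, AddCommGroup (A U)] [AddGermSystem A]

theorem res_zero {U V : Opens X} (h : V ≤ U) : res h (0 : A U) = 0 := by
  have := res_add h (0 : A U) 0
  rwa [add_zero, eq_comm, add_eq_left] at this

theorem res_neg {U V : Opens X} (h : V ≤ U) (a : A U) : res h (-a) = -res h a := by
  rw [eq_neg_iff_add_eq_zero, ← res_add, neg_add_cancel, res_zero]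

instance : Add (Germ A x) := ⟨Germ.map₂ (fun _ a b => a + b) res_add⟩
instance : Zero (Germ A x) := ⟨germOf A (Opens.mem_top x) 0⟩
instance : Neg (Germ A x) := ⟨Germ.map (fun _ a => -a) res_neg⟩

theorem germOf_add {U : Opens X} (hx : x ∈ U) (a b : A U) :
    germOf A hx (a + b) = germOf A hx a + germOf A hx b :=
  (Germ.map₂_germOf (C := A) (fun _ a b => a + b) res_add hx a b).symm

theorem germOf_zero {U : Opens X} (hx : x ∈ U) : germOf A hx (0 : A U) = 0 :=
  germOf_eq_iff.2 ⟨U, le_rfl, le_top, hx, (res_zero (A := A) _).trans (res_zero (A := A) _).symm⟩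

theorem germOf_neg {U : Opens X} (hx : x ∈ U) (a : A U) :
    germOf A hx (-a) = -germOf A hx a := rfl

instance : AddCommGroup (Germ A x) where
  add_assoc a b c := by
    obtain ⟨U, hx, a, b, c, rfl, rfl, rfl⟩ := exists_germOf₃ a b c
    simp only [← germOf_add, add_assoc]
  zero_add a := by
    obtain ⟨U, hx, a, rfl⟩ := exists_germOf a
    rw [← germOf_zero hx, ← germOf_add, zero_add]
  add_zero a := by
    obtain ⟨U, hx, a, rfl⟩ := exists_germOf a
    rw [← germOf_zero hx, ← germOf_add, add_zero]
  add_comm a b := by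
    obtain ⟨U, hx, a, b, rfl, rfl⟩ := exists_germOf₂ a b
    rw [← germOf_add, add_comm, germOf_add]
  neg_add_cancel a := by
    obtain ⟨U, hx, a, rfl⟩ := exists_germOf a
    rw [← germOf_neg, ← germOf_add, neg_add_cancel, germOf_zero]
  nsmul := nsmulRec
  zsmul := zsmulRec

end Add

section Ring

variable {A : Opens X → Type*} [∀ U, Ring (A U)] [RingGermSystem A]

instance : Mul (Germ A x) := ⟨Germ.map₂ (fun _ a b => a * b) res_mul⟩
instance : One (Germ A x) := ⟨germOf A (Opens.mem_top x) 1⟩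

theorem germOf_mul {U : Opens X} (hx : x ∈ U) (a b : A U) :
    germOf A hx (a * b) = germOf A hx a * germOf A hx b :=
  (Germ.map₂_germOf (C := A) (fun _ a b => a * b) res_mul hx a b).symm

theorem germOf_one {U : Opens X} (hx : x ∈ U) : germOf A hx (1 : A U) = 1 :=
  germOf_eq_iff.2 ⟨U, le_rfl, le_top, hx, (res_one (A := A) _).trans (res_one (A := A) _).symm⟩

instance : Ring (Germ A x) where
  mul_assoc a b c := by
    obtain ⟨U, hx, a, b, c, rfl, rfl, rfl⟩ := exists_germOf₃ a b c
    simp only [← germOf_mul, mul_assoc]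
  one_mul a := by
    obtain ⟨U, hx, a, rfl⟩ := exists_germOf a
    rw [← germOf_one hx, ← germOf_mul, one_mul]
  mul_one a := by
    obtain ⟨U, hx, a, rfl⟩ := exists_germOf a
    rw [← germOf_one hx, ← germOf_mul, mul_one]
  left_distrib a b c := by
    obtain ⟨U, hx, a, b, c, rfl, rfl, rfl⟩ := exists_germOf₃ a b c
    simp only [← germOf_mul, ← germOf_add, mul_add]
  right_distrib a b c := by
    obtain ⟨U, hx, a, b, c, rfl, rfl, rfl⟩ := exists_germOf₃ a b c
    simp only [← germOf_mul, ← germOf_add, add_mul]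
  zero_mul a := by
    obtain ⟨U, hx, a, rfl⟩ := exists_germOf a
    rw [← germOf_zero hx, ← germOf_mul, zero_mul]
  mul_zero a := by
    obtain ⟨U, hx, a, rfl⟩ := exists_germOf a
    rw [← germOf_zero hx, ← germOf_mul, mul_zero]
  neg_add_cancel := neg_add_cancel
  zsmul := zsmulRec

variable {E : Opens X → Type*} [∀ U, AddCommGroup (E U)] [AddGermSystem E]
  [∀ U, Module (A U) (E U)]

/-- The stalk of a module over a presheaf of rings. -/
@[reducible]
def germModule (hs : ∀ {U V : Opens X} (h : V ≤ U) (a : A U) (e : E U),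
    res h (a • e) = res h a • res h e) : Module (Germ A x) (Germ E x) where
  smul := Germ.map₂ (fun _ a e => a • e) hs
  one_smul e := by
    obtain ⟨U, hx, e, rfl⟩ := exists_germOf e
    rw [← germOf_one hx]
    exact (Germ.map₂_germOf _ hs hx 1 e).trans (by rw [one_smul])
  mul_smul a b e := by
    obtain ⟨U, hx, a, b, e, rfl, rfl, rfl⟩ := exists_germOf₃ a b e
    rw [← germOf_mul]
    refine (Germ.map₂_germOf _ hs hx (a * b) e).trans ?_
    rw [mul_smul]
    refine (Germ.map₂_germOf _ hs hx a (b • e)).symm.trans ?_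
    exact congrArg (Germ.map₂ (fun _ a e => a • e) hs (germOf A hx a))
      (Germ.map₂_germOf _ hs hx b e).symm
  smul_zero a := by
    obtain ⟨U, hx, a, rfl⟩ := exists_germOf a
    rw [← germOf_zero hx]
    exact (Germ.map₂_germOf _ hs hx a 0).trans (by rw [smul_zero])
  smul_add a e e' := by
    obtain ⟨U, hx, a, e, e', rfl, rfl, rfl⟩ := exists_germOf₃ a e e'
    rw [← germOf_add]
    refine (Germ.map₂_germOf _ hs hx a (e + e')).trans ?_
    rw [smul_add, germOf_add, ← Germ.map₂_germOf _ hs hx a e, ← Germ.map₂_germOf _ hs hx a e']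
    rfl
  add_smul a b e := by
    obtain ⟨U, hx, a, b, e, rfl, rfl, rfl⟩ := exists_germOf₃ a b e
    rw [← germOf_add]
    refine (Germ.map₂_germOf _ hs hx (a + b) e).trans ?_
    rw [add_smul, germOf_add, ← Germ.map₂_germOf _ hs hx a e, ← Germ.map₂_germOf _ hs hx b e]
    rfl
  zero_smul e := by
    obtain ⟨U, hx, e, rfl⟩ := exists_germOf e
    rw [← germOf_zero hx]
    refine (Germ.map₂_germOf _ hs hx 0 e).trans ?_
    rw [zero_smul, germOf_zero]

end Ring

end Germs

/-! ### Stalks of functions, operators, modules and subsheaves -/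

variable {n : ℕ} {X : Type u} [TopologicalSpace X] [ChartedSpace (Fin n → ℂ) X] (x : X)

instance : RingGermSystem (Hol n (X := X)) where
  res h := Hol.res h
  res_self _ := rfl
  res_res _ _ _ := rfl
  res_add _ _ _ := rfl
  res_mul _ _ _ := rfl
  res_one _ := rfl

instance : RingGermSystem (DiffOp n (X := X)) where
  res h := DiffOp.res h
  res_self _ := rfl
  res_res _ _ _ := rfl
  res_add _ _ _ := rfl
  res_mul _ _ _ := rfl
  res_one _ := rfl

theorem Sec.res_smul {M : DModule.{u, v} n X} {V W : Opens X} (h : W ≤ V) (P : DiffOp n V)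
    (s : Sec M V) : Sec.res h (P • s) = DiffOp.res h P • Sec.res h s :=
  M.val.map_smul (homOfLE h : (W : Opens (TopCat.of X)) ⟶ V).op P s

theorem Sec.res_self {M : DModule.{u, v} n X} {V : Opens X} (s : Sec M V) :
    Sec.res le_rfl s = s :=
  congrArg (fun φ => φ.hom s) (M.val.map_id (op (V : Opens (TopCat.of X))))

instance (M : DModule.{u, v} n X) : AddGermSystem (Sec M) where
  res h := Sec.res h
  res_self := Sec.res_self
  res_res := Sec.res_res
  res_add h := map_add (Sec.res h)

variable (n) in
/-- The ring `𝒪_{X,x}` of germs of holomorphic functions at `x`. -/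
abbrev HolStalk : Type u := Germ (Hol n (X := X)) x

instance : CommRing (HolStalk n x) where
  mul_comm a b := by
    obtain ⟨U, hx, a, b, rfl, rfl⟩ := exists_germOf₂ a b
    rw [← germOf_mul, mul_comm, germOf_mul]

variable (n) in
/-- The ring `𝒟_{X,x}` of germs of differential operators at `x`. -/
abbrev DiffStalk : Type u := Germ (DiffOp n (X := X)) x

variable {x}

/-- The germ at `x` of a holomorphic function. -/
def Hol.germ {U : Opens X} (hx : x ∈ U) : Hol n U →+* HolStalk n x where
  toFun := germOf (Hol n) hx
  map_one' := germOf_one hx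
  map_mul' := germOf_mul hx
  map_zero' := germOf_zero hx
  map_add' := germOf_add hx

theorem Hol.germ_res {U V : Opens X} (h : V ≤ U) (hx : x ∈ V) (f : Hol n U) :
    Hol.germ hx (Hol.res h f) = Hol.germ (h hx) f := germOf_res h hx f

theorem Hol.exists_germ (a : HolStalk n x) : ∃ (U : Opens X) (hx : x ∈ U) (f : Hol n U),
    Hol.germ hx f = a := exists_germOf a

theorem Hol.germ_eq_iff {U V : Opens X} {hU : x ∈ U} {hV : x ∈ V} {f : Hol n U} {g : Hol n V} :
    Hol.germ hU f = Hol.germ hV g ↔ ∃ (W : Opens X) (h1 : W ≤ U) (h2 : W ≤ V), x ∈ W ∧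
      Hol.res h1 f = Hol.res h2 g := germOf_eq_iff

instance : Algebra ℂ (DiffStalk n x) :=
  RingHom.toAlgebra'
    { toFun := fun c => germOf (DiffOp n) (Opens.mem_top x) (algebraMap ℂ _ c)
      map_one' := by rw [map_one, germOf_one]
      map_mul' := fun a b => by rw [map_mul, germOf_mul]
      map_zero' := by rw [map_zero, germOf_zero]
      map_add' := fun a b => by rw [map_add, germOf_add] }
    (fun c a => by
      obtain ⟨U, hx, a, rfl⟩ := exists_germOf a
      change germOf (DiffOp n) (Opens.mem_top x) (algebraMap ℂ (DiffOp n (⊤ : Opens X)) c) * _ =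
        _ * germOf (DiffOp n) (Opens.mem_top x) (algebraMap ℂ (DiffOp n (⊤ : Opens X)) c)
      rw [← germOf_res (le_top : U ≤ ⊤) hx, ← germOf_mul, ← germOf_mul]
      exact congrArg (germOf (DiffOp n) hx) (Algebra.commutes (A := DiffOp n U) c a))

/-- The germ at `x` of a differential operator. -/
def DiffOp.germ {U : Opens X} (hx : x ∈ U) : DiffOp n U →ₐ[ℂ] DiffStalk n x where
  toFun := germOf (DiffOp n) hx
  map_one' := germOf_one hx
  map_mul' := germOf_mul hx
  map_zero' := germOf_zero hx
  map_add' := germOf_add hx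
  commutes' c := germOf_res (le_top : U ≤ ⊤) hx (algebraMap ℂ (DiffOp n (⊤ : Opens X)) c)

theorem DiffOp.germ_res {U V : Opens X} (h : V ≤ U) (hx : x ∈ V) (f : DiffOp n U) :
    DiffOp.germ hx (DiffOp.res h f) = DiffOp.germ (h hx) f := germOf_res h hx f

theorem DiffOp.exists_germ (a : DiffStalk n x) : ∃ (U : Opens X) (hx : x ∈ U) (f : DiffOp n U),
    DiffOp.germ hx f = a := exists_germOf a

instance (U : Opens X) : Module (DiffOp n U) (Hol n U) where
  smul P f := P.act le_rfl f
  one_smul _ := rfl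
  mul_smul _ _ _ := rfl
  smul_zero P := map_zero (P.1.1 ⟨U, le_rfl⟩)
  smul_add P := map_add (P.1.1 ⟨U, le_rfl⟩)
  add_smul _ _ _ := rfl
  zero_smul _ := rfl

instance : Module (DiffStalk n x) (HolStalk n x) :=
  germModule fun h P f => P.act_res le_rfl h f

theorem germ_smul_germ {U : Opens X} (hx : x ∈ U) (P : DiffOp n U) (f : Hol n U) :
    DiffOp.germ hx P • Hol.germ hx f = Hol.germ hx (P.act le_rfl f) :=
  Germ.map₂_germOf _ _ hx P f

section Sections

variable (M : DModule.{u, v} n X)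

variable (x) in
/-- The stalk `M_x` of a `𝒟_X`-module. -/
abbrev SecStalk : Type max u v := Germ (Sec M) x

instance : Module (DiffStalk n x) (SecStalk x M) :=
  germModule fun h P s => Sec.res_smul h P s

variable {M}

/-- The germ at `x` of a section of a `𝒟_X`-module. -/
def Sec.germ {U : Opens X} (hx : x ∈ U) : Sec M U →+ SecStalk x M where
  toFun := germOf (Sec M) hx
  map_zero' := germOf_zero hx
  map_add' := germOf_add hx

theorem Sec.germ_res {U V : Opens X} (h : V ≤ U) (hx : x ∈ V) (f : Sec M U) :
    Sec.germ hx (Sec.res h f) = Sec.germ (h hx) f := germOf_res h hx f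

theorem Sec.exists_germ (a : SecStalk x M) : ∃ (U : Opens X) (hx : x ∈ U) (f : Sec M U),
    Sec.germ hx f = a := exists_germOf a

theorem Sec.germ_eq_iff {U V : Opens X} {hU : x ∈ U} {hV : x ∈ V} {f : Sec M U} {g : Sec M V} :
    Sec.germ hU f = Sec.germ hV g ↔ ∃ (W : Opens X) (h1 : W ≤ U) (h2 : W ≤ V), x ∈ W ∧
      Sec.res h1 f = Sec.res h2 g := germOf_eq_iff

theorem germ_smul_sec_germ {U : Opens X} (hx : x ∈ U) (P : DiffOp n U) (s : Sec M U) :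
    DiffOp.germ hx P • Sec.germ hx s = Sec.germ hx (P • s) :=
  Germ.map₂_germOf _ _ hx P s

/-- The map on stalks induced by a morphism of `𝒟_X`-modules. -/
def stalkMap {N : DModule.{u, v} n X} (f : M ⟶ N) (x : X) :
    SecStalk x M →ₗ[DiffStalk n x] SecStalk x N where
  toFun := Germ.map (fun U => Sec.map f U) fun h s => Sec.res_map f h s
  map_add' a b := by
    obtain ⟨U, hx, a, b, rfl, rfl⟩ := exists_germOf₂ a b
    rw [← germOf_add, Germ.map_germOf, Germ.map_germOf, Germ.map_germOf, map_add, germOf_add]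
  map_smul' P s := by
    obtain ⟨U, hx, P, s, rfl, rfl⟩ := exists_germOf₂ P s
    refine (congrArg _ (germ_smul_sec_germ hx P s)).trans ?_
    refine Eq.trans ?_ (germ_smul_sec_germ hx P (Sec.map f U s)).symm
    exact congrArg (germOf (Sec N) hx) (map_smul (Sec.map f U) P s)

theorem stalkMap_germ {N : DModule.{u, v} n X} (f : M ⟶ N) {U : Opens X} (hx : x ∈ U)
    (s : Sec M U) : stalkMap f x (Sec.germ hx s) = Sec.germ hx (Sec.map f U s) := rfl

namespace Subsheaf

/-- The stalk of a subsheaf. -/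
def stalk (S : Subsheaf M) (x : X) : AddSubgroup (SecStalk x M) where
  carrier := {a | ∃ (U : Opens X) (hx : x ∈ U), ∃ s ∈ S.sections U, Sec.germ hx s = a}
  zero_mem' := ⟨⊤, trivial, 0, zero_mem _, map_zero _⟩
  add_mem' := by
    rintro _ _ ⟨U, hU, s, hs, rfl⟩ ⟨V, hV, t, ht, rfl⟩
    have hW : x ∈ U ⊓ V := ⟨hU, hV⟩
    refine ⟨U ⊓ V, hW, _, add_mem (S.res_mem inf_le_left hs) (S.res_mem inf_le_right ht), ?_⟩
    rw [map_add, Sec.germ_res, Sec.germ_res]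
  neg_mem' := by
    rintro _ ⟨U, hU, s, hs, rfl⟩
    exact ⟨U, hU, -s, neg_mem hs, map_neg _ _⟩

theorem germ_mem_stalk {S : Subsheaf M} {U : Opens X} (hx : x ∈ U) {s : Sec M U}
    (hs : s ∈ S.sections U) : Sec.germ hx s ∈ S.stalk x := ⟨U, hx, s, hs, rfl⟩

theorem germ_mem_stalk_iff {S : Subsheaf M} {U : Opens X} (hx : x ∈ U) {s : Sec M U} :
    Sec.germ hx s ∈ S.stalk x ↔ ∃ (W : Opens X) (h : W ≤ U), x ∈ W ∧ Sec.res h s ∈ S.sections W := by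
  constructor
  · rintro ⟨V, hV, t, ht, e⟩
    obtain ⟨W, h1, h2, hW, e⟩ := Sec.germ_eq_iff.1 e
    exact ⟨W, h2, hW, e ▸ S.res_mem h1 ht⟩
  · rintro ⟨W, h, hW, hs⟩
    exact ⟨W, hW, _, hs, Sec.germ_res h hW s⟩

/-- Membership in a subsheaf is local, so it can be read off on germs. Together with
`mem_map_sections_iff` this turns the theorem into a statement about stalks. -/
theorem mem_sections_iff {S : Subsheaf M} {U : Opens X} {s : Sec M U} :
    s ∈ S.sections U ↔ ∀ x (hx : x ∈ U), Sec.germ hx s ∈ S.stalk x :=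
  ⟨fun hs _ hx => germ_mem_stalk hx hs, fun h => S.mem_of_local fun x hx =>
    (germ_mem_stalk_iff hx).1 (h x hx)⟩

theorem mem_map_sections_iff {N : DModule.{u, v} n X} (f : M ⟶ N) {S : Subsheaf M} {U : Opens X}
    {t : Sec N U} : t ∈ (S.map f).sections U ↔
      ∀ x (hx : x ∈ U), ∃ a ∈ S.stalk x, stalkMap f x a = Sec.germ hx t := by
  constructor
  · intro h x hx
    obtain ⟨W, hW, hxW, s, hs, e⟩ := h x hx
    exact ⟨_, germ_mem_stalk hxW hs, by rw [stalkMap_germ, e, Sec.germ_res]⟩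
  · intro h x hx
    obtain ⟨_, ⟨V, hV, s, hs, rfl⟩, e⟩ := h x hx
    rw [stalkMap_germ, Sec.germ_eq_iff] at e
    obtain ⟨W, h1, h2, hW, e⟩ := e
    exact ⟨W, h2, hW, _, S.res_mem h1 hs, by rw [← Sec.res_map, e]⟩

end Subsheaf

end Sections

end Stalks

/-! ### Power series and analytic functions of several variables -/

noncomputable section SeriesFunctions

open MvPowerSeries Filter Topology

variable {n : ℕ}

/-- The value at `z` of the monomial with exponent `b`. -/
def monoVal (z : Fin n → ℂ) (b : Fin n →₀ ℕ) : ℂ := ∏ i, z i ^ b i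

theorem monoVal_zero (z : Fin n → ℂ) : monoVal z 0 = 1 := by simp [monoVal]

theorem monoVal_add (z : Fin n → ℂ) (a b : Fin n →₀ ℕ) :
    monoVal z (a + b) = monoVal z a * monoVal z b := by
  simp [monoVal, pow_add, Finset.prod_mul_distrib]

theorem monoVal_single (z : Fin n → ℂ) (i : Fin n) : monoVal z (Finsupp.single i 1) = z i := by
  rw [monoVal, Finset.prod_eq_single i] <;> simp +contextual [eq_comm]

theorem norm_monoVal_le {z : Fin n → ℂ} {ρ : ℝ} (hz : ‖z‖ ≤ ρ) (b : Fin n →₀ ℕ) :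
    ‖monoVal z b‖ ≤ ρ ^ b.degree := by
  rw [monoVal, norm_prod, Finsupp.degree_eq_sum, ← Finset.prod_pow_eq_pow_sum]
  refine Finset.prod_le_prod (fun i _ => norm_nonneg _) fun i _ => ?_
  rw [norm_pow]
  exact pow_le_pow_left₀ (norm_nonneg _) ((norm_le_pi_norm z i).trans hz) _

/-- Words in the coordinates. -/
abbrev Word (n : ℕ) : Type := Σ k : ℕ, (Fin k → Fin n)

/-- The exponent of a word. -/
def Word.content (v : Word n) : Fin n →₀ ℕ := ∑ j, Finsupp.single (v.2 j) 1

theorem Word.monoVal_content (z : Fin n → ℂ) (v : Word n) :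
    monoVal z v.content = ∏ j, z (v.2 j) := by
  have h : ∀ (k : ℕ) (s : Finset (Fin k)) (f : Fin k → Fin n),
      monoVal z (∑ j ∈ s, Finsupp.single (f j) 1) = ∏ j ∈ s, z (f j) := by
    intro k s f
    classical
    induction s using Finset.induction_on with
    | empty => simp [monoVal_zero]
    | insert a s ha ih => rw [Finset.sum_insert ha, Finset.prod_insert ha, monoVal_add,
        monoVal_single, ih]
  exact h _ _ _

theorem Word.degree_content (v : Word n) : v.content.degree = v.1 := by
  simp [Word.content, map_sum]

/-- Needed to rewrite a series over exponents as a series over words, whose terms of length `k` are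
values of `k`-linear forms. -/
theorem Word.content_surjective : Function.Surjective (Word.content (n := n)) := by
  intro b
  refine ⟨⟨_, (Finsupp.toMultiset b).toList.get⟩, ?_⟩
  rw [Word.content]
  have h : ∀ l : List (Fin n), ∑ j : Fin l.length, Finsupp.single (l.get j) 1 =
      Multiset.toFinsupp (l : Multiset (Fin n)) := by
    intro l
    rw [← List.sum_ofFn]
    have : (List.ofFn fun j : Fin l.length => Finsupp.single (l.get j) 1) =
        l.map fun i => Finsupp.single i 1 := by
      conv_rhs => rw [← List.ofFn_get l, List.map_ofFn]
      rfl
    rw [this]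
    clear this
    induction l with
    | nil => simp
    | cons a l ih =>
      rw [List.map_cons, List.sum_cons, ih, ← Multiset.cons_coe, ← Multiset.singleton_add, map_add,
        Multiset.toFinsupp_singleton]
  rw [h, Multiset.coe_toList, Finsupp.toMultiset_toFinsupp]

/-- The multilinear form `(z^(1), …, z^(k)) ↦ ∏ z^(j)_{v_j}`. -/
def wordForm {k : ℕ} (v : Fin k → Fin n) :
    ContinuousMultilinearMap ℂ (fun _ : Fin k => Fin n → ℂ) ℂ :=
  (ContinuousMultilinearMap.mkPiAlgebra ℂ (Fin k) ℂ).compContinuousLinearMap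
    fun j => ContinuousLinearMap.proj (v j)

theorem wordForm_apply {k : ℕ} (v : Fin k → Fin n) (z : Fin n → ℂ) :
    wordForm v (fun _ => z) = monoVal z (Word.content ⟨k, v⟩) := by
  rw [Word.monoVal_content]; simp [wordForm]

theorem norm_wordForm_le {k : ℕ} (v : Fin k → Fin n) : ‖wordForm v‖ ≤ 1 := by
  refine (ContinuousMultilinearMap.norm_compContinuousLinearMap_le _ _).trans ?_
  rw [ContinuousMultilinearMap.norm_mkPiAlgebra, one_mul]
  refine Finset.prod_le_one (fun _ _ => norm_nonneg _) fun j _ => ?_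
  exact ContinuousLinearMap.opNorm_le_bound _ zero_le_one fun z => by
    rw [one_mul]; exact norm_le_pi_norm z _

/-- An absolutely convergent power series defines an analytic function. -/
theorem exists_analytic_of_summable (c : (Fin n →₀ ℕ) → ℂ) {ρ : ℝ} (hρ : 0 < ρ)
    (hc : Summable fun b => ‖c b‖ * ρ ^ b.degree) :
    ∃ F : (Fin n → ℂ) → ℂ, AnalyticOnNhd ℂ F (Metric.ball 0 ρ) ∧
      ∀ z ∈ Metric.ball (0 : Fin n → ℂ) ρ, HasSum (fun b => c b * monoVal z b) (F z) := by
  have hsum : ∀ z ∈ Metric.ball (0 : Fin n → ℂ) ρ, Summable fun b => c b * monoVal z b := by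
    intro z hz
    refine Summable.of_norm_bounded hc fun b => ?_
    rw [norm_mul]
    gcongr
    exact norm_monoVal_le (mem_ball_zero_iff.1 hz).le b
  refine ⟨fun z => ∑' b, c b * monoVal z b, ?_, fun z hz => (hsum z hz).hasSum⟩
  -- One word is chosen for each exponent and carries its coefficient; all other words get
  -- coefficient zero.
  obtain ⟨s, hs⟩ := Word.content_surjective.hasRightInverse (f := Word.content (n := n))
  have hsi : Function.Injective s := hs.injective
  set d : Word n → ℂ := Function.extend s c 0 with hd
  have hd0 : ∀ v ∉ Set.range s, d v = 0 := fun v hv => by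
    rw [hd, Function.extend_apply' _ _ _ fun ⟨b, hb⟩ => hv ⟨b, hb⟩]; rfl
  have hds : ∀ b, d (s b) = c b := fun b => hsi.extend_apply c 0 b
  have hdeg : ∀ b, (s b).1 = b.degree := fun b => by
    rw [← Word.degree_content, hs b]
  have hd1 : Summable fun v : Word n => ‖d v‖ * ρ ^ v.1 := by
    rw [← hsi.summable_iff (fun v hv => by rw [hd0 v hv, norm_zero, zero_mul])]
    refine hc.congr fun b => ?_
    simp only [Function.comp, hds, hdeg]
  let p : FormalMultilinearSeries ℂ (Fin n → ℂ) ℂ := fun k => ∑ v, d ⟨k, v⟩ • wordForm v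
  have hp : HasFPowerSeriesOnBall (fun z => ∑' b, c b * monoVal z b) p 0 (ENNReal.ofReal ρ) := by
    refine ⟨?_, ENNReal.ofReal_pos.2 hρ, fun {y} hy => ?_⟩
    · refine p.le_radius_of_summable_norm ?_
      rw [Real.coe_toNNReal _ hρ.le]
      refine Summable.of_nonneg_of_le (fun k => by positivity) (fun k => ?_) hd1.sigma
      have e : ∑' v, ‖d ⟨k, v⟩‖ * ρ ^ (⟨k, v⟩ : Word n).1 = (∑ v, ‖d ⟨k, v⟩‖) * ρ ^ k := by
        rw [tsum_fintype, Finset.sum_mul]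
      rw [e]
      gcongr
      refine (norm_sum_le _ _).trans (Finset.sum_le_sum fun v _ => ?_)
      rw [norm_smul]
      exact mul_le_of_le_one_right (norm_nonneg _) (norm_wordForm_le v)
    · rw [Metric.eball_ofReal] at hy
      rw [zero_add]
      have h1 := (hsum y hy).hasSum
      have h2 : HasSum (fun v : Word n => d v * monoVal y v.content) (∑' b, c b * monoVal y b) := by
        rw [← hsi.hasSum_iff (fun v hv => by rw [hd0 v hv, zero_mul])]
        refine h1.congr_fun fun b => ?_
        simp only [Function.comp, hds, hs b]
      refine (h2.sigma fun k => hasSum_fintype _).congr_fun fun k => ?_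
      simp [p, wordForm_apply]
  have := hp.analyticOnNhd
  rwa [Metric.eball_ofReal] at this

/-- An analytic function is the sum of an absolutely convergent power series. -/
theorem exists_series_of_analyticAt {F : (Fin n → ℂ) → ℂ} {a : Fin n → ℂ}
    (hF : AnalyticAt ℂ F a) : ∃ (c : (Fin n →₀ ℕ) → ℂ) (ρ : ℝ), 0 < ρ ∧
      (Summable fun b => ‖c b‖ * ρ ^ b.degree) ∧
      ∀ z ∈ Metric.ball (0 : Fin n → ℂ) ρ, HasSum (fun b => c b * monoVal z b) (F (a + z)) := by
  obtain ⟨p, R, hp⟩ := hF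
  obtain ⟨R', hR'0, hR'⟩ := ENNReal.lt_iff_exists_nnreal_btwn.1 hp.r_pos
  have hR'0 : 0 < (R' : ℝ) := by exact_mod_cast hR'0
  -- There are `n ^ k` words of length `k`, each with coefficient of norm at most `‖p k‖`, so `n * ρ
  -- ≤ R'` is needed. The summand `1` keeps the denominator positive when `n = 0`.
  set ρ : ℝ := R' / (n + 1) with hρ
  have hρ0 : 0 < ρ := by positivity
  have hnρ : n * ρ ≤ R' := by
    rw [hρ, mul_div_assoc', div_le_iff₀ (by positivity)]
    nlinarith
  have hρR : ρ ≤ R' := div_le_self hR'0.le (by linarith [(Nat.cast_nonneg n : (0 : ℝ) ≤ n)])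
  let d : Word n → ℂ := fun v => p v.1 fun j => Pi.single (v.2 j) 1
  have hd1 : Summable fun v : Word n => ‖d v‖ * ρ ^ v.1 := by
    have hd : ∀ v : Word n, ‖d v‖ ≤ ‖p v.1‖ := fun v => by
      refine ((p v.1).le_opNorm _).trans (mul_le_of_le_one_right (norm_nonneg _) ?_)
      refine Finset.prod_le_one (fun _ _ => norm_nonneg _) fun j _ => ?_
      rw [Pi.norm_single, norm_one]
    have h1 := p.summable_norm_mul_pow (hR'.trans_le hp.r_le)
    refine (summable_sigma_of_nonneg fun v => by positivity).2
      ⟨fun k => (hasSum_fintype _).summable, ?_⟩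
    refine Summable.of_nonneg_of_le (fun k => tsum_nonneg fun v => by positivity)
      (fun k => ?_) h1
    rw [tsum_fintype]
    calc ∑ v : Fin k → Fin n, ‖d ⟨k, v⟩‖ * ρ ^ k ≤ ∑ v : Fin k → Fin n, ‖p k‖ * ρ ^ k :=
          Finset.sum_le_sum fun v _ => by gcongr; exact hd ⟨k, v⟩
      _ = ‖p k‖ * (n * ρ) ^ k := by
          rw [Finset.sum_const, Finset.card_univ, Fintype.card_fun, Fintype.card_fin,
            Fintype.card_fin, nsmul_eq_mul, mul_pow]
          push_cast
          ring
      _ ≤ _ := by gcongr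
  have hd2 : ∀ z ∈ Metric.ball (0 : Fin n → ℂ) ρ,
      HasSum (fun v : Word n => d v * monoVal z v.content) (F (a + z)) := by
    intro z hz
    have hz' : z ∈ Metric.eball (0 : Fin n → ℂ) R := by
      rw [mem_ball_zero_iff] at hz
      rw [mem_eball_zero_iff]
      refine lt_of_le_of_lt ?_ hR'
      rw [← ofReal_norm, ← ENNReal.ofReal_coe_nnreal]
      exact ENNReal.ofReal_le_ofReal (hz.le.trans hρR)
    refine HasSum.sigma_of_hasSum (hp.hasSum hz') (fun k => ?_) ?_
    · have e : z = ∑ i, z i • (Pi.single i 1 : Fin n → ℂ) := by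
        ext j; simp [Finset.sum_apply, Pi.single_apply]
      have : (p k fun _ => z) = ∑ v : Fin k → Fin n, d ⟨k, v⟩ * monoVal z (Word.content ⟨k, v⟩) := by
        conv_lhs => rw [e]
        rw [ContinuousMultilinearMap.map_sum]
        refine Finset.sum_congr rfl fun v _ => ?_
        rw [ContinuousMultilinearMap.map_smul_univ, Word.monoVal_content, smul_eq_mul, mul_comm]
      rw [this]
      exact hasSum_fintype _
    · refine Summable.of_norm_bounded hd1 fun v => ?_
      rw [norm_mul, ← Word.degree_content v]
      gcongr
      exact norm_monoVal_le (mem_ball_zero_iff.1 hz).le _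
  -- Words with the same content give the same monomial, so their coefficients are added.
  refine ⟨fun b => ∑' v : ↑(Word.content ⁻¹' {b}), d v, ρ, hρ0, ?_, fun z hz => ?_⟩
  · have h1 := (hd1.hasSum.tsum_fiberwise Word.content).summable
    refine Summable.of_nonneg_of_le (fun b => by positivity) (fun b => ?_) h1
    have h2 : Summable fun v : ↑(Word.content ⁻¹' {b}) => ‖d v‖ * ρ ^ v.1.1 := hd1.subtype _
    have h3 : ∀ v : ↑(Word.content ⁻¹' {b}), ‖d v‖ * ρ ^ v.1.1 = ‖d v‖ * ρ ^ b.degree := by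
      rintro ⟨v, rfl⟩
      rw [Word.degree_content]
    rw [tsum_congr h3, tsum_mul_right]
    simp only [h3] at h2
    gcongr
    exact norm_tsum_le_tsum_norm ((summable_mul_right_iff (by positivity)).1 h2)
  · refine ((hd2 z hz).tsum_fiberwise Word.content).congr_fun fun b => ?_
    rw [← tsum_mul_right]
    refine tsum_congr ?_
    rintro ⟨v, rfl⟩
    rfl

/-- Cauchy product: in `ℂ` summability is absolute, so no further hypothesis is needed. -/
theorem hasSum_antidiagonal {A : Type*} [AddCommMonoid A] [Finset.HasAntidiagonal A] {f g : A → ℂ} {u v : ℂ}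
    (hf : HasSum f u) (hg : HasSum g v) :
    HasSum (fun b => ∑ p ∈ Finset.HasAntidiagonal.antidiagonal b, f p.1 * g p.2) (u * v) := by
  have h1 := summable_mul_of_summable_norm hf.summable.norm hg.summable.norm
  rw [← hf.tsum_eq, ← hg.tsum_eq,
    hf.summable.tsum_mul_tsum_eq_tsum_sum_antidiagonal hg.summable h1]
  exact (summable_sum_mul_antidiagonal_of_summable_mul h1).hasSum

theorem hasSum_coeff_mul {f g : MvPowerSeries (Fin n) ℂ} {z : Fin n → ℂ} {u v : ℂ}
    (hf : HasSum (fun b => coeff b f * monoVal z b) u)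
    (hg : HasSum (fun b => coeff b g * monoVal z b) v) :
    HasSum (fun b => coeff b (f * g) * monoVal z b) (u * v) := by
  refine (hasSum_antidiagonal hf hg).congr_fun fun b => ?_
  rw [coeff_mul, Finset.sum_mul]
  refine Finset.sum_congr rfl fun p hp => ?_
  have : monoVal z b = monoVal z p.1 * monoVal z p.2 := by
    rw [← monoVal_add, Finset.HasAntidiagonal.mem_antidiagonal.1 hp]
  rw [this]
  ring

theorem hasSum_coeff_monomial (a : Fin n →₀ ℕ) (c : ℂ) (z : Fin n → ℂ) :
    HasSum (fun b => coeff b (monomial a c) * monoVal z b) (c * monoVal z a) := by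
  classical
  refine (hasSum_ite_eq a (c * monoVal z a)).congr_fun fun b => ?_
  rw [coeff_monomial]
  split_ifs with h
  · rw [h]
  · rw [zero_mul]

section ConvSeries

variable {w : Fin n → ℝ} (hw : ∀ i, 0 < w i)

include hw in
-- Evaluate at the point with coordinates `exp (-s * w i)`. For large `s` the initial monomial
-- exceeds the sum of all other terms in absolute value, so the sum of a nonzero series cannot
-- vanish there.
theorem eq_zero_of_hasSum_zero (hinj : Function.Injective (Finsupp.weight w : (Fin n →₀ ℕ) → ℝ))
    {f : MvPowerSeries (Fin n) ℂ} (hf : f ∈ convSeries hw) {ρ : ℝ} (hρ : 0 < ρ)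
    (h : ∀ z ∈ Metric.ball (0 : Fin n → ℂ) ρ, HasSum (fun b => coeff b f * monoVal z b) 0) :
    f = 0 := by
  by_contra hne
  obtain ⟨a, ha⟩ := exists_isInitial hw hinj hne
  have hε : ‖coeff a f‖ₑ / 2 ≠ 0 := by simpa using ha.1
  have h1 : ∀ᶠ s : ℝ in atTop, ∀ i, Real.exp (-s * w i) < ρ := by
    rw [eventually_all]
    intro i
    have : Tendsto (fun s : ℝ => Real.exp (-s * w i)) atTop (𝓝 0) :=
      Real.tendsto_exp_atBot.comp (Tendsto.atBot_mul_const (hw i) tendsto_neg_atTop_atBot)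
    exact this.eventually (gt_mem_nhds hρ)
  obtain ⟨s, hs1, hs2⟩ := (h1.and (eventually_seriesNorm_sub_le hw hf ha hε)).exists
  set z : Fin n → ℂ := fun i => (Real.exp (-s * w i) : ℂ) with hz
  have hzn : ∀ i, ‖z i‖ = Real.exp (-s * w i) := fun i => by
    rw [hz]
    simp only [Complex.norm_real, Real.norm_eq_abs, Real.abs_exp]
  have hzb : ∀ b, ‖monoVal z b‖ₑ = monomialSize w s b := by
    intro b
    rw [← ofReal_norm, monomialSize, monoVal, norm_prod, Finsupp.weight_apply,
      Finsupp.sum_fintype _ _ (by simp), Finset.mul_sum, Real.exp_sum]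
    congr 1
    refine Finset.prod_congr rfl fun i _ => ?_
    rw [norm_pow, hzn, nsmul_eq_mul, mul_left_comm, Real.exp_nat_mul]
  have hzρ : z ∈ Metric.ball (0 : Fin n → ℂ) ρ := by
    rw [mem_ball_zero_iff, pi_norm_lt_iff hρ]
    intro i
    rw [hzn]
    exact hs1 i
  have h2 := (h z hzρ).sub (hasSum_coeff_monomial a (coeff a f) z)
  have h3 : ‖coeff a f‖ₑ * monomialSize w s a ≤
      seriesNorm w s (f - monomial a (coeff a f)) := by
    rw [← hzb, ← enorm_mul, ← enorm_neg, ← zero_sub, ← h2.tsum_eq]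
    refine enorm_tsum_le_tsum_enorm.trans (ENNReal.tsum_le_tsum fun b => ?_)
    rw [← sub_mul, ← map_sub, enorm_mul, hzb]
  have h4 := (ENNReal.mul_le_mul_iff_left (monomialSize_ne_zero w s a)
    (monomialSize_ne_top w s a)).1 (h3.trans hs2)
  exact absurd (ENNReal.half_lt_self (enorm_ne_zero.2 ha.1) enorm_ne_top) (not_lt.2 h4)

theorem summable_of_mem_convSeries {f : MvPowerSeries (Fin n) ℂ} (hf : f ∈ convSeries hw) :
    ∃ ρ : ℝ, 0 < ρ ∧ Summable fun b => ‖coeff b f‖ * ρ ^ b.degree := by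
  obtain ⟨s, hs⟩ := hf
  set W := ∑ i, w i with hW
  have hW0 : ∀ i, w i ≤ W := fun i => Finset.single_le_sum (fun i _ => (hw i).le) (Finset.mem_univ i)
  -- A radius not exceeding any of the radii `exp (-s * w i)`, whatever the sign of `s`.
  refine ⟨Real.exp (-|s| * W), Real.exp_pos _, ?_⟩
  have h1 : Summable fun b => ‖coeff b f‖ * Real.exp (-s * Finsupp.weight w b) := by
    have h2 : ∀ b, ‖coeff b f‖ₑ * monomialSize w s b =
        ((‖coeff b f‖₊ * (Real.exp (-s * Finsupp.weight w b)).toNNReal : NNReal) : ℝ≥0∞) := by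
      intro b
      rw [ENNReal.coe_mul]
      rfl
    rw [seriesNorm, tsum_congr h2] at hs
    have h3 := ENNReal.tsum_coe_ne_top_iff_summable.1 hs.ne
    refine (NNReal.summable_coe.2 h3).congr fun b => ?_
    rw [NNReal.coe_mul, coe_nnnorm, Real.coe_toNNReal _ (Real.exp_pos _).le]
  refine Summable.of_nonneg_of_le (fun b => by positivity) (fun b => ?_) h1
  gcongr
  rw [← Real.exp_nat_mul, Real.exp_le_exp]
  have h4 : Finsupp.weight w b ≤ b.degree * W := by
    rw [Finsupp.weight_apply, Finsupp.sum_fintype _ _ (by simp), Finsupp.degree_eq_sum]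
    push_cast
    rw [Finset.sum_mul]
    refine Finset.sum_le_sum fun i _ => ?_
    rw [nsmul_eq_mul]
    gcongr
    exact hW0 i
  have h5 := weight_nonneg hw b
  nlinarith [le_abs_self s, abs_nonneg s]

theorem mem_convSeries_of_summable {f : MvPowerSeries (Fin n) ℂ} {ρ : ℝ} (hρ : 0 < ρ)
    (h : Summable fun b => ‖coeff b f‖ * ρ ^ b.degree) : f ∈ convSeries hw := by
  obtain ⟨s, hs⟩ : ∃ s : ℝ, ∀ i, Real.exp (-s * w i) ≤ ρ := by
    have : ∀ᶠ s : ℝ in atTop, ∀ i, Real.exp (-s * w i) ≤ ρ := by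
      rw [eventually_all]
      intro i
      have : Tendsto (fun s : ℝ => Real.exp (-s * w i)) atTop (𝓝 0) :=
        Real.tendsto_exp_atBot.comp (Tendsto.atBot_mul_const (hw i) tendsto_neg_atTop_atBot)
      exact (this.eventually (gt_mem_nhds hρ)).mono fun _ h => h.le
    exact this.exists
  refine ⟨s, lt_of_le_of_lt (b := ∑' b, ENNReal.ofReal (‖coeff b f‖ * ρ ^ b.degree))
    (ENNReal.tsum_le_tsum fun b => ?_) h.tsum_ofReal_lt_top⟩
  rw [← ofReal_norm, monomialSize, ← ENNReal.ofReal_mul (norm_nonneg _)]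
  refine ENNReal.ofReal_le_ofReal (mul_le_mul_of_nonneg_left ?_ (norm_nonneg _))
  rw [Finsupp.weight_apply, Finsupp.sum_fintype _ _ (by simp), Finsupp.degree_eq_sum,
    Finset.mul_sum, Real.exp_sum, ← Finset.prod_pow_eq_pow_sum]
  refine Finset.prod_le_prod (fun i _ => (Real.exp_pos _).le) fun i _ => ?_
  rw [nsmul_eq_mul, mul_left_comm, Real.exp_nat_mul]
  exact pow_le_pow_left₀ (Real.exp_pos _).le (hs i) _

end ConvSeries

end SeriesFunctions

/-! ### Germs of functions as convergent series; divisibility by coordinates -/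

noncomputable section SeriesAtPoint

open Filter Topology

set_option linter.unusedSectionVars false

variable {n : ℕ} {X : Type u} [TopologicalSpace X] [ChartedSpace (Fin n → ℂ) X] {x : X}

instance : Algebra ℂ (HolStalk n x) :=
  RingHom.toAlgebra
    { toFun := fun c => germOf (Hol n) (Opens.mem_top x) (algebraMap ℂ _ c)
      map_one' := by rw [map_one, germOf_one]
      map_mul' := fun a b => by rw [map_mul, germOf_mul]
      map_zero' := by rw [map_zero, germOf_zero]
      map_add' := fun a b => by rw [map_add, germOf_add] }

theorem Hol.germ_algebraMap {U : Opens X} (hx : x ∈ U) (c : ℂ) :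
    Hol.germ hx (algebraMap ℂ (Hol n U) c) = algebraMap ℂ (HolStalk n x) c :=
  germOf_res (le_top : U ≤ ⊤) hx (algebraMap ℂ (Hol n (⊤ : Opens X)) c)

/-- The germ `g` is the sum of the power series `c` in the coordinates of `φ` centred at `x`. -/
def IsSeriesAt (φ : OpenPartialHomeomorph X (Fin n → ℂ)) (c : MvPowerSeries (Fin n) ℂ)
    (g : HolStalk n x) : Prop :=
  ∃ (U : Opens X) (hx : x ∈ U) (f : Hol n U), Hol.germ hx f = g ∧ (U : Set X) ⊆ φ.source ∧
    ∀ y : U, HasSum (fun b => MvPowerSeries.coeff b c * monoVal (φ y.1 - φ x) b) (f y)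

variable {φ : OpenPartialHomeomorph X (Fin n → ℂ)}

theorem IsSeriesAt.exists_common {c d : MvPowerSeries (Fin n) ℂ} {g h : HolStalk n x}
    (hg : IsSeriesAt φ c g) (hh : IsSeriesAt φ d h) :
    ∃ (U : Opens X) (hx : x ∈ U) (f k : Hol n U), Hol.germ hx f = g ∧ Hol.germ hx k = h ∧
      (U : Set X) ⊆ φ.source ∧
      (∀ y : U, HasSum (fun b => MvPowerSeries.coeff b c * monoVal (φ y.1 - φ x) b) (f y)) ∧
      ∀ y : U, HasSum (fun b => MvPowerSeries.coeff b d * monoVal (φ y.1 - φ x) b) (k y) := by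
  obtain ⟨U, hU, f, rfl, hUφ, hf⟩ := hg
  obtain ⟨V, hV, k, rfl, hVφ, hk⟩ := hh
  have hx : x ∈ U ⊓ V := ⟨hU, hV⟩
  exact ⟨U ⊓ V, hx, Hol.res inf_le_left f, Hol.res inf_le_right k, Hol.germ_res _ hx f,
    Hol.germ_res _ hx k, fun y hy => hUφ hy.1, fun y => hf ⟨y.1, y.2.1⟩, fun y => hk ⟨y.1, y.2.2⟩⟩

theorem IsSeriesAt.unique {c : MvPowerSeries (Fin n) ℂ} {g h : HolStalk n x}
    (hg : IsSeriesAt φ c g) (hh : IsSeriesAt φ c h) : g = h := by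
  obtain ⟨U, hU, f, k, rfl, rfl, -, hf, hk⟩ := hg.exists_common hh
  congr 1
  ext y
  exact (hf y).unique (hk y)

theorem IsSeriesAt.add {c d : MvPowerSeries (Fin n) ℂ} {g h : HolStalk n x}
    (hg : IsSeriesAt φ c g) (hh : IsSeriesAt φ d h) : IsSeriesAt φ (c + d) (g + h) := by
  obtain ⟨U, hU, f, k, rfl, rfl, hUφ, hf, hk⟩ := hg.exists_common hh
  refine ⟨U, hU, f + k, map_add _ _ _, hUφ, fun y => ?_⟩
  simp only [map_add, add_mul]
  exact (hf y).add (hk y)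

theorem IsSeriesAt.mul {c d : MvPowerSeries (Fin n) ℂ} {g h : HolStalk n x}
    (hg : IsSeriesAt φ c g) (hh : IsSeriesAt φ d h) : IsSeriesAt φ (c * d) (g * h) := by
  obtain ⟨U, hU, f, k, rfl, rfl, hUφ, hf, hk⟩ := hg.exists_common hh
  exact ⟨U, hU, f * k, map_mul _ _ _, hUφ, fun y => hasSum_coeff_mul (hf y) (hk y)⟩

theorem isSeriesAt_algebraMap (hx : x ∈ φ.source) (a : ℂ) :
    IsSeriesAt φ (MvPowerSeries.monomial 0 a) (algebraMap ℂ (HolStalk n x) a) := by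
  refine ⟨⟨φ.source, φ.open_source⟩, hx, _, Hol.germ_algebraMap _ a, subset_rfl, fun y => ?_⟩
  have := hasSum_coeff_monomial 0 a (φ y.1 - φ x)
  rwa [monoVal_zero, mul_one] at this

variable [IsManifold 𝓘(ℂ, Fin n → ℂ) ω X]
  (hφ : φ ∈ IsManifold.maximalAtlas 𝓘(ℂ, Fin n → ℂ) ω X)

/-- The germ at `x` of the `j`-th coordinate of a chart `φ`. -/
def coordGerm (hx : x ∈ φ.source) (j : Fin n) : HolStalk n x :=
  Hol.germ (U := ⟨φ.source, φ.open_source⟩) hx (coord φ hφ subset_rfl j)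

theorem germ_coord {U : Opens X} (hU : (U : Set X) ⊆ φ.source) (hx : x ∈ U) (j : Fin n) :
    Hol.germ hx (coord φ hφ hU j) = coordGerm hφ (hU hx) j :=
  Hol.germ_res (V := U) (U := ⟨φ.source, φ.open_source⟩) hU hx (coord φ hφ subset_rfl j)

theorem isSeriesAt_coord (hx : x ∈ φ.source) (j : Fin n) :
    IsSeriesAt φ (MvPowerSeries.monomial (Finsupp.single j 1) 1)
      (coordGerm hφ hx j - algebraMap ℂ (HolStalk n x) (φ x j)) := by
  refine ⟨⟨φ.source, φ.open_source⟩, hx, coord φ hφ subset_rfl j - algebraMap ℂ _ (φ x j), ?_,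
    subset_rfl, fun y => ?_⟩
  · rw [map_sub, Hol.germ_algebraMap]; rfl
  · have := hasSum_coeff_monomial (Finsupp.single j 1) 1 (φ y.1 - φ x)
    rwa [monoVal_single, one_mul] at this

variable {w : Fin n → ℝ} (hw : ∀ i, 0 < w i)

/-- The points of the domain of `φ` at distance `< ρ` from `x` in the chart. -/
def chartBall (φ : OpenPartialHomeomorph X (Fin n → ℂ)) (x : X) (ρ : ℝ) : Opens X :=
  ⟨φ.source ∩ φ ⁻¹' Metric.ball (φ x) ρ, φ.isOpen_inter_preimage Metric.isOpen_ball⟩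

theorem mem_chartBall (hx : x ∈ φ.source) {ρ : ℝ} (hρ : 0 < ρ) : x ∈ chartBall φ x ρ :=
  ⟨hx, Metric.mem_ball_self hρ⟩

theorem sub_mem_ball {ρ : ℝ} {y : X} (hy : y ∈ chartBall φ x ρ) :
    φ y - φ x ∈ Metric.ball (0 : Fin n → ℂ) ρ := by
  rw [mem_ball_zero_iff, ← dist_eq_norm]; exact hy.2

include hφ in
theorem exists_isSeriesAt (hx : x ∈ φ.source) {c : MvPowerSeries (Fin n) ℂ}
    (hc : c ∈ convSeries hw) : ∃ g : HolStalk n x, IsSeriesAt φ c g := by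
  obtain ⟨ρ, hρ, hs⟩ := summable_of_mem_convSeries hw hc
  obtain ⟨F, hF, hsum⟩ := exists_analytic_of_summable _ hρ hs
  refine ⟨_, chartBall φ x ρ, mem_chartBall hx hρ, ⟨fun y => F (φ y.1 - φ x), fun y => ?_⟩, rfl,
    fun y hy => hy.1, fun y => hsum _ (sub_mem_ball y.2)⟩
  have h1 : ContMDiffAt 𝓘(ℂ, Fin n → ℂ) 𝓘(ℂ, Fin n → ℂ) ω φ y.1 :=
    contMDiffAt_of_mem_maximalAtlas hφ y.2.1
  have h2 : ContDiffAt ℂ ω (fun z => F (z - φ x)) (φ y.1) :=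
    ContDiffAt.comp (φ y.1) (hF _ (sub_mem_ball y.2)).contDiffAt (contDiffAt_id.sub contDiffAt_const)
  exact contMDiffAt_subtype_iff.2 (h2.contMDiffAt.comp y.1 h1)

include hφ in
theorem exists_series (hx : x ∈ φ.source) (g : HolStalk n x) :
    ∃ c ∈ convSeries hw, IsSeriesAt φ c g := by
  obtain ⟨U, hU, f, rfl⟩ := Hol.exists_germ g
  have h0 : x ∈ U ⊓ ⟨φ.source, φ.open_source⟩ := ⟨hU, hx⟩
  have h1 : ((U ⊓ ⟨φ.source, φ.open_source⟩ : Opens X) : Set X) ⊆ φ.source := fun y hy => hy.2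
  have h2 : AnalyticAt ℂ (inChart φ (Hol.res (inf_le_left : U ⊓ ⟨φ.source, φ.open_source⟩ ≤ U) f))
    (φ x) := (inChart_contDiffAt φ hφ h1 (Hol.res inf_le_left f) ⟨x, h0⟩).analyticAt
  obtain ⟨c, ρ, hρ, hs, hsum⟩ := exists_series_of_analyticAt h2
  refine ⟨c, mem_convSeries_of_summable hw hρ hs, U ⊓ chartBall φ x ρ,
    ⟨hU, mem_chartBall hx hρ⟩, Hol.res inf_le_left f, Hol.germ_res _ _ f, fun y hy => hy.2.1,
    fun y => ?_⟩
  have h3 := hsum _ (sub_mem_ball y.2.2)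
  have h4 := inChart_apply φ h1 (Hol.res inf_le_left f) ⟨y.1, y.2.1, y.2.2.1⟩
  rw [add_sub_cancel] at h3
  rw [h4] at h3
  exact h3

theorem IsSeriesAt.eq_zero (hx : x ∈ φ.source)
    (hinj : Function.Injective (Finsupp.weight w : (Fin n →₀ ℕ) → ℝ))
    {c : MvPowerSeries (Fin n) ℂ} (hc : c ∈ convSeries hw)
    (h : IsSeriesAt φ c (0 : HolStalk n x)) : c = 0 := by
  obtain ⟨U, hU, f, hf, hUφ, hsum⟩ := h
  rw [← map_zero (Hol.germ hU), Hol.germ_eq_iff] at hf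
  obtain ⟨W, hW, h', hxW, e⟩ := hf
  have h1 : φ.symm ⁻¹' (W : Set X) ∈ 𝓝 (φ x) :=
    (φ.continuousAt_symm (φ.map_source hx)).preimage_mem_nhds
      (by rw [φ.left_inv hx]; exact W.2.mem_nhds hxW)
  obtain ⟨ρ, hρ, hball⟩ := Metric.mem_nhds_iff.1 (inter_mem h1 (φ.open_target.mem_nhds (φ.map_source hx)))
  refine eq_zero_of_hasSum_zero hw hinj hc hρ fun z hz => ?_
  have h2 := hball (show φ x + z ∈ Metric.ball (φ x) ρ by
    rwa [mem_ball_iff_norm, add_sub_cancel_left, ← mem_ball_zero_iff])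
  have h3 := hsum ⟨φ.symm (φ x + z), hW h2.1⟩
  have h4 : f ⟨φ.symm (φ x + z), hW h2.1⟩ = 0 :=
    congrArg (fun k : Hol n W => k ⟨φ.symm (φ x + z), h2.1⟩) e
  rwa [h4, φ.right_inv h2.2, add_sub_cancel_left] at h3

/-- The ring of germs at `x` is the ring of convergent power series. -/
def seriesEquiv (hx : x ∈ φ.source)
    (hinj : Function.Injective (Finsupp.weight w : (Fin n →₀ ℕ) → ℝ)) :
    convSeries hw ≃+* HolStalk n x :=
  have h (c : convSeries hw) := (exists_isSeriesAt hφ hw hx c.2).choose_spec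
  RingEquiv.ofBijective
    ({ toFun := fun c => (exists_isSeriesAt hφ hw hx c.2).choose
       map_one' := (h 1).unique (by
          have := isSeriesAt_algebraMap (φ := φ) hx (1 : ℂ)
          rwa [map_one (algebraMap ℂ _)] at this)
       map_mul' := fun c d => (h (c * d)).unique ((h c).mul (h d))
       map_zero' := (h 0).unique (by
          have := isSeriesAt_algebraMap (φ := φ) hx (0 : ℂ)
          rwa [map_zero (algebraMap ℂ _), map_zero] at this)
       map_add' := fun c d => (h (c + d)).unique ((h c).add (h d)) } : convSeries hw →+* HolStalk n x)
    ⟨(injective_iff_map_eq_zero _).2 fun c hc => by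
        have h1 := h c
        rw [show (exists_isSeriesAt hφ hw hx c.2).choose = 0 from hc] at h1
        exact Subtype.ext (h1.eq_zero hw hx hinj c.2),
      fun g => by
        obtain ⟨c, hc, hg⟩ := exists_series hφ hw hx g
        exact ⟨⟨c, hc⟩, (h ⟨c, hc⟩).unique hg⟩⟩

theorem isSeriesAt_seriesEquiv (hx : x ∈ φ.source)
    (hinj : Function.Injective (Finsupp.weight w : (Fin n →₀ ℕ) → ℝ)) (c : convSeries hw) :
    IsSeriesAt φ c.1 (seriesEquiv hφ hw hx hinj c) :=
  (exists_isSeriesAt hφ hw hx c.2).choose_spec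

theorem IsSeriesAt.seriesEquiv_eq (hx : x ∈ φ.source)
    (hinj : Function.Injective (Finsupp.weight w : (Fin n →₀ ℕ) → ℝ)) {c : convSeries hw}
    {g : HolStalk n x} (h : IsSeriesAt φ c.1 g) : seriesEquiv hφ hw hx hinj c = g :=
  (isSeriesAt_seriesEquiv hφ hw hx hinj c).unique h

include hφ in
-- The weights are auxiliary: any positive family separating exponents identifies the stalk with a
-- noetherian ring of convergent series.
theorem HolStalk.isNoetherianRing (hx : x ∈ φ.source) : IsNoetherianRing (HolStalk n x) := by
  obtain ⟨w, hw, hinj⟩ := exists_injective_weight n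
  have := convSeries_isNoetherianRing hw hinj
  exact isNoetherianRing_of_ringEquiv _ (seriesEquiv hφ hw hx hinj)

theorem shiftSeries_mem_convSeries {f : MvPowerSeries (Fin n) ℂ} (hf : f ∈ convSeries hw)
    (A : Set (Fin n →₀ ℕ)) (a : Fin n →₀ ℕ) : shiftSeries A a f ∈ convSeries hw := by
  obtain ⟨s, hs⟩ := hf
  exact ⟨s, (seriesNorm_shiftSeries_le w s A a f).trans_lt
    (ENNReal.mul_lt_top (ENNReal.inv_lt_top.2 (pos_iff_ne_zero.2 (monomialSize_ne_zero w s a))) hs)⟩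

/-- The coordinate `X_j` as a convergent power series. -/
def convX (j : Fin n) : convSeries hw := ⟨_, monomial_mem_convSeries hw (Finsupp.single j 1) 1⟩

/-- The shifted power series, as a convergent power series. -/
def convShift (A : Set (Fin n →₀ ℕ)) (a : Fin n →₀ ℕ) (c : convSeries hw) : convSeries hw :=
  ⟨_, shiftSeries_mem_convSeries hw c.2 A a⟩

theorem coeff_convX_mul_convShift (A : Set (Fin n →₀ ℕ)) (j : Fin n) (hA : ∀ b ∈ A, b j ≠ 0)
    (c : convSeries hw) (b : Fin n →₀ ℕ) :
    MvPowerSeries.coeff b (convX hw j * convShift hw A (Finsupp.single j 1) c).1 =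
      A.indicator (fun b => MvPowerSeries.coeff b c.1) b :=
  coeff_monomial_mul_shiftSeries A _ _ (fun b hb => by
    rw [Finsupp.single_le_iff]; exact Nat.one_le_iff_ne_zero.2 (hA b hb)) b

theorem seriesEquiv_convX (hx : x ∈ φ.source)
    (hinj : Function.Injective (Finsupp.weight w : (Fin n →₀ ℕ) → ℝ)) (j : Fin n) :
    seriesEquiv hφ hw hx hinj (convX hw j) =
      coordGerm hφ hx j - algebraMap ℂ (HolStalk n x) (φ x j) :=
  IsSeriesAt.seriesEquiv_eq hφ hw hx hinj (c := convX hw j) (isSeriesAt_coord hφ hx j)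

/-- The first order Taylor formula with holomorphic remainder terms. -/
theorem exists_hadamard (hx : x ∈ φ.source) (g : HolStalk n x) :
    ∃ (a : ℂ) (h : Fin n → HolStalk n x), g = algebraMap ℂ _ a +
      ∑ j, (coordGerm hφ hx j - algebraMap ℂ _ (φ x j)) * h j := by
  classical
  obtain ⟨w, hw, hinj⟩ := exists_injective_weight n
  obtain ⟨c, rfl⟩ := (seriesEquiv hφ hw hx hinj).surjective g
  -- Each nonzero exponent is attributed to its first nonzero coordinate. The sets `A j` are
  -- disjoint, and the part of the series supported on `A j` is divisible by the `j`-th variable.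
  set A : Fin n → Set (Fin n →₀ ℕ) := fun j => {b | b j ≠ 0 ∧ ∀ i < j, b i = 0} with hA
  have hA1 : ∀ j, ∀ b ∈ A j, b j ≠ 0 := fun j b hb => hb.1
  set c₀ : convSeries hw := ⟨_, monomial_mem_convSeries hw 0 (MvPowerSeries.coeff 0 c.1)⟩ with hc₀
  have key : c = c₀ + ∑ j, convX hw j * convShift hw (A j) (Finsupp.single j 1) c := by
    apply Subtype.ext
    rw [Subring.coe_add, AddSubmonoidClass.coe_finsetSum]
    ext b
    rw [map_add, map_sum]
    simp only [coeff_convX_mul_convShift hw _ _ (hA1 _)]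
    rw [hc₀, MvPowerSeries.coeff_monomial]
    by_cases hb : b = 0
    · subst hb
      rw [if_pos rfl, Finset.sum_eq_zero, add_zero]
      intro j _
      exact Set.indicator_of_notMem (fun h => h.1 rfl) _
    · rw [if_neg hb, zero_add]
      have hne : (Finset.univ.filter fun i => b i ≠ 0).Nonempty := by
        by_contra h
        rw [Finset.not_nonempty_iff_eq_empty, Finset.filter_eq_empty_iff] at h
        exact hb (Finsupp.ext fun i => not_not.1 (h (Finset.mem_univ i)))
      set j := (Finset.univ.filter fun i => b i ≠ 0).min' hne with hj
      have hj1 : b j ≠ 0 := (Finset.mem_filter.1 (Finset.min'_mem _ hne)).2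
      have hj2 : ∀ i < j, b i = 0 := fun i hi => by
        by_contra h
        exact absurd (Finset.min'_le _ i (Finset.mem_filter.2 ⟨Finset.mem_univ _, h⟩)) (not_le.2 hi)
      rw [Finset.sum_eq_single j, Set.indicator_of_mem (show b ∈ A j from ⟨hj1, hj2⟩)]
      · intro i _ hij
        refine Set.indicator_of_notMem (fun h => ?_) _
        rcases lt_or_gt_of_ne hij with h' | h'
        · exact h.1 (hj2 i h')
        · exact hj1 (h.2 j h')
      · simp
  refine ⟨MvPowerSeries.coeff 0 c.1, fun j => seriesEquiv hφ hw hx hinj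
    (convShift hw (A j) (Finsupp.single j 1) c), ?_⟩
  conv_lhs => rw [key]
  rw [map_add, map_sum, IsSeriesAt.seriesEquiv_eq hφ hw hx hinj (c := c₀) (isSeriesAt_algebraMap hx _)]
  simp only [map_mul, seriesEquiv_convX]

/-- A function vanishing on a coordinate hyperplane is divisible by the coordinate. -/
theorem coordGerm_dvd_of_vanish (hx : x ∈ φ.source) {j : Fin n} (hj : φ x j = 0) {U : Opens X}
    (hU : x ∈ U) (f : Hol n U)
    (h : ∀ y : U, y.1 ∈ φ.source → φ y.1 j = 0 → f y = 0) :
    coordGerm hφ hx j ∣ Hol.germ hU f := by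
  classical
  obtain ⟨w, hw, hinj⟩ := exists_injective_weight n
  obtain ⟨c, hc⟩ := (seriesEquiv hφ hw hx hinj).surjective (Hol.germ hU f)
  have h1 := isSeriesAt_seriesEquiv hφ hw hx hinj c
  rw [hc] at h1
  obtain ⟨V, hV, f', hf', hVφ, hsum⟩ := h1
  obtain ⟨W, hWV, hWU, hxW, e⟩ := Hol.germ_eq_iff.1 hf'
  have e' : ∀ y (hy : y ∈ W), f' ⟨y, hWV hy⟩ = f ⟨y, hWU hy⟩ := fun y hy =>
    congrArg (fun k : Hol n W => k ⟨y, hy⟩) e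
  set A : Set (Fin n →₀ ℕ) := {b | b j ≠ 0} with hA
  have hA1 : ∀ b ∈ A, b j ≠ 0 := fun b hb => hb
  -- the part of the series without `z_j`
  set c' : convSeries hw := c - convX hw j * convShift hw A (Finsupp.single j 1) c with hc'
  have hcoeff : ∀ b, MvPowerSeries.coeff b c'.1 = if b j = 0 then MvPowerSeries.coeff b c.1 else 0 := by
    intro b
    rw [hc', AddSubgroupClass.coe_sub, map_sub, coeff_convX_mul_convShift hw _ _ hA1]
    split_ifs with hb
    · rw [Set.indicator_of_notMem (fun h : b ∈ A => h hb), sub_zero]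
    · rw [Set.indicator_of_mem (show b ∈ A from hb), sub_self]
  have h1 : φ.symm ⁻¹' (W : Set X) ∈ 𝓝 (φ x) :=
    (φ.continuousAt_symm (φ.map_source hx)).preimage_mem_nhds
      (by rw [φ.left_inv hx]; exact W.2.mem_nhds hxW)
  obtain ⟨ρ, hρ, hball⟩ := Metric.mem_nhds_iff.1
    (inter_mem h1 (φ.open_target.mem_nhds (φ.map_source hx)))
  have hc'0 : c'.1 = 0 := by
    refine eq_zero_of_hasSum_zero hw hinj c'.2 hρ fun z hz => ?_
    -- The series `c'` collects the terms free of the `j`-th variable, so its terms at `z` are those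
    -- of `c` at `z'`. That point corresponds to a point of the hyperplane, where `f` vanishes.
    set z' : Fin n → ℂ := Function.update z j 0 with hz'
    have hz'ρ : φ x + z' ∈ Metric.ball (φ x) ρ := by
      rw [mem_ball_iff_norm, add_sub_cancel_left, pi_norm_lt_iff hρ]
      intro i
      rw [hz', Function.update_apply]
      split_ifs
      · rwa [norm_zero]
      · exact (norm_le_pi_norm z i).trans_lt (mem_ball_zero_iff.1 hz)
    have h2 := hball hz'ρ
    have h3 := hsum ⟨φ.symm (φ x + z'), hWV h2.1⟩
    rw [e' _ h2.1, h _ (φ.map_target h2.2)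
      (by rw [φ.right_inv h2.2, Pi.add_apply, hj, hz', Function.update_self, add_zero]),
      φ.right_inv h2.2, add_sub_cancel_left] at h3
    refine h3.congr_fun fun b => ?_
    rw [hcoeff]
    split_ifs with hb
    · congr 1
      refine Finset.prod_congr rfl fun i _ => ?_
      rw [hz', Function.update_apply]
      split_ifs with hi
      · rw [hi, hb, pow_zero, pow_zero]
      · rfl
    · rw [zero_mul, monoVal, Finset.prod_eq_zero (Finset.mem_univ j), mul_zero]
      rw [hz', Function.update_self, zero_pow hb]
  have hfin : c = convX hw j * convShift hw A (Finsupp.single j 1) c :=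
    sub_eq_zero.1 (Subtype.ext hc'0)
  rw [← hc, hfin, map_mul, seriesEquiv_convX, hj, map_zero, sub_zero]
  exact dvd_mul_right _ _

/-- A germ divisible by powers of several coordinates is divisible by their product. -/
theorem prod_coordGerm_pow_dvd (hx : x ∈ φ.source) {ι : Type*} [Fintype ι] (e : ι ↪ Fin n)
    (he : ∀ i, φ x (e i) = 0) (k : ι → ℕ) {g : HolStalk n x}
    (h : ∀ i, coordGerm hφ hx (e i) ^ k i ∣ g) : ∏ i, coordGerm hφ hx (e i) ^ k i ∣ g := by
  classical
  obtain ⟨w, hw, hinj⟩ := exists_injective_weight n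
  have hcoord : ∀ i, coordGerm hφ hx (e i) = seriesEquiv hφ hw hx hinj (convX hw (e i)) := fun i => by
    rw [seriesEquiv_convX, he, map_zero, sub_zero]
  obtain ⟨c, rfl⟩ := (seriesEquiv hφ hw hx hinj).surjective g
  simp only [hcoord, ← map_pow, ← map_prod] at h ⊢
  have h' : ∀ i, (MvPowerSeries.X (e i) : MvPowerSeries (Fin n) ℂ) ^ k i ∣ c.1 := fun i => by
    have h1 := h i
    rw [map_dvd_iff] at h1
    have := map_dvd (convSeries hw).subtype h1
    rwa [map_pow] at this
  refine map_dvd _ ?_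
  -- Divisibility by powers of variables is a condition on the support. Since the variables `e i`
  -- are distinct, the separate conditions combine into `a ≤ b`.
  set a : Fin n →₀ ℕ := ∑ i, Finsupp.single (e i) (k i) with ha
  have hcoef : ∀ b, MvPowerSeries.coeff b c.1 ≠ 0 → a ≤ b := by
    intro b hb j
    rw [ha, Finsupp.finsetSum_apply]
    by_cases hj : ∃ i, e i = j
    · obtain ⟨i, rfl⟩ := hj
      rw [Finset.sum_eq_single i]
      · rw [Finsupp.single_eq_same]
        by_contra hlt
        exact hb (MvPowerSeries.X_pow_dvd_iff.1 (h' i) b (not_le.1 hlt))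
      · intro i' _ hi'
        exact Finsupp.single_eq_of_ne fun h => hi' (e.injective h.symm)
      · simp
    · rw [Finset.sum_eq_zero]
      · exact Nat.zero_le _
      · intro i _
        exact Finsupp.single_eq_of_ne fun h => hj ⟨i, h.symm⟩
  refine ⟨convShift hw {b | a ≤ b} a c, Subtype.ext ?_⟩
  have hprod : ((∏ i, convX hw (e i) ^ k i : convSeries hw) : MvPowerSeries (Fin n) ℂ) = MvPowerSeries.monomial a 1 := by
    rw [SubmonoidClass.coe_finsetProd, ha]
    have h2 : ∀ s : Finset ι, (∏ i ∈ s, (MvPowerSeries.monomial (Finsupp.single (e i) 1) (1 : ℂ)) ^ k i) =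
        MvPowerSeries.monomial (∑ i ∈ s, Finsupp.single (e i) (k i)) 1 := by
      intro s
      induction s using Finset.induction_on with
      | empty => simp
      | insert i s hi ih =>
        rw [Finset.prod_insert hi, Finset.sum_insert hi, ih, MvPowerSeries.monomial_pow,
          MvPowerSeries.monomial_mul_monomial]
        simp
    exact h2 _
  rw [Subring.coe_mul, hprod]
  ext b
  refine Eq.trans ?_ (coeff_monomial_mul_shiftSeries {b | a ≤ b} a c.1 (fun b hb => hb) b).symm
  by_cases hb : a ≤ b
  · exact (Set.indicator_of_mem (s := {b | a ≤ b}) hb _).symm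
  · rw [Set.indicator_of_notMem (s := {b | a ≤ b}) hb]
    by_contra hne
    exact hb (hcoef b hne)

end SeriesAtPoint

/-! ### Normal forms of operators and abstract `V`-filtrations -/

noncomputable section Weyl

/-- A family of commuting elements of an algebra is the image of the variables. -/
theorem exists_algHom_of_commute {R A ι : Type*} [CommRing R] [Ring A] [Algebra R A] (a : ι → A)
    (h : ∀ i j, a i * a j = a j * a i) :
    ∃ ψ : MvPolynomial ι R →ₐ[R] A, ∀ i, ψ (MvPolynomial.X i) = a i := by
  have hc : ∀ x ∈ Set.range a, ∀ y ∈ Set.range a, x * y = y * x := by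
    rintro _ ⟨i, rfl⟩ _ ⟨j, rfl⟩
    exact h i j
  have := Algebra.isMulCommutative_adjoin R hc
  let _ : CommRing (Algebra.adjoin R (Set.range a)) :=
    { (inferInstance : Ring (Algebra.adjoin R (Set.range a))) with
      mul_comm := fun x y => this.is_comm.comm x y }
  let b : ι → Algebra.adjoin R (Set.range a) := fun i => ⟨a i, Algebra.subset_adjoin ⟨i, rfl⟩⟩
  refine ⟨(Algebra.adjoin R (Set.range a)).val.comp (MvPolynomial.aeval b), fun i => ?_⟩
  rw [AlgHom.comp_apply, MvPolynomial.aeval_X]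
  rfl

/-- A ring `D` of differential operators in `n` variables, acting on the ring of functions `O`. -/
structure WeylData (n : ℕ) (O D : Type*) [CommRing O] [Ring D] [Module D O] where
  mul : O →+* D
  del : Fin n → D
  z : Fin n → O
  mul_smul : ∀ a b, mul a • b = a * b
  del_comm : ∀ i j, del i * del j = del j * del i
  del_mul : ∀ j a, del j * mul a = mul a * del j + mul (del j • a)
  del_z : ∀ i j, del i • z j = if i = j then 1 else 0
  generates : Subring.closure (Set.range mul ∪ Set.range del) = ⊤

namespace WeylData

variable {n : ℕ} {O D : Type*} [CommRing O] [Ring D] [Module D O] (W : WeylData n O D)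

theorem mul_injective : Function.Injective W.mul := fun a b h => by
  have := congrArg (fun P => P • (1 : O)) h
  simpa only [W.mul_smul, mul_one] using this

theorem del_smul_one (j : Fin n) : W.del j • (1 : O) = 0 := by
  have h := W.del_mul j 1
  rw [map_one, mul_one, one_mul, left_eq_add] at h
  exact W.mul_injective (by rw [h, map_zero])

/-- The homomorphism sending the variables to the derivations. -/
def delHom : MvPolynomial (Fin n) ℤ →ₐ[ℤ] D := (exists_algHom_of_commute W.del W.del_comm).choose

/-- The monomials in the derivations. -/
def dpow (α : Fin n →₀ ℕ) : D := W.delHom (MvPolynomial.monomial α 1)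

theorem dpow_zero : W.dpow 0 = 1 := map_one W.delHom

theorem delHom_X (j : Fin n) : W.delHom (MvPolynomial.X j) = W.del j :=
  (exists_algHom_of_commute (R := ℤ) W.del W.del_comm).choose_spec j

theorem dpow_single (j : Fin n) : W.dpow (Finsupp.single j 1) = W.del j := W.delHom_X j

theorem dpow_add (α β : Fin n →₀ ℕ) : W.dpow (α + β) = W.dpow α * W.dpow β := by
  rw [dpow, dpow, dpow, ← map_mul, MvPolynomial.monomial_mul, one_mul]

theorem dpow_single_add (j : Fin n) (α : Fin n →₀ ℕ) :
    W.dpow (Finsupp.single j 1 + α) = W.del j * W.dpow α := by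
  rw [dpow_add, dpow_single]

/-- The operator with coefficients `p`. -/
def opOf : MvPolynomial (Fin n) O →+ D :=
  letI := Module.compHom D W.mul
  ((MvPolynomial.basisMonomials (Fin n) O).constr ℕ W.dpow).toAddMonoidHom

theorem opOf_monomial (α : Fin n →₀ ℕ) (a : O) :
    W.opOf (MvPolynomial.monomial α a) = W.mul a * W.dpow α := by
  let _ := Module.compHom D W.mul
  have h : MvPolynomial.monomial α a = a • MvPolynomial.basisMonomials (Fin n) O α := by
    rw [MvPolynomial.coe_basisMonomials, MvPolynomial.smul_monomial, smul_eq_mul, mul_one]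
  change (MvPolynomial.basisMonomials (Fin n) O).constr ℕ W.dpow _ = _
  rw [h, map_smul, Module.Basis.constr_basis]
  rfl

theorem opOf_eq_sum (p : MvPolynomial (Fin n) O) :
    W.opOf p = ∑ α ∈ p.support, W.mul (p.coeff α) * W.dpow α := by
  conv_lhs => rw [p.as_sum, map_sum]
  exact Finset.sum_congr rfl fun α _ => W.opOf_monomial α _

theorem mul_mul_opOf (a : O) (p : MvPolynomial (Fin n) O) :
    W.mul a * W.opOf p = W.opOf (MvPolynomial.C a * p) := by
  induction p using MvPolynomial.induction_on' with
  | monomial α b => rw [opOf_monomial, MvPolynomial.C_mul_monomial, opOf_monomial, map_mul, mul_assoc]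
  | add p q hp hq => rw [map_add, mul_add, mul_add, map_add, hp, hq]

theorem exists_del_mul_opOf (j : Fin n) (p : MvPolynomial (Fin n) O) :
    ∃ q, W.del j * W.opOf p = W.opOf q := by
  induction p using MvPolynomial.induction_on' with
  | monomial α b =>
    refine ⟨MvPolynomial.monomial (Finsupp.single j 1 + α) b +
      MvPolynomial.monomial α (W.del j • b), ?_⟩
    rw [map_add, opOf_monomial, opOf_monomial, opOf_monomial, ← mul_assoc, W.del_mul, add_mul,
      dpow_single_add, mul_assoc]
  | add p q hp hq =>
    obtain ⟨p', hp⟩ := hp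
    obtain ⟨q', hq⟩ := hq
    exact ⟨p' + q', by rw [map_add, mul_add, map_add, hp, hq]⟩

/-- Operators with coefficients written on the left contain `1` and are stable under left
multiplication by the generators, hence exhaust the ring. -/
theorem opOf_surjective : Function.Surjective W.opOf := by
  have h1 : ∀ P ∈ Subring.closure (Set.range W.mul ∪ Set.range W.del),
      ∀ p, ∃ q, P * W.opOf p = W.opOf q := by
    intro P hP
    induction hP using Subring.closure_induction with
    | mem P hP =>
      rcases hP with ⟨a, rfl⟩ | ⟨j, rfl⟩
      · exact fun p => ⟨_, W.mul_mul_opOf a p⟩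
      · exact W.exists_del_mul_opOf j
    | zero => exact fun p => ⟨0, by rw [zero_mul, map_zero]⟩
    | one => exact fun p => ⟨p, one_mul _⟩
    | add P Q _ _ hP hQ =>
      intro p
      obtain ⟨q, hq⟩ := hP p
      obtain ⟨q', hq'⟩ := hQ p
      exact ⟨q + q', by rw [add_mul, hq, hq', map_add]⟩
    | neg P _ hP =>
      intro p
      obtain ⟨q, hq⟩ := hP p
      exact ⟨-q, by rw [neg_mul, hq, map_neg]⟩
    | mul P Q _ _ hP hQ =>
      intro p
      obtain ⟨q, hq⟩ := hQ p
      obtain ⟨q', hq'⟩ := hP q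
      exact ⟨q', by rw [mul_assoc, hq, hq']⟩
  intro P
  obtain ⟨q, hq⟩ := h1 P (by rw [W.generates]; trivial) 1
  refine ⟨q, ?_⟩
  have : W.opOf 1 = 1 := by
    change W.opOf (MvPolynomial.monomial 0 1) = 1
    rw [opOf_monomial, map_one, dpow_zero, one_mul]
  rw [← hq, this, mul_one]

theorem dpow_smul_one {α : Fin n →₀ ℕ} (hα : α ≠ 0) : W.dpow α • (1 : O) = 0 := by
  obtain ⟨j, hj⟩ := Finsupp.ne_iff.1 hα
  rw [← tsub_add_cancel_of_le (Finsupp.single_le_iff.2 (Nat.one_le_iff_ne_zero.2 hj)), dpow_add,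
    dpow_single, SemigroupAction.mul_smul, del_smul_one, smul_zero]

/-- Derivations kill `1`, so evaluation at `1` extracts the coefficient of order zero. -/
theorem opOf_smul_one (p : MvPolynomial (Fin n) O) : W.opOf p • (1 : O) = p.coeff 0 := by
  induction p using MvPolynomial.induction_on' with
  | monomial α a =>
    rw [opOf_monomial, SemigroupAction.mul_smul, W.mul_smul, MvPolynomial.coeff_monomial]
    split_ifs with h
    · rw [h, dpow_zero, one_smul, mul_one]
    · rw [dpow_smul_one W h, mul_zero]
  | add p q hp hq => rw [map_add, add_smul, hp, hq, MvPolynomial.coeff_add]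

theorem del_mul_z (i j : Fin n) :
    W.del i * W.mul (W.z j) = W.mul (W.z j) * W.del i + if i = j then 1 else 0 := by
  rw [del_mul, del_z]
  split_ifs <;> simp

theorem delHom_mul_z (j : Fin n) (q : MvPolynomial (Fin n) ℤ) :
    W.delHom q * W.mul (W.z j) = W.mul (W.z j) * W.delHom q + W.delHom (MvPolynomial.pderiv j q) := by
  induction q using MvPolynomial.induction_on with
  | C a =>
    rw [MvPolynomial.pderiv_C, map_zero, add_zero, ← MvPolynomial.algebraMap_eq,
      AlgHom.commutes, Algebra.commutes]
  | add p q hp hq =>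
    simp only [map_add, add_mul, mul_add, hp, hq]
    abel
  | mul_X p i hp =>
    rw [Derivation.leibniz, MvPolynomial.pderiv_X, map_add, map_mul, delHom_X, mul_assoc, del_mul_z,
      mul_add, ← mul_assoc, hp, smul_eq_mul, smul_eq_mul, map_mul, mul_comm (MvPolynomial.X i),
      map_mul, delHom_X, add_mul, mul_assoc]
    by_cases h : i = j
    · subst h
      rw [Pi.single_eq_same, map_one, if_pos rfl]
      abel
    · rw [Pi.single_eq_of_ne h, map_zero, if_neg h]
      abel

/-- Commutation with `z_j` differentiates the symbol with respect to `∂_j`. Iterating brings any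
coefficient to order zero, up to an integer factor, where it can be read off by evaluation at `1`.
-/
theorem opOf_mul_z (j : Fin n) (p : MvPolynomial (Fin n) O) :
    W.opOf p * W.mul (W.z j) - W.mul (W.z j) * W.opOf p = W.opOf (MvPolynomial.pderiv j p) := by
  induction p using MvPolynomial.induction_on' with
  | monomial α a =>
    have h : W.delHom (MvPolynomial.monomial (α - Finsupp.single j 1) (1 * (α j : ℤ))) =
        (α j : D) * W.dpow (α - Finsupp.single j 1) := by
      rw [one_mul, ← mul_one (α j : ℤ), ← MvPolynomial.C_mul_monomial, map_mul]
      simp [dpow]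
    rw [opOf_monomial, mul_assoc, dpow, delHom_mul_z, MvPolynomial.pderiv_monomial,
      MvPolynomial.pderiv_monomial, opOf_monomial, h, mul_add, map_mul, map_natCast, ← mul_assoc,
      ← mul_assoc, ← mul_assoc, ← map_mul, ← map_mul, mul_comm a, add_sub_cancel_left, mul_assoc]
  | add p q hp hq => rw [map_add, map_add, map_add, ← hp, ← hq]; noncomm_ring

end WeylData

/-- A multi-indexed filtration of `D` of the kind of the `V`-filtrations along the components of the
divisor `∏ t_i = 0`; `deg j` is the degree of the derivation `∂_j`. -/
structure VData {n : ℕ} {O D : Type*} [CommRing O] [Ring D] [Module D O] (W : WeylData n O D)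
    (r : ℕ) where
  V : (Fin r → ℤ) → AddSubgroup D
  t : Fin r → O
  deg : Fin n → Fin r → ℤ
  deg_eq : ∀ j, deg j = 0 ∨ ∃ i, deg j = -Pi.single i 1
  mul_mem : ∀ {k l P Q}, P ∈ V k → Q ∈ V l → P * Q ∈ V (k + l)
  anti : ∀ {k l}, k ≤ l → V l ≤ V k
  mul_mem_zero : ∀ a, W.mul a ∈ V 0
  t_mem : ∀ i, W.mul (t i) ∈ V (Pi.single i 1)
  del_mem : ∀ j, W.del j ∈ V (deg j)
  z_mem : ∀ j, W.mul (W.z j) ∈ V (-deg j)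
  del_t : ∀ i j, W.del j • t i = 0 ∨ Pi.single i 1 + deg j = 0
  dvd : ∀ {k P}, P ∈ V k → ∀ i, t i ^ (k i).toNat ∣ P • (1 : O)
  prod_dvd : ∀ (e : Fin r → ℕ) (a : O), (∀ i, t i ^ e i ∣ a) → ∏ i, t i ^ e i ∣ a

namespace VData

variable {n : ℕ} {O D : Type*} [CommRing O] [Ring D] [Module D O] {W : WeylData n O D} {r : ℕ}
  (E : VData W r)

/-- The degree of a monomial in the derivations. -/
def degMon (α : Fin n →₀ ℕ) : Fin r → ℤ := ∑ j, α j • E.deg j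

theorem degMon_add (α β : Fin n →₀ ℕ) : E.degMon (α + β) = E.degMon α + E.degMon β := by
  simp [degMon, add_smul, Finset.sum_add_distrib]

theorem degMon_single (j : Fin n) : E.degMon (Finsupp.single j 1) = E.deg j := by
  rw [degMon, Finset.sum_eq_single j] <;> simp +contextual

theorem degMon_zero : E.degMon 0 = 0 := by simp [degMon]

theorem one_mem : (1 : D) ∈ E.V 0 := by simpa using E.mul_mem_zero 1

/-- The coefficients of an operator in `V^k` are divisible by powers of the `t_i`. -/
theorem dvd_coeff (hO : ∀ k : ℕ, IsUnit ((k + 1 : ℕ) : O)) (α : Fin n →₀ ℕ) :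
    ∀ (k : Fin r → ℤ) (p : MvPolynomial (Fin n) O), W.opOf p ∈ E.V k →
      ∀ i, E.t i ^ ((k - E.degMon α) i).toNat ∣ p.coeff α := by
  obtain ⟨d, hd⟩ : ∃ d, α.degree = d := ⟨_, rfl⟩
  induction d generalizing α with
  | zero =>
    intro k p hp i
    rw [Finsupp.degree_eq_zero_iff] at hd
    rw [hd, ← W.opOf_smul_one, degMon_zero, sub_zero]
    exact E.dvd hp i
  | succ d ih =>
    intro k p hp i
    have hne : α ≠ 0 := by
      rintro rfl
      simp at hd
    obtain ⟨j, hj⟩ := Finsupp.ne_iff.1 hne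
    obtain ⟨β, rfl⟩ : ∃ β, α = β + Finsupp.single j 1 := ⟨_, (tsub_add_cancel_of_le
      (Finsupp.single_le_iff.2 (Nat.one_le_iff_ne_zero.2 hj))).symm⟩
    -- As `z_j` has degree `-deg j`, the commutator lies in step `k - deg j`; this matches the drop
    -- of one factor `∂_j` in `degMon`, so the exponent of divisibility is unchanged.
    have h1 : W.opOf (MvPolynomial.pderiv j p) ∈ E.V (k - E.deg j) := by
      rw [← W.opOf_mul_z, sub_eq_add_neg k]
      refine sub_mem (E.mul_mem hp (E.z_mem j)) ?_
      rw [add_comm]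
      exact E.mul_mem (E.z_mem j) hp
    have h2 := ih β (by simpa using hd) _ _ h1 i
    rw [MvPolynomial.coeff_pderiv] at h2
    -- Differentiating the symbol produced the integer factor `β j + 1`, which is a unit.
    have h3 := hO (β j)
    push_cast at h3
    rw [h3.dvd_mul_right] at h2
    rwa [degMon_add, degMon_single, add_comm (E.degMon β), ← sub_sub]

end VData

end Weyl

/-! ### The Rees ring is noetherian -/

noncomputable section Rees

open AddMonoidAlgebra

variable {D : Type*} [Ring D] {r : ℕ}

theorem coeff_single_mul' (k m : Fin r → ℤ) (P : D) (b : AddMonoidAlgebra D (Fin r → ℤ)) :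
    (single k P * b).coeff m = P * b.coeff (m - k) :=
  coeff_single_mul_eq_mul_coeff _ fun m' _ => by rw [add_comm, eq_sub_iff_add_eq]

/-- The Rees ring `⨁ V^k u^k` of a filtration. -/
def reesRing (V : (Fin r → ℤ) → AddSubgroup D) (h1 : (1 : D) ∈ V 0)
    (hmul : ∀ {k l P Q}, P ∈ V k → Q ∈ V l → P * Q ∈ V (k + l)) :
    Subring (AddMonoidAlgebra D (Fin r → ℤ)) where
  carrier := {a | ∀ k, a.coeff k ∈ V k}
  zero_mem' k := zero_mem _
  one_mem' k := by
    rw [one_def, coeff_single, Finsupp.single_apply]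
    split_ifs with h
    · exact h ▸ h1
    · exact zero_mem _
  add_mem' ha hb k := add_mem (ha k) (hb k)
  neg_mem' {a} ha k := neg_mem (ha k)
  mul_mem' {a b} ha hb k := by
    rw [← sum_coeff_single a, Finsupp.sum, Finset.sum_mul, coeff_sum, Finsupp.finsetSum_apply]
    refine sum_mem fun l _ => ?_
    rw [coeff_single_mul']
    have := hmul (ha l) (hb (k - l))
    rwa [add_sub_cancel] at this

theorem single_mem_reesRing {V : (Fin r → ℤ) → AddSubgroup D} {h1 : (1 : D) ∈ V 0}
    {hmul : ∀ {k l P Q}, P ∈ V k → Q ∈ V l → P * Q ∈ V (k + l)} {k : Fin r → ℤ} {P : D}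
    (hP : P ∈ V k) : single k P ∈ reesRing V h1 hmul := by
  intro l
  rw [coeff_single, Finsupp.single_apply]
  split_ifs with h
  · exact h ▸ hP
  · exact zero_mem _

namespace VData

variable {n : ℕ} {O : Type*} [CommRing O] [Module D O] {W : WeylData n O D} (E : VData W r)

/-- The Rees ring of the `V`-filtration. -/
def rees : Subring (AddMonoidAlgebra D (Fin r → ℤ)) := reesRing E.V E.one_mem E.mul_mem

/-- The inclusion of functions in degree zero. -/
def reesFunHom (_ : VData W r) : O →+* AddMonoidAlgebra D (Fin r → ℤ) :=
  (AddMonoidAlgebra.singleZeroRingHom (R := D)).comp W.mul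

/-- Functions, in degree zero. -/
def reesFun : Subring (AddMonoidAlgebra D (Fin r → ℤ)) := E.reesFunHom.range

/-- The degree-lowering elements and the elements `t_i u_i`. -/
def reesCentral : List (AddMonoidAlgebra D (Fin r → ℤ)) :=
  (List.ofFn fun i => single (-Pi.single i 1) (1 : D)) ++
    List.ofFn fun i => single (Pi.single i 1) (W.mul (E.t i))

/-- The derivations, in their degrees. -/
def reesDel : List (AddMonoidAlgebra D (Fin r → ℤ)) := List.ofFn fun j => single (E.deg j) (W.del j)

theorem mem_reesCentral {a : AddMonoidAlgebra D (Fin r → ℤ)} : a ∈ E.reesCentral ↔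
    (∃ i, a = single (-Pi.single i 1) (1 : D)) ∨ ∃ i, a = single (Pi.single i 1) (W.mul (E.t i)) := by
  simp [reesCentral, eq_comm]

theorem mem_reesDel {a : AddMonoidAlgebra D (Fin r → ℤ)} : a ∈ E.reesDel ↔
    ∃ j, a = single (E.deg j) (W.del j) := by
  simp [reesDel, eq_comm]

/-- The subring of the Rees ring generated by functions and elements of multiplicative type. -/
def reesBase : Subring (AddMonoidAlgebra D (Fin r → ℤ)) :=
  Subring.closure ((E.reesFun : Set (AddMonoidAlgebra D (Fin r → ℤ))) ∪ {x | x ∈ E.reesCentral})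

/-- The subring of the Rees ring generated by functions, elements of multiplicative type and
derivations. -/
def reesGen : Subring (AddMonoidAlgebra D (Fin r → ℤ)) :=
  Subring.closure ((E.reesBase : Set (AddMonoidAlgebra D (Fin r → ℤ))) ∪ {x | x ∈ E.reesDel})

theorem reesFun_mem (a : O) : single 0 (W.mul a) ∈ E.reesFun := ⟨a, rfl⟩

/-- All the generators are functions times powers of the central variables, so they commute. -/
theorem reesBase_isNoetherianRing [IsNoetherianRing O] : IsNoetherianRing E.reesBase := by
  have : IsNoetherianRing E.reesFun :=
    isNoetherianRing_range E.reesFunHom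
  have hzero : ∀ (k l : Fin r → ℤ) (a b : O), single k (W.mul a) * single l (W.mul b) -
      single l (W.mul b) * single k (W.mul a) = 0 := by
    intro k l a b
    rw [single_mul_single, single_mul_single, ← map_mul, ← map_mul, mul_comm a, add_comm k, sub_self]
  have hform : ∀ x ∈ E.reesCentral, ∃ k a, x = single k (W.mul a) := by
    intro x hx
    rcases E.mem_reesCentral.1 hx with ⟨i, rfl⟩ | ⟨i, rfl⟩
    · exact ⟨_, 1, by rw [map_one]⟩
    · exact ⟨_, _, rfl⟩
  refine closure_list_isNoetherianRing E.reesCentral E.reesFun ?_ ?_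
  · rintro x hx _ ⟨b, rfl⟩
    obtain ⟨k, a, rfl⟩ := hform x hx
    have := hzero k 0 a b
    exact (show _ = _ from this) ▸ zero_mem _
  · intro x hx y hy
    obtain ⟨k, a, rfl⟩ := hform x hx
    obtain ⟨l, b, rfl⟩ := hform y hy
    exact hzero k l a b ▸ zero_mem _

/-- The commutator of `∂_j u^(deg j)` with `a u^k` is `∂_j(a) u^(k + deg j)`. For functions this
stays in the base because `u^(deg j)` is `1` or some `u_i⁻¹`, which is in the base. For `t_i u_i`
either the derivative vanishes or the degree becomes zero. The derivations commute among themselves.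
-/
theorem reesGen_isNoetherianRing [IsNoetherianRing O] : IsNoetherianRing E.reesGen := by
  have := E.reesBase_isNoetherianRing
  refine closure_list_isNoetherianRing E.reesDel E.reesBase ?_ ?_
  · intro x hx
    obtain ⟨j, rfl⟩ := E.mem_reesDel.1 hx
    have hcomm : ∀ (k : Fin r → ℤ) (a : O), single (E.deg j) (W.del j) * single k (W.mul a) -
        single k (W.mul a) * single (E.deg j) (W.del j) =
        single (k + E.deg j) (W.mul (W.del j • a)) := by
      intro k a
      rw [single_mul_single, single_mul_single, W.del_mul, add_comm (E.deg j), single_add,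
        add_sub_cancel_left]
    have hsub : ∀ {y}, y ∈ E.reesFun → y ∈ E.reesBase := fun h => Subring.subset_closure (Or.inl h)
    refine commutator_mem_closure _ ?_
    rintro _ (⟨a, rfl⟩ | hy)
    · refine (hcomm 0 a).symm ▸ ?_
      rw [zero_add]
      rcases E.deg_eq j with h | ⟨i, h⟩
      · rw [h]
        exact hsub (E.reesFun_mem _)
      · have h1 : single (E.deg j) (1 : D) ∈ E.reesBase :=
          Subring.subset_closure (Or.inr (E.mem_reesCentral.2 (Or.inl ⟨i, by rw [h]⟩)))
        have := MulMemClass.mul_mem h1 (hsub (E.reesFun_mem (W.del j • a)))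
        rwa [single_mul_single, add_zero, one_mul] at this
    · rcases E.mem_reesCentral.1 hy with ⟨i, rfl⟩ | ⟨i, rfl⟩
      · have h := hcomm (-Pi.single i 1) 1
        rw [map_one, W.del_smul_one, map_zero, single_zero] at h
        exact h ▸ zero_mem _
      · refine (hcomm (Pi.single i 1) (E.t i)).symm ▸ ?_
        rcases E.del_t i j with h | h
        · rw [h, map_zero, single_zero]
          exact zero_mem _
        · rw [h]
          exact hsub (E.reesFun_mem _)
  · intro x hx y hy
    obtain ⟨i, rfl⟩ := E.mem_reesDel.1 hx
    obtain ⟨j, rfl⟩ := E.mem_reesDel.1 hy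
    rw [single_mul_single, single_mul_single, W.del_comm, add_comm, sub_self]
    exact zero_mem _

/-- Positive entries of `k` come from powers of `t_i u_i`, negative ones from powers of `u_i⁻¹`,
where `toNat` makes the power of `t_i` trivial. -/
theorem single_mem_reesBase (k : Fin r → ℤ) (s : Finset (Fin r)) :
    single (∑ i ∈ s, Pi.single i (k i)) (W.mul (∏ i ∈ s, E.t i ^ (k i).toNat)) ∈ E.reesBase := by
  induction s using Finset.induction_on with
  | empty => simp [← one_def]
  | insert i s hi ih =>
    rw [Finset.sum_insert hi, Finset.prod_insert hi, map_mul, ← single_mul_single]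
    refine MulMemClass.mul_mem ?_ ih
    rcases le_total 0 (k i) with h | h
    · have h1 : single (Pi.single i 1) (W.mul (E.t i)) ∈ E.reesBase :=
        Subring.subset_closure (Or.inr (E.mem_reesCentral.2 (Or.inr ⟨i, rfl⟩)))
      have h2 := pow_mem h1 (k i).toNat
      rw [single_pow] at h2
      convert h2 using 2
      · rw [← Pi.single_smul, nsmul_eq_mul, mul_one, Int.toNat_of_nonneg h]
      · rw [map_pow]
    · have h1 : single (-Pi.single i 1) (1 : D) ∈ E.reesBase :=
        Subring.subset_closure (Or.inr (E.mem_reesCentral.2 (Or.inl ⟨i, rfl⟩)))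
      have h2 := pow_mem h1 (-k i).toNat
      rw [single_pow, one_pow] at h2
      rw [Int.toNat_of_nonpos h, pow_zero, map_one]
      convert h2 using 2
      rw [smul_neg, ← Pi.single_smul, nsmul_eq_mul, mul_one, Int.toNat_of_nonneg (by omega),
        ← Pi.single_neg, neg_neg]

theorem reesBase_le_reesGen : E.reesBase ≤ E.reesGen :=
  fun _ h => Subring.subset_closure (Or.inl h)

theorem single_dpow_mem_reesGen (α : Fin n →₀ ℕ) :
    single (E.degMon α) (W.dpow α) ∈ E.reesGen := by
  induction α using Finsupp.induction_linear with
  | zero => rw [degMon_zero, W.dpow_zero]; exact OneMemClass.one_mem _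
  | add f g hf hg =>
    rw [degMon_add, W.dpow_add, ← single_mul_single]
    exact MulMemClass.mul_mem hf hg
  | single j k =>
    have h1 : single (E.deg j) (W.del j) ∈ E.reesGen :=
      Subring.subset_closure (Or.inr (E.mem_reesDel.2 ⟨j, rfl⟩))
    induction k with
    | zero => rw [Finsupp.single_zero, degMon_zero, W.dpow_zero]; exact OneMemClass.one_mem _
    | succ k ih =>
      rw [Finsupp.single_add, degMon_add, W.dpow_add, ← single_mul_single, degMon_single,
        W.dpow_single]
      exact MulMemClass.mul_mem ih h1

theorem reesGen_le_rees : E.reesGen ≤ E.rees := by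
  refine Subring.closure_le.2 (Set.union_subset (Subring.closure_le.2 (Set.union_subset ?_ ?_)) ?_)
  · rintro _ ⟨a, rfl⟩
    exact single_mem_reesRing (E.mul_mem_zero a)
  · intro x hx
    rcases E.mem_reesCentral.1 hx with ⟨i, rfl⟩ | ⟨i, rfl⟩
    · refine single_mem_reesRing (E.anti ?_ E.one_mem)
      rw [neg_nonpos]
      exact Pi.single_nonneg.2 zero_le_one
    · exact single_mem_reesRing (E.t_mem i)
  · intro x hx
    obtain ⟨j, rfl⟩ := E.mem_reesDel.1 hx
    exact single_mem_reesRing (E.del_mem j)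

/-- In the normal form of an operator in `V^k`, the coefficient of `∂^α` is divisible by the power
of each `t_i` needed to reach `k` from the degree of `∂^α`, hence by their product. Each term is
therefore a product of generators. -/
theorem rees_le_reesGen (hO : ∀ k : ℕ, IsUnit ((k + 1 : ℕ) : O)) : E.rees ≤ E.reesGen := by
  intro a ha
  rw [← sum_coeff_single a, Finsupp.sum]
  refine sum_mem fun k _ => ?_
  obtain ⟨p, hp⟩ := W.opOf_surjective (a.coeff k)
  have h1 := E.dvd_coeff hO (k := k) (p := p)
  rw [← hp, W.opOf_eq_sum, ← singleAddHom_apply, map_sum]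
  refine sum_mem fun α _ => ?_
  rw [singleAddHom_apply]
  obtain ⟨b, hb⟩ := E.prod_dvd _ _ (h1 α (hp ▸ ha k))
  have h2 := E.reesBase_le_reesGen (E.single_mem_reesBase (k - E.degMon α) Finset.univ)
  have h3 := E.reesBase_le_reesGen (Subring.subset_closure (Or.inl (E.reesFun_mem b)))
  have h4 := MulMemClass.mul_mem (MulMemClass.mul_mem h2 h3) (E.single_dpow_mem_reesGen α)
  rw [single_mul_single, single_mul_single, ← map_mul, ← hb, add_zero] at h4
  have h5 : ∑ i, Pi.single i ((k - E.degMon α) i) = k - E.degMon α :=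
    Finset.univ_sum_single (k - E.degMon α)
  rwa [h5, sub_add_cancel] at h4

/-- The Rees ring of the `V`-filtration is noetherian. -/
theorem rees_isNoetherianRing [IsNoetherianRing O] (hO : ∀ k : ℕ, IsUnit ((k + 1 : ℕ) : O)) :
    IsNoetherianRing E.rees := by
  rw [le_antisymm (E.rees_le_reesGen hO) E.reesGen_le_rees]
  exact E.reesGen_isNoetherianRing

end VData

end Rees

/-! ### Germs of differential operators in a chart -/

noncomputable section StalkOperators

set_option linter.unusedSectionVars false

variable {n : ℕ} {X : Type u} [TopologicalSpace X] [ChartedSpace (Fin n → ℂ) X] {x : X}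

theorem exists_germOf_fin {ι : Type*} [Finite ι] {A : Opens X → Type*} [GermSystem A]
    (a : ι → Germ A x) : ∃ (U : Opens X) (hx : x ∈ U) (b : ι → A U), ∀ i, germOf A hx (b i) = a i := by
  have := Fintype.ofFinite ι
  choose U hU b hb using fun i => exists_germOf (a i)
  have hx : x ∈ Finset.univ.inf U := by
    rw [← SetLike.mem_coe, Opens.coe_finset_inf]
    simpa using hU
  exact ⟨Finset.univ.inf U, hx, fun i => GermSystem.res (Finset.inf_le (Finset.mem_univ i)) (b i),
    fun i => (germOf_res _ hx (b i)).trans (hb i)⟩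

/-- Holomorphic functions as operators of order zero. -/
def DiffOp.multHom (U : Opens X) : Hol n U →+* DiffOp n U where
  toFun := DiffOp.mult
  map_one' := DiffOp.ext_act fun _ _ f => one_mul f
  map_mul' a b := DiffOp.ext_act fun _ hW f => mul_assoc (Hol.res hW a) (Hol.res hW b) f
  map_zero' := DiffOp.ext_act fun _ _ f => zero_mul f
  map_add' a b := DiffOp.ext_act fun _ hW f => add_mul (Hol.res hW a) (Hol.res hW b) f

theorem DiffOp.res_multHom {U V : Opens X} (h : V ≤ U) (f : Hol n U) :
    GermSystem.res h (DiffOp.multHom U f) = DiffOp.multHom V (GermSystem.res h f) := rfl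

/-- Germs of functions as operators of order zero. -/
def mulStalk (x : X) : HolStalk n x →+* DiffStalk n x where
  toFun := Germ.map (fun U f => DiffOp.multHom U f) DiffOp.res_multHom
  map_one' := by
    rw [← germOf_one (Opens.mem_top x), Germ.map_germOf, map_one, germOf_one]
  map_mul' a b := by
    obtain ⟨U, hx, a, b, rfl, rfl⟩ := exists_germOf₂ a b
    rw [← germOf_mul, Germ.map_germOf, Germ.map_germOf, Germ.map_germOf, map_mul, germOf_mul]
  map_zero' := by
    rw [← germOf_zero (Opens.mem_top x), Germ.map_germOf, map_zero, germOf_zero]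
  map_add' a b := by
    obtain ⟨U, hx, a, b, rfl, rfl⟩ := exists_germOf₂ a b
    rw [← germOf_add, Germ.map_germOf, Germ.map_germOf, Germ.map_germOf, map_add, germOf_add]

theorem mulStalk_germ {U : Opens X} (hx : x ∈ U) (f : Hol n U) :
    mulStalk x (Hol.germ hx f) = DiffOp.germ hx (DiffOp.mult f) := rfl

theorem mulStalk_smul (a b : HolStalk n x) : mulStalk x a • b = a * b := by
  obtain ⟨U, hx, a, b, rfl, rfl⟩ := exists_germOf₂ a b
  exact (germ_smul_germ hx (DiffOp.mult a) b).trans (map_mul (Hol.germ hx) a b)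

theorem Hol.exists_germ₂ (a b : HolStalk n x) : ∃ (U : Opens X) (hx : x ∈ U) (f g : Hol n U),
    Hol.germ hx f = a ∧ Hol.germ hx g = b := exists_germOf₂ a b

/-- `Q` acts as a derivation of the ring of germs. -/
def IsDer (Q : DiffStalk n x) : Prop :=
  ∀ a b : HolStalk n x, Q • (a * b) = a * (Q • b) + b * (Q • a)

theorem isDer_germ {U : Opens X} (hx : x ∈ U) {P : HolEnd n U} (hP : P.IsVectorField) :
    IsDer (DiffOp.germ hx (DiffOp.ofVectorField P hP)) := by
  intro a b
  obtain ⟨V, hV, a, b, rfl, rfl⟩ := Hol.exists_germ₂ a b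
  have hx' : x ∈ U ⊓ V := ⟨hx, hV⟩
  rw [← Hol.germ_res (inf_le_right : U ⊓ V ≤ V) hx' a,
    ← Hol.germ_res (inf_le_right : U ⊓ V ≤ V) hx' b,
    ← DiffOp.germ_res (inf_le_left : U ⊓ V ≤ U) hx']
  generalize Hol.res (inf_le_right : U ⊓ V ≤ V) a = a'
  generalize Hol.res (inf_le_right : U ⊓ V ≤ V) b = b'
  rw [← map_mul, germ_smul_germ, germ_smul_germ, germ_smul_germ, ← map_mul, ← map_mul]
  exact (congrArg (Hol.germ hx') (hP ⟨U ⊓ V, inf_le_left⟩ a' b')).trans (map_add (Hol.germ hx') _ _)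

variable [IsManifold 𝓘(ℂ, Fin n → ℂ) ω X] {φ : OpenPartialHomeomorph X (Fin n → ℂ)}
  (hφ : φ ∈ IsManifold.maximalAtlas 𝓘(ℂ, Fin n → ℂ) ω X)

include hφ in
/-- A vector field killing the coordinate functions vanishes. -/
theorem vectorField_eq_zero {W : Opens X} (hW : (W : Set X) ⊆ φ.source) {P : HolEnd n W}
    (hP : P.IsVectorField)
    (h : ∀ (V : Opens X) (hV : V ≤ W) j, P.1 ⟨V, hV⟩ (coord φ hφ (Set.Subset.trans hV hW) j) = 0) :
    P = 0 := by
  have h1 : ∀ V : {V : Opens X // V ≤ W}, P.1 V 1 = 0 := fun V => by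
    have := hP V 1 1
    rwa [mul_one, one_mul, left_eq_add] at this
  have h2 : ∀ (V : {V : Opens X // V ≤ W}) (a : ℂ), P.1 V (algebraMap ℂ _ a) = 0 := fun V a => by
    rw [Algebra.algebraMap_eq_smul_one, map_smul, h1, smul_zero]
  apply Subtype.ext
  funext V
  apply LinearMap.ext
  intro f
  ext y
  have hy : y.1 ∈ φ.source := hW (V.2 y.2)
  -- `P` kills the constant and the coordinates, so by Leibniz only the terms `(z_j - z_j(y))
  -- P(g_j)` remain, and these vanish at `y`.
  obtain ⟨a, g, hg⟩ := exists_hadamard hφ hy (Hol.germ y.2 f)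
  obtain ⟨U, hU, k, hk⟩ := exists_germOf_fin (A := Hol n) g
  have hyW : y.1 ∈ U ⊓ V.1 := ⟨hU, y.2⟩
  have hUV : (↑(U ⊓ V.1) : Set X) ⊆ φ.source := fun z hz => hW (V.2 hz.2)
  have h3 : Hol.germ y.2 f = Hol.germ hyW (algebraMap ℂ _ a +
      ∑ j, (coord φ hφ hUV j - algebraMap ℂ _ (φ y.1 j)) * Hol.res inf_le_left (k j)) := by
    rw [hg, map_add, map_sum, Hol.germ_algebraMap]
    simp only [map_mul, map_sub, Hol.germ_algebraMap, germ_coord, Hol.germ_res]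
    simp only [← hk]
    rfl
  obtain ⟨U', hU'V, hU'U, hyU', e⟩ := Hol.germ_eq_iff.1 h3
  have h4 := P.2 V ⟨U', hU'V.trans V.2⟩ hU'V f
  have h5 := congrArg (fun k : Hol n U' => k ⟨y.1, hyU'⟩) h4
  refine h5.trans ?_
  rw [e, map_add, map_sum]
  simp only [map_mul, map_sub, AlgHom.commutes, map_add, map_sum]
  rw [h2, zero_add]
  have h6 : ∀ j, P.1 ⟨U', hU'V.trans V.2⟩ ((Hol.res hU'U (coord φ hφ hUV j) -
      algebraMap ℂ (Hol n U') (φ y.1 j)) * Hol.res hU'U (Hol.res inf_le_left (k j))) =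
      (Hol.res hU'U (coord φ hφ hUV j) - algebraMap ℂ (Hol n U') (φ y.1 j)) *
        P.1 ⟨U', hU'V.trans V.2⟩ (Hol.res hU'U (Hol.res inf_le_left (k j))) := by
    intro j
    rw [hP, map_sub, h2, sub_zero]
    have h7 : P.1 ⟨U', hU'V.trans V.2⟩ (Hol.res hU'U (coord φ hφ hUV j)) = 0 :=
      h U' (hU'V.trans V.2) j
    rw [h7, mul_zero, add_zero]
  rw [Finset.sum_congr rfl fun j _ => h6 j]
  change ContMDiffMap.coeFnAddMonoidHom (∑ j, _) (⟨y.1, hyU'⟩ : U') = 0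
  rw [map_sum, Finset.sum_apply]
  refine Finset.sum_eq_zero fun j _ => ?_
  change (φ y.1 j - φ y.1 j) * _ = (0 : ℂ)
  rw [sub_self, zero_mul]

theorem partial_coord {W : Opens X} (hW : (W : Set X) ⊆ φ.source) (i j : Fin n) {V : Opens X}
    (hV : V ≤ W) : (partialEnd φ hφ hW i).1 ⟨V, hV⟩ (coord φ hφ (Set.Subset.trans hV hW) j) =
      if i = j then 1 else 0 := by
  ext y
  have h1 : partialFun φ i (coord φ hφ (Set.Subset.trans hV hW) j) y = _ :=
    partialFun_congr φ i (Set.Subset.trans hV hW) le_rfl _ (fun z => z j) y fun _ => rfl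
  refine h1.trans ?_
  have h2 : fderiv ℂ (fun z : Fin n → ℂ => z j) (φ y.1) = ContinuousLinearMap.proj j :=
    (ContinuousLinearMap.proj (R := ℂ) (φ := fun _ : Fin n => ℂ) j).fderiv
  rw [h2, ContinuousLinearMap.proj_apply, Pi.single_apply]
  by_cases h : i = j
  · rw [if_pos h, if_pos h.symm]; rfl
  · rw [if_neg h, if_neg (Ne.symm h)]; rfl

/-- Vector fields are combinations of the coordinate vector fields. -/
theorem vectorField_eq_sum {W : Opens X} (hW : (W : Set X) ⊆ φ.source) {P : HolEnd n W}
    (hP : P.IsVectorField) :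
    P = ∑ j, HolEnd.mult (P.1 ⟨W, le_rfl⟩ (coord φ hφ hW j)) * partialEnd φ hφ hW j := by
  have happ : ∀ (Q : Fin n → HolEnd n W) (V : {V : Opens X // V ≤ W}) (f : Hol n V.1),
      (∑ j, Q j).1 V f = ∑ j, (Q j).1 V f := by
    intro Q V f
    let e : HolEnd n W →+ Hol n V.1 :=
      { toFun := fun P => P.1 V f, map_zero' := rfl, map_add' := fun _ _ => rfl }
    exact map_sum e Q Finset.univ
  rw [← sub_eq_zero]
  have hval : ∀ (V : {V : Opens X // V ≤ W}) (f : Hol n V.1),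
      (P - ∑ j, HolEnd.mult (P.1 ⟨W, le_rfl⟩ (coord φ hφ hW j)) * partialEnd φ hφ hW j).1 V f =
      P.1 V f - ∑ j, Hol.res V.2 (P.1 ⟨W, le_rfl⟩ (coord φ hφ hW j)) *
        (partialEnd φ hφ hW j).1 V f := by
    intro V f
    exact congrArg (P.1 V f - ·) (happ _ V f)
  refine vectorField_eq_zero hφ hW (fun V f g => ?_) fun V hV j => ?_
  · rw [hval, hval, hval, hP, mul_sub, mul_sub, Finset.mul_sum, Finset.mul_sum, sub_add_sub_comm,
      ← Finset.sum_add_distrib]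
    congr 1
    refine Finset.sum_congr rfl fun j _ => ?_
    rw [partialEnd_isVectorField φ hφ hW j V f g]
    ring
  · rw [hval, Finset.sum_eq_single j]
    · rw [partial_coord hφ hW j j hV, if_pos rfl, mul_one, sub_eq_zero]
      exact (P.2 ⟨W, le_rfl⟩ ⟨V, hV⟩ hV (coord φ hφ hW j)).symm
    · intro i _ hij
      rw [partial_coord hφ hW i j hV, if_neg hij, mul_zero]
    · simp

/-- The germ at `x` of the coordinate vector field `∂_j`. -/
def delStalk (hx : x ∈ φ.source) (j : Fin n) : DiffStalk n x :=
  DiffOp.germ (U := ⟨φ.source, φ.open_source⟩) hx (partialOp φ hφ subset_rfl j)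

theorem germ_partialOp {U : Opens X} (hU : (U : Set X) ⊆ φ.source) (hx : x ∈ U) (j : Fin n) :
    DiffOp.germ hx (partialOp φ hφ hU j) = delStalk hφ (hU hx) j :=
  DiffOp.germ_res (V := U) (U := ⟨φ.source, φ.open_source⟩) hU hx (partialOp φ hφ subset_rfl j)

theorem isDer_delStalk (hx : x ∈ φ.source) (j : Fin n) : IsDer (delStalk hφ hx j) :=
  isDer_germ _ _

theorem delStalk_smul_coordGerm (hx : x ∈ φ.source) (i j : Fin n) :
    delStalk hφ hx i • coordGerm hφ hx j = if i = j then 1 else 0 := by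
  rw [delStalk, coordGerm, germ_smul_germ]
  have := congrArg (Hol.germ (U := ⟨φ.source, φ.open_source⟩) hx)
    (partial_coord hφ subset_rfl i j le_rfl)
  refine this.trans ?_
  split_ifs
  · exact map_one _
  · exact map_zero _

/-- The commutator of two derivations is a derivation, and it kills the coordinates because their
derivatives are constant. -/
theorem partialOp_comm {W : Opens X} (hW : (W : Set X) ⊆ φ.source) (i j : Fin n) :
    partialOp φ hφ hW i * partialOp φ hφ hW j = partialOp φ hφ hW j * partialOp φ hφ hW i := by
  apply Subtype.ext
  change partialEnd φ hφ hW i * partialEnd φ hφ hW j = partialEnd φ hφ hW j * partialEnd φ hφ hW i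
  rw [← sub_eq_zero]
  have hval : ∀ (V : {V : Opens X // V ≤ W}) (f : Hol n V.1),
      (partialEnd φ hφ hW i * partialEnd φ hφ hW j -
        partialEnd φ hφ hW j * partialEnd φ hφ hW i).1 V f =
      (partialEnd φ hφ hW i).1 V ((partialEnd φ hφ hW j).1 V f) -
        (partialEnd φ hφ hW j).1 V ((partialEnd φ hφ hW i).1 V f) := fun V f => rfl
  have h := partialEnd_isVectorField φ hφ hW
  have h1 : ∀ k, ∀ V : {V : Opens X // V ≤ W}, (partialEnd φ hφ hW k).1 V 1 = 0 := fun k V => by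
    have := h k V 1 1
    rwa [mul_one, one_mul, left_eq_add] at this
  refine vectorField_eq_zero hφ hW (fun V f g => ?_) fun V hV k => ?_
  · rw [hval, hval, hval, h i V f g, h j V f g, map_add, map_add, h, h, h, h]
    ring
  · rw [hval, partial_coord, partial_coord]
    have h2 : ∀ (p : Prop) [Decidable p] l, (partialEnd φ hφ hW l).1 ⟨V, hV⟩ (if p then 1 else 0) = 0 := by
      intro p _ l
      split_ifs
      · exact h1 l _
      · exact map_zero _
    rw [h2, h2, sub_zero]

/-- Vector fields are expanded in the coordinate fields by `vectorField_eq_sum`. The induction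
carries a `DiffOp` over each endomorphism, since only these have germs here. -/
theorem germ_mem_closure (hx : x ∈ φ.source) {W : Opens X} (hW : (W : Set X) ⊆ φ.source)
    (hxW : x ∈ W) {P : DiffOp n W} (hP : P.1 ∈ generatedOps n W) :
    DiffOp.germ hxW P ∈ Subring.closure (Set.range (mulStalk x) ∪ Set.range (delStalk hφ hx)) := by
  set S := Subring.closure (Set.range (mulStalk x) ∪ Set.range (delStalk hφ hx)) with hS
  have key : ∀ Q ∈ generatedOps n W, ∃ Q' : DiffOp n W, Q'.1 = Q ∧ DiffOp.germ hxW Q' ∈ S := by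
    intro Q hQ
    induction hQ using Algebra.adjoin_induction with
    | mem Q hQ =>
      rcases hQ with ⟨g, rfl⟩ | hQ
      · exact ⟨DiffOp.mult g, rfl, Subring.subset_closure (Or.inl ⟨_, mulStalk_germ hxW g⟩)⟩
      · refine ⟨∑ j, DiffOp.mult (Q.1 ⟨W, le_rfl⟩ (coord φ hφ hW j)) * partialOp φ hφ hW j, ?_, ?_⟩
        · refine Eq.trans ?_ (vectorField_eq_sum hφ hW hQ).symm
          exact map_sum (diffOpAlg n W).val _ _
        · rw [map_sum]
          refine sum_mem fun j _ => ?_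
          rw [map_mul, germ_partialOp, ← mulStalk_germ]
          exact mul_mem (Subring.subset_closure (Or.inl ⟨_, rfl⟩))
            (Subring.subset_closure (Or.inr ⟨_, rfl⟩))
    | algebraMap c =>
      refine ⟨DiffOp.mult (algebraMap ℂ _ c), ?_, Subring.subset_closure (Or.inl ⟨_, mulStalk_germ hxW _⟩)⟩
      apply Subtype.ext
      funext V
      apply LinearMap.ext
      intro f
      change Hol.res V.2 (algebraMap ℂ _ c) * f = c • f
      rw [AlgHom.commutes, Algebra.smul_def]
    | add P Q _ _ hP hQ =>
      obtain ⟨P, rfl, hP⟩ := hP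
      obtain ⟨Q, rfl, hQ⟩ := hQ
      exact ⟨P + Q, rfl, by rw [map_add]; exact add_mem hP hQ⟩
    | mul P Q _ _ hP hQ =>
      obtain ⟨P, rfl, hP⟩ := hP
      obtain ⟨Q, rfl, hQ⟩ := hQ
      exact ⟨P * Q, rfl, by rw [map_mul]; exact mul_mem hP hQ⟩
  obtain ⟨Q, hQ, h⟩ := key _ hP
  rwa [Subtype.ext hQ] at h

theorem closure_eq_top (hx : x ∈ φ.source) :
    Subring.closure (Set.range (mulStalk x) ∪ Set.range (delStalk hφ hx)) = ⊤ := by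
  rw [eq_top_iff]
  intro a _
  obtain ⟨U, hU, P, rfl⟩ := DiffOp.exists_germ a
  obtain ⟨W, hWU, hxW, hP⟩ := P.2 x hU
  have hx' : x ∈ W ⊓ ⟨φ.source, φ.open_source⟩ := ⟨hxW, hx⟩
  rw [← DiffOp.germ_res (inf_le_left.trans hWU : W ⊓ ⟨φ.source, φ.open_source⟩ ≤ U) hx']
  have hWφ : (↑(W ⊓ ⟨φ.source, φ.open_source⟩ : Opens X) : Set X) ⊆ φ.source := fun y hy => hy.2
  exact germ_mem_closure hφ hx hWφ hx'
    (generatedOps_res (V := W) (W := W ⊓ ⟨φ.source, φ.open_source⟩) inf_le_left hP)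

theorem delStalk_mul_mulStalk (hx : x ∈ φ.source) (j : Fin n) (a : HolStalk n x) :
    delStalk hφ hx j * mulStalk x a = mulStalk x a * delStalk hφ hx j +
      mulStalk x (delStalk hφ hx j • a) := by
  obtain ⟨U, hU, f, rfl⟩ := Hol.exists_germ a
  have hx' : x ∈ U ⊓ ⟨φ.source, φ.open_source⟩ := ⟨hU, hx⟩
  have hUφ : (↑(U ⊓ ⟨φ.source, φ.open_source⟩ : Opens X) : Set X) ⊆ φ.source := fun y hy => hy.2
  rw [← Hol.germ_res (inf_le_left : U ⊓ ⟨φ.source, φ.open_source⟩ ≤ U) hx',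
    ← germ_partialOp hφ hUφ hx', germ_smul_germ, mulStalk_germ, mulStalk_germ, ← map_mul, ← map_mul,
    ← map_add]
  congr 1
  refine DiffOp.ext_act fun V hV g => ?_
  have := partialEnd_isVectorField φ hφ hUφ j ⟨V, hV⟩ (Hol.res (hV.trans inf_le_left) f) g
  refine this.trans ?_
  rw [mul_comm g]
  congr 2
  exact ((partialOp φ hφ hUφ j).act_res le_rfl hV (Hol.res inf_le_left f)).symm

/-- The operators at `x`, with their coordinates. -/
def weylData (hx : x ∈ φ.source) : WeylData n (HolStalk n x) (DiffStalk n x) where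
  mul := mulStalk x
  del := delStalk hφ hx
  z := coordGerm hφ hx
  mul_smul := mulStalk_smul
  del_comm i j := by
    have := congrArg (DiffOp.germ (U := ⟨φ.source, φ.open_source⟩) hx)
      (partialOp_comm hφ subset_rfl i j)
    rwa [map_mul, map_mul] at this
  del_mul := delStalk_mul_mulStalk hφ hx
  del_z := delStalk_smul_coordGerm hφ hx
  generates := closure_eq_top hφ hx

end StalkOperators

/-! ### The `V`-filtration on germs of operators -/

noncomputable section StalkV

set_option linter.unusedSectionVars false

variable {n : ℕ} {X : Type u} [TopologicalSpace X] [ChartedSpace (Fin n → ℂ) X] {x : X}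

variable (n) in
/-- The stalk at `x` of the ideal sheaf of `Z`. -/
def stalkIdeal (Z : Set X) (x : X) : Ideal (HolStalk n x) where
  carrier := {a | ∃ (U : Opens X) (hx : x ∈ U), ∃ f ∈ vanishingIdeal n Z U, Hol.germ hx f = a}
  zero_mem' := ⟨⊤, trivial, 0, zero_mem _, map_zero _⟩
  add_mem' := by
    rintro _ _ ⟨U, hU, f, hf, rfl⟩ ⟨V, hV, g, hg, rfl⟩
    have hx : x ∈ U ⊓ V := ⟨hU, hV⟩
    refine ⟨U ⊓ V, hx, Hol.res inf_le_left f + Hol.res inf_le_right g,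
      add_mem (fun y hy => hf ⟨y.1, y.2.1⟩ hy) (fun y hy => hg ⟨y.1, y.2.2⟩ hy), ?_⟩
    rw [map_add, Hol.germ_res, Hol.germ_res]
  smul_mem' := by
    rintro a _ ⟨V, hV, g, hg, rfl⟩
    obtain ⟨U, hU, f, rfl⟩ := Hol.exists_germ a
    have hx : x ∈ U ⊓ V := ⟨hU, hV⟩
    refine ⟨U ⊓ V, hx, Hol.res inf_le_left f * Hol.res inf_le_right g,
      Ideal.mul_mem_left _ _ (fun y hy => hg ⟨y.1, y.2.2⟩ hy), ?_⟩
    rw [map_mul, Hol.germ_res, Hol.germ_res]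
    rfl

theorem germ_mem_stalkIdeal_pow {Z : Set X} {U : Opens X} (hx : x ∈ U) {m : ℕ} {f : Hol n U}
    (hf : f ∈ vanishingIdeal n Z U ^ m) : Hol.germ hx f ∈ stalkIdeal n Z x ^ m := by
  have h1 : (vanishingIdeal n Z U).map (Hol.germ hx) ≤ stalkIdeal n Z x :=
    Ideal.map_le_iff_le_comap.2 fun f hf => ⟨U, hx, f, hf, rfl⟩
  have h2 := Ideal.mem_map_of_mem (Hol.germ hx) hf
  rw [Ideal.map_pow] at h2
  exact Ideal.pow_right_mono h1 m h2

theorem res_mem_vanishingIdeal_pow {Z : Set X} {U V : Opens X} (h : V ≤ U) {m : ℕ} {f : Hol n U}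
    (hf : f ∈ vanishingIdeal n Z U ^ m) : Hol.res h f ∈ vanishingIdeal n Z V ^ m := by
  have h1 : (vanishingIdeal n Z U).map (Hol.res h).toRingHom ≤ vanishingIdeal n Z V :=
    Ideal.map_le_iff_le_comap.2 fun f hf y hy => hf ⟨y.1, h y.2⟩ hy
  have h2 := Ideal.mem_map_of_mem (Hol.res h).toRingHom hf
  rw [Ideal.map_pow] at h2
  exact Ideal.pow_right_mono h1 m h2

/-- An element of the power is a finite sum of products, so all sections involved are defined on a
common neighbourhood. -/
theorem exists_of_mem_stalkIdeal_pow {Z : Set X} {m : ℕ} {a : HolStalk n x}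
    (ha : a ∈ stalkIdeal n Z x ^ m) : ∃ (U : Opens X) (hx : x ∈ U),
      ∃ f ∈ vanishingIdeal n Z U ^ m, Hol.germ hx f = a := by
  induction m generalizing a with
  | zero =>
    obtain ⟨U, hx, f, rfl⟩ := Hol.exists_germ a
    exact ⟨U, hx, f, by simp, rfl⟩
  | succ m ih =>
    rw [pow_succ] at ha
    induction ha using Submodule.mul_induction_on' with
    | mem_mul_mem a ha b hb =>
      obtain ⟨U, hU, f, hf, rfl⟩ := ih ha
      obtain ⟨V, hV, g, hg, rfl⟩ := hb
      have hx : x ∈ U ⊓ V := ⟨hU, hV⟩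
      refine ⟨U ⊓ V, hx, Hol.res inf_le_left f * Hol.res inf_le_right g, ?_, ?_⟩
      · rw [pow_succ]
        exact Ideal.mul_mem_mul (res_mem_vanishingIdeal_pow _ hf) (fun y hy => hg ⟨y.1, y.2.2⟩ hy)
      · rw [map_mul, Hol.germ_res, Hol.germ_res]
    | add a _ b _ ha hb =>
      obtain ⟨U, hU, f, hf, rfl⟩ := ha
      obtain ⟨V, hV, g, hg, rfl⟩ := hb
      have hx : x ∈ U ⊓ V := ⟨hU, hV⟩
      refine ⟨U ⊓ V, hx, Hol.res inf_le_left f + Hol.res inf_le_right g,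
        add_mem (res_mem_vanishingIdeal_pow _ hf) (res_mem_vanishingIdeal_pow _ hg), ?_⟩
      rw [map_add, Hol.germ_res, Hol.germ_res]

theorem vanishesToOrder_iff {Z : Set X} {m : ℕ} {W : Opens X} {f : Hol n W} :
    VanishesToOrder Z m f ↔ ∀ x (hx : x ∈ W), Hol.germ hx f ∈ stalkIdeal n Z x ^ m := by
  constructor
  · intro h x hx
    obtain ⟨W', hW', hxW', hf⟩ := h x hx
    rw [← Hol.germ_res hW' hxW']
    exact germ_mem_stalkIdeal_pow hxW' hf
  · intro h x hx
    obtain ⟨U, hU, g, hg, e⟩ := exists_of_mem_stalkIdeal_pow (h x hx)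
    obtain ⟨V, hVU, hVW, hxV, e⟩ := Hol.germ_eq_iff.1 e
    exact ⟨V, hVW, hxV, e ▸ res_mem_vanishingIdeal_pow hVU hg⟩

theorem stalkIdeal_eq_top {Z : Set X} (hZ : IsClosed Z) (hx : x ∉ Z) : stalkIdeal n Z x = ⊤ :=
  (Ideal.eq_top_iff_one _).2 ⟨⟨Zᶜ, hZ.isOpen_compl⟩, hx, 1, fun y hy => absurd hy y.2, map_one _⟩

variable (n) in
/-- The operators mapping `I^m` to `I^(m + k)`, where `I` is the stalk of the ideal of `Z`. -/
def vStalkAlong (Z : Set X) (k : ℤ) (x : X) : AddSubgroup (DiffStalk n x) where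
  carrier := {Q | ∀ m : ℕ, ∀ g ∈ stalkIdeal n Z x ^ m, Q • g ∈ stalkIdeal n Z x ^ ((m : ℤ) + k).toNat}
  zero_mem' m g _ := by rw [zero_smul]; exact zero_mem _
  add_mem' hP hQ m g hg := by rw [add_smul]; exact add_mem (hP m g hg) (hQ m g hg)
  neg_mem' hP m g hg := by rw [neg_smul]; exact neg_mem (hP m g hg)

theorem mul_mem_vStalkAlong {Z : Set X} {k l : ℤ} {P Q : DiffStalk n x}
    (hP : P ∈ vStalkAlong n Z k x) (hQ : Q ∈ vStalkAlong n Z l x) :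
    P * Q ∈ vStalkAlong n Z (k + l) x := by
  intro m g hg
  rw [mul_smul]
  refine Ideal.pow_le_pow_right ?_ (hP _ _ (hQ m g hg))
  omega

theorem vStalkAlong_anti {Z : Set X} {k l : ℤ} (h : k ≤ l) :
    vStalkAlong n Z l x ≤ vStalkAlong n Z k x :=
  fun _ hP m g hg => Ideal.pow_le_pow_right (by omega) (hP m g hg)

theorem mulStalk_mem_vStalkAlong {Z : Set X} {k : ℕ} {a : HolStalk n x}
    (ha : a ∈ stalkIdeal n Z x ^ k) : mulStalk x a ∈ vStalkAlong n Z k x := by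
  intro m g hg
  rw [mulStalk_smul, mul_comm]
  have := Ideal.mul_mem_mul hg ha
  rw [← pow_add] at this
  exact Ideal.pow_le_pow_right (by omega) this

theorem mem_vStalkAlong_of_notMem {Z : Set X} (hZ : IsClosed Z) (hx : x ∉ Z) (k : ℤ)
    (P : DiffStalk n x) : P ∈ vStalkAlong n Z k x := by
  intro m g _
  rw [stalkIdeal_eq_top hZ hx, Ideal.top_pow]
  trivial

/-- By Leibniz one factor is differentiated at a time. With `J = ⊤` a derivation loses at most one
order; with `J = I` it loses none. -/
theorem IsDer.smul_mem_pow {Q : DiffStalk n x} (hQ : IsDer Q) {I J : Ideal (HolStalk n x)}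
    (h : ∀ a ∈ I, Q • a ∈ J) (m : ℕ) :
    ∀ a ∈ I ^ (m + 1), Q • a ∈ I ^ m * J := by
  induction m with
  | zero => simpa using h
  | succ m ih =>
    intro a ha
    rw [pow_succ] at ha
    induction ha using Submodule.mul_induction_on' with
    | mem_mul_mem a ha b hb =>
      rw [hQ]
      refine add_mem (Ideal.mul_mem_mul ha (h b hb)) ?_
      rw [pow_succ', mul_assoc]
      exact Ideal.mul_mem_mul hb (ih a ha)
    | add a _ b _ ha hb => rw [smul_add]; exact add_mem ha hb

theorem IsDer.mem_vStalkAlong {Q : DiffStalk n x} (hQ : IsDer Q) (Z : Set X) :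
    Q ∈ vStalkAlong n Z (-1) x := by
  intro m g hg
  cases m with
  | zero => simp
  | succ m =>
    have := hQ.smul_mem_pow (J := ⊤) (fun _ _ => trivial) m g hg
    rw [Ideal.mul_top] at this
    exact Ideal.pow_le_pow_right (by omega) this

theorem IsDer.mem_vStalkAlong_zero {Q : DiffStalk n x} (hQ : IsDer Q) {Z : Set X}
    (h : ∀ a ∈ stalkIdeal n Z x, Q • a ∈ stalkIdeal n Z x) : Q ∈ vStalkAlong n Z 0 x := by
  intro m g hg
  cases m with
  | zero => simp
  | succ m =>
    have := hQ.smul_mem_pow h m g hg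
    rw [← pow_succ] at this
    exact Ideal.pow_le_pow_right (by omega) this

theorem mem_vOpAlong_iff {Z : Set X} {k : ℤ} {U : Opens X} {P : DiffOp n U} :
    P ∈ vOpAlong n Z k U ↔ ∀ x (hx : x ∈ U), DiffOp.germ hx P ∈ vStalkAlong n Z k x := by
  constructor
  · intro h x hx m g hg
    obtain ⟨V, hV, f, hf, rfl⟩ := exists_of_mem_stalkIdeal_pow hg
    have hx' : x ∈ U ⊓ V := ⟨hx, hV⟩
    rw [← DiffOp.germ_res (inf_le_left : U ⊓ V ≤ U) hx',
      ← Hol.germ_res (inf_le_right : U ⊓ V ≤ V) hx', germ_smul_germ]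
    exact vanishesToOrder_iff.1 (h (U ⊓ V) inf_le_left m (Hol.res inf_le_right f)
      (vanishesToOrder_iff.2 fun y hy => germ_mem_stalkIdeal_pow hy
        (res_mem_vanishingIdeal_pow _ hf))) x hx'
  · intro h W hW m f hf
    rw [vanishesToOrder_iff] at hf ⊢
    intro x hx
    have := h x (hW hx) m _ (hf x hx)
    rwa [← DiffOp.germ_res hW hx, germ_smul_germ] at this

variable {r : ℕ} (D : SNCDivisor n X r)

theorem SNCDivisor.mem_vOp_iff {k : Fin r → ℤ} {U : Opens X} {P : DiffOp n U} :
    P ∈ D.vOp k U ↔ ∀ x (hx : x ∈ U) i, DiffOp.germ hx P ∈ vStalkAlong n (D.comp i) (k i) x :=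
  ⟨fun h x hx i => mem_vOpAlong_iff.1 (h i) x hx,
    fun h i => mem_vOpAlong_iff.2 fun x hx => h x hx i⟩

theorem SNCDivisor.res_mem_vOp {k : Fin r → ℤ} {U V : Opens X} (h : V ≤ U) {P : DiffOp n U}
    (hP : P ∈ D.vOp k U) : DiffOp.res h P ∈ D.vOp k V := by
  rw [D.mem_vOp_iff] at hP ⊢
  intro x hx i
  rw [DiffOp.germ_res]
  exact hP x (h hx) i

variable (x) in
/-- The stalk of `V^𝐤 𝒟_X`. -/
def SNCDivisor.vStalk (k : Fin r → ℤ) : AddSubgroup (DiffStalk n x) where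
  carrier := {Q | ∃ (U : Opens X) (hx : x ∈ U), ∃ P ∈ D.vOp k U, DiffOp.germ hx P = Q}
  zero_mem' := ⟨⊤, trivial, 0, D.mem_vOp_iff.2 fun y hy i => by rw [map_zero]; exact zero_mem _,
    map_zero _⟩
  add_mem' := by
    rintro _ _ ⟨U, hU, P, hP, rfl⟩ ⟨V, hV, Q, hQ, rfl⟩
    have hW : x ∈ U ⊓ V := ⟨hU, hV⟩
    refine ⟨U ⊓ V, hW, DiffOp.res inf_le_left P + DiffOp.res inf_le_right Q,
      D.mem_vOp_iff.2 fun y hy i => ?_, ?_⟩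
    · rw [map_add, DiffOp.germ_res, DiffOp.germ_res]
      exact add_mem (D.mem_vOp_iff.1 hP y hy.1 i) (D.mem_vOp_iff.1 hQ y hy.2 i)
    · rw [map_add, DiffOp.germ_res, DiffOp.germ_res]
  neg_mem' := by
    rintro _ ⟨U, hU, P, hP, rfl⟩
    exact ⟨U, hU, -P, D.mem_vOp_iff.2 fun y hy i => by
      rw [map_neg]; exact neg_mem (D.mem_vOp_iff.1 hP y hy i), map_neg _ _⟩

/-- `vStalk` consists of germs of sections, so the condition has to be checked at all points of a
neighbourhood, including those lying on fewer components than `x`. -/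
theorem SNCDivisor.germ_mem_vStalk {k : Fin r → ℤ} {U : Opens X} (hx : x ∈ U) {P : DiffOp n U}
    (hP : ∀ y (hy : y ∈ U) i, DiffOp.germ hy P ∈ vStalkAlong n (D.comp i) (k i) y) :
    DiffOp.germ hx P ∈ D.vStalk x k := ⟨U, hx, P, D.mem_vOp_iff.2 hP, rfl⟩

theorem SNCDivisor.mul_mem_vStalk {k l : Fin r → ℤ} {P Q : DiffStalk n x} (hP : P ∈ D.vStalk x k)
    (hQ : Q ∈ D.vStalk x l) : P * Q ∈ D.vStalk x (k + l) := by
  obtain ⟨U, hU, P, hP, rfl⟩ := hP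
  obtain ⟨V, hV, Q, hQ, rfl⟩ := hQ
  have hW : x ∈ U ⊓ V := ⟨hU, hV⟩
  have e : DiffOp.germ hU P * DiffOp.germ hV Q = DiffOp.germ hW
      (DiffOp.res inf_le_left P * DiffOp.res inf_le_right Q) := by
    rw [map_mul, DiffOp.germ_res, DiffOp.germ_res]
  rw [e]
  refine D.germ_mem_vStalk hW fun y hy i => ?_
  rw [map_mul, DiffOp.germ_res, DiffOp.germ_res]
  exact mul_mem_vStalkAlong (D.mem_vOp_iff.1 hP y hy.1 i) (D.mem_vOp_iff.1 hQ y hy.2 i)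

theorem SNCDivisor.vStalk_anti {k l : Fin r → ℤ} (h : k ≤ l) : D.vStalk x l ≤ D.vStalk x k := by
  rintro _ ⟨U, hU, P, hP, rfl⟩
  exact D.germ_mem_vStalk hU fun y hy i => vStalkAlong_anti (h i) (D.mem_vOp_iff.1 hP y hy i)

section Adapted

variable [IsManifold 𝓘(ℂ, Fin n → ℂ) ω X] {D} (c : AdaptedChart n D.comp x)

/-- The germ at `y` of the `j`-th coordinate of an adapted chart. -/
abbrev AdaptedChart.zGerm {y : X} (hy : y ∈ c.chart.source) (j : Fin n) : HolStalk n y :=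
  coordGerm c.mem_maximalAtlas hy j

theorem AdaptedChart.zGerm_mem {y : X} (hy : y ∈ c.chart.source) (i : {i : Fin r // x ∈ D.comp i}) :
    c.zGerm hy (c.idx i) ∈ stalkIdeal n (D.comp i.1) y :=
  ⟨⟨c.chart.source, c.chart.open_source⟩, hy, _, fun z hz => (c.mem_iff i z.1 z.2).1 hz, rfl⟩

/-- A function vanishing on a coordinate hyperplane is divisible by the coordinate, so the ideal is
principal at every point of the component in the chart. -/
theorem AdaptedChart.stalkIdeal_eq {y : X} (hy : y ∈ c.chart.source)
    (i : {i : Fin r // x ∈ D.comp i}) (hi : y ∈ D.comp i.1) :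
    stalkIdeal n (D.comp i.1) y = Ideal.span {c.zGerm hy (c.idx i)} := by
  refine le_antisymm ?_ ((Ideal.span_singleton_le_iff_mem _).2 (c.zGerm_mem hy i))
  rintro _ ⟨U, hU, f, hf, rfl⟩
  refine Ideal.mem_span_singleton.2 (coordGerm_dvd_of_vanish c.mem_maximalAtlas hy
    ((c.mem_iff i y hy).1 hi) hU f fun z hz h => hf z ((c.mem_iff i z.1 hz).2 h))

/-- A neighbourhood of `x` in the domain of the chart which does not meet the components not passing
through `x`. -/
def AdaptedChart.nhd : Opens X :=
  ⟨c.chart.source, c.chart.open_source⟩ ⊓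
    ⟨⋂ i : {i : Fin r // x ∉ D.comp i}, (D.comp i.1)ᶜ,
      isOpen_iInter_of_finite fun i => (D.isClosed_comp i.1).isOpen_compl⟩

theorem AdaptedChart.mem_nhd : x ∈ c.nhd := ⟨c.mem_source, Set.mem_iInter.2 fun i => i.2⟩

theorem AdaptedChart.nhd_subset : (c.nhd : Set X) ⊆ c.chart.source := fun _ h => h.1

theorem AdaptedChart.mem_comp_of_mem_nhd {y : X} (hy : y ∈ c.nhd) {i : Fin r} (hi : y ∈ D.comp i) :
    x ∈ D.comp i := by
  by_contra h
  exact Set.mem_iInter.1 hy.2 ⟨i, h⟩ hi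

open Classical in
/-- The germs defining the components. -/
def AdaptedChart.tGerm (i : Fin r) : HolStalk n x :=
  -- A component missing `x` imposes no condition near `x`, so the unit `1` serves as its equation.
  if h : x ∈ D.comp i then c.zGerm c.mem_source (c.idx ⟨i, h⟩) else 1

open Classical in
/-- The degree of the derivations. -/
def AdaptedChart.delDeg (j : Fin n) (i : Fin r) : ℤ :=
  if ∃ h : x ∈ D.comp i, c.idx ⟨i, h⟩ = j then -1 else 0

theorem AdaptedChart.delDeg_idx (i : {i : Fin r // x ∈ D.comp i}) :
    c.delDeg (c.idx i) = -Pi.single i.1 1 := by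
  ext i'
  simp only [delDeg, Pi.neg_apply, Pi.single_apply]
  have : (∃ h : x ∈ D.comp i', c.idx ⟨i', h⟩ = c.idx i) ↔ i' = i.1 :=
    ⟨fun ⟨h, e⟩ => congrArg Subtype.val (c.idx.injective e), fun e => ⟨e ▸ i.2, by subst e; rfl⟩⟩
  simp only [this]
  split_ifs <;> rfl

theorem AdaptedChart.delDeg_eq_zero {j : Fin n} (h : ∀ i, c.idx i ≠ j) : c.delDeg j = 0 := by
  ext i
  rw [delDeg, if_neg fun ⟨hi, e⟩ => h _ e]
  rfl

theorem mulStalk_mem_vStalk_zero (D : SNCDivisor n X r) (a : HolStalk n x) :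
    mulStalk x a ∈ D.vStalk x 0 := by
  obtain ⟨U, hU, f, rfl⟩ := Hol.exists_germ a
  exact D.germ_mem_vStalk hU fun y hy i =>
    mulStalk_mem_vStalkAlong (k := 0) (a := Hol.germ hy f) (by simp)

theorem AdaptedChart.mulStalk_zGerm_mem (i : {i : Fin r // x ∈ D.comp i}) :
    mulStalk x (c.zGerm c.mem_source (c.idx i)) ∈ D.vStalk x (Pi.single i.1 1) := by
  refine D.germ_mem_vStalk (U := ⟨c.chart.source, c.chart.open_source⟩) c.mem_source
    (P := DiffOp.mult (coord c.chart c.mem_maximalAtlas subset_rfl (c.idx i))) fun y hy i' => ?_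
  change mulStalk y (c.zGerm hy (c.idx i)) ∈ _
  by_cases h : i' = i.1
  · subst h
    rw [Pi.single_eq_same]
    exact mulStalk_mem_vStalkAlong (k := 1) (by rw [pow_one]; exact c.zGerm_mem hy i)
  · rw [Pi.single_eq_of_ne h]
    exact mulStalk_mem_vStalkAlong (k := 0) (by simp)

/-- Differentiation along the coordinate defining one component costs one order there. The other
components through `x` are cut out by coordinates which it kills, and those missing `x` do not meet
`nhd`. -/
theorem AdaptedChart.delStalk_mem (j : Fin n) :
    delStalk c.mem_maximalAtlas c.mem_source j ∈ D.vStalk x (c.delDeg j) := by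
  rw [← germ_partialOp c.mem_maximalAtlas c.nhd_subset c.mem_nhd]
  refine D.germ_mem_vStalk c.mem_nhd fun y hy i => ?_
  rw [germ_partialOp]
  have hd := isDer_delStalk c.mem_maximalAtlas hy.1 j
  by_cases hi : y ∈ D.comp i
  swap
  · exact mem_vStalkAlong_of_notMem (D.isClosed_comp i) hi _ _
  have hxi := c.mem_comp_of_mem_nhd hy hi
  by_cases hj : c.idx ⟨i, hxi⟩ = j
  · rw [delDeg, if_pos ⟨hxi, hj⟩]
    exact hd.mem_vStalkAlong _
  · rw [delDeg, if_neg fun ⟨_, e⟩ => hj e]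
    refine hd.mem_vStalkAlong_zero fun a ha => ?_
    rw [c.stalkIdeal_eq hy.1 ⟨i, hxi⟩ hi, Ideal.mem_span_singleton] at ha ⊢
    obtain ⟨b, rfl⟩ := ha
    rw [hd, delStalk_smul_coordGerm, if_neg (by tauto), mul_zero, add_zero]
    exact dvd_mul_right _ _

/-- The `V`-filtration on the ring of germs of differential operators. -/
def AdaptedChart.vData : VData (weylData c.mem_maximalAtlas c.mem_source) r where
  V := D.vStalk x
  t := c.tGerm
  deg := c.delDeg
  deg_eq j := by
    by_cases h : ∃ i, c.idx i = j
    · obtain ⟨i, rfl⟩ := h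
      exact Or.inr ⟨i.1, c.delDeg_idx i⟩
    · exact Or.inl (c.delDeg_eq_zero (not_exists.1 h))
  mul_mem := D.mul_mem_vStalk
  anti := D.vStalk_anti
  mul_mem_zero := mulStalk_mem_vStalk_zero D
  t_mem i := by
    rw [tGerm]
    split_ifs with h
    · exact c.mulStalk_zGerm_mem ⟨i, h⟩
    -- Off `D_i` every operator has arbitrary order along `D_i`, so there `1` already has index `1`
    -- in that direction.
    · rw [map_one, ← map_one (DiffOp.germ (n := n) (x := x)
        (U := ⟨(D.comp i)ᶜ, (D.isClosed_comp i).isOpen_compl⟩) h)]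
      refine D.germ_mem_vStalk (U := ⟨(D.comp i)ᶜ, (D.isClosed_comp i).isOpen_compl⟩) h
        (P := 1) fun y hy i' => ?_
      by_cases e : i' = i
      · subst e
        exact mem_vStalkAlong_of_notMem (D.isClosed_comp i') hy _ _
      · rw [Pi.single_eq_of_ne e, map_one, ← map_one (mulStalk y)]
        exact mulStalk_mem_vStalkAlong (k := 0) (by simp)
  del_mem := c.delStalk_mem
  z_mem j := by
    change mulStalk x (c.zGerm c.mem_source j) ∈ _
    by_cases h : ∃ i, c.idx i = j
    · obtain ⟨i, rfl⟩ := h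
      rw [c.delDeg_idx, neg_neg]
      exact c.mulStalk_zGerm_mem i
    · rw [c.delDeg_eq_zero (not_exists.1 h), neg_zero]
      exact mulStalk_mem_vStalk_zero D _
  del_t i j := by
    rw [tGerm]
    split_ifs with h
    · by_cases e : c.idx ⟨i, h⟩ = j
      · right
        rw [← e, c.delDeg_idx, add_neg_cancel]
      · left
        refine (delStalk_smul_coordGerm c.mem_maximalAtlas c.mem_source _ _).trans ?_
        rw [if_neg (by tauto)]
    · exact Or.inl (WeylData.del_smul_one _ j)
  dvd := by
    rintro k _ ⟨U, hU, P, hP, rfl⟩ i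
    rw [tGerm]
    split_ifs with h
    · have := D.mem_vOp_iff.1 hP x hU i 0 1 (by simp)
      rwa [c.stalkIdeal_eq c.mem_source ⟨i, h⟩ h, Ideal.span_singleton_pow,
        Ideal.mem_span_singleton, Nat.cast_zero, zero_add] at this
    · rw [one_pow]
      exact one_dvd _
  prod_dvd e a h := by
    classical
    have e1 : ∏ i, c.tGerm i ^ e i =
        ∏ i : {i : Fin r // x ∈ D.comp i}, c.zGerm c.mem_source (c.idx i) ^ e i.1 := by
      have e2 : ∀ i : {i : Fin r // x ∈ D.comp i},
          c.zGerm c.mem_source (c.idx i) ^ e i.1 = c.tGerm i.1 ^ e i.1 := fun i => by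
        rw [tGerm, dif_pos i.2]
      rw [Finset.prod_congr rfl fun i _ => e2 i,
        ← Finset.prod_subtype (Finset.univ.filter fun i => x ∈ D.comp i) (by simp)
          fun i => c.tGerm i ^ e i]
      refine (Finset.prod_filter_of_ne fun i _ hi => ?_).symm
      by_contra h'
      rw [tGerm, dif_neg h', one_pow] at hi
      exact hi rfl
    rw [e1]
    refine prod_coordGerm_pow_dvd c.mem_maximalAtlas c.mem_source c.idx
      (fun i => (c.mem_iff i x c.mem_source).1 i.2) (fun i => e i.1) fun i => ?_
    have := h i.1
    rwa [tGerm, dif_pos i.2] at this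

/-- The Rees ring of the `V`-filtration on `𝒟_{X,x}` is noetherian. -/
theorem AdaptedChart.rees_isNoetherianRing : IsNoetherianRing c.vData.rees := by
  have := HolStalk.isNoetherianRing c.mem_maximalAtlas c.mem_source
  refine c.vData.rees_isNoetherianRing fun k => ?_
  have h : ((k + 1 : ℕ) : HolStalk n x) = algebraMap ℂ _ ((k + 1 : ℕ) : ℂ) := (map_natCast _ _).symm
  rw [h]
  exact (IsUnit.mk0 _ (Nat.cast_ne_zero.2 k.succ_ne_zero)).map _

end Adapted

end StalkV

/-! ### Good filtrations and the Artin-Rees argument -/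

noncomputable section GoodFamilies

/-- `ℝ^r` is directed downwards; so, for example, finitely many elements of an exhaustive filtration
lie in one step. -/
theorem exists_common_of_antitone {ι : Type*} [Finite ι] {r : ℕ} (P : ι → (Fin r → ℝ) → Prop)
    (hP : ∀ i p q, p ≤ q → P i q → P i p) (h : ∀ i, ∃ q, P i q) : ∃ q, ∀ i, P i q := by
  choose f hf using h
  obtain ⟨q, hq⟩ := Finite.exists_ge f
  exact ⟨q, fun i => hP i _ _ (hq i) (hf i)⟩

/-- A good filtration of the `D`-module `M` with respect to the filtration `V` of `D`. -/
structure GoodFamily {D : Type*} [Ring D] {r : ℕ} (V : (Fin r → ℤ) → AddSubgroup D)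
    (M : Type*) [AddCommGroup M] [Module D M] where
  F : (Fin r → ℝ) → AddSubgroup M
  anti : ∀ {p q}, p ≤ q → F q ≤ F p
  exhaustive : ∀ m, ∃ p, m ∈ F p
  smul_mem : ∀ {k p P m}, P ∈ V k → m ∈ F p → P • m ∈ F ((fun i => (k i : ℝ)) + p)
  -- One finite family and one shift `C` serve all integral indices; a real index is rounded down to
  -- an integral one.
  generated : ∃ (l : ℕ) (g : Fin l → M) (C : Fin r → ℤ), ∀ (k : Fin r → ℤ),
    ∀ m ∈ F (fun i => (k i : ℝ)), ∃ c : Fin l → D, (∀ a, c a ∈ V (k - C)) ∧ ∑ a, c a • g a = m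

namespace GoodFamily

open AddMonoidAlgebra

variable {D : Type*} [Ring D] {r : ℕ} {V : (Fin r → ℤ) → AddSubgroup D}
  {M N : Type*} [AddCommGroup M] [Module D M] [AddCommGroup N] [Module D N]

/-- `B` absorbs, uniformly in `p`, the rounding error (less than one), the shift `C` and the
position `q` of the generators. -/
theorem exists_shift (C : Fin r → ℤ) (q : Fin r → ℝ) : ∃ B : ℝ, ∀ p : Fin r → ℝ,
    (p - fun _ => B) ≤ (fun i => (((⌊p i⌋ - C i : ℤ)) : ℝ)) + q := by
  obtain ⟨B, hB⟩ := Finite.exists_le fun i => 1 + C i - q i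
  refine ⟨B, fun p i => ?_⟩
  have h1 := Int.lt_floor_add_one (p i)
  have h2 := hB i
  simp only [Pi.sub_apply, Pi.add_apply, Int.cast_sub]
  linarith

theorem floor_le (p : Fin r → ℝ) : (fun i => ((⌊p i⌋ : ℤ) : ℝ)) ≤ p := fun i => Int.floor_le (p i)

/-- A linear map is compatible with good filtrations, up to a shift. -/
theorem exists_map_mem (F : GoodFamily V M) (G : GoodFamily V N) (f : M →ₗ[D] N) :
    ∃ B : ℝ, ∀ p, ∀ m ∈ F.F p, f m ∈ G.F (p - fun _ => B) := by
  obtain ⟨l, g, C, hg⟩ := F.generated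
  obtain ⟨q, hq⟩ := exists_common_of_antitone (fun a q => f (g a) ∈ G.F q)
    (fun a p q h h' => G.anti h h') fun a => G.exhaustive (f (g a))
  obtain ⟨B, hB⟩ := exists_shift C q
  refine ⟨B, fun p m hm => G.anti (hB p) ?_⟩
  obtain ⟨c, hc, rfl⟩ := hg (fun i => ⌊p i⌋) m (F.anti (floor_le p) hm)
  rw [map_sum]
  refine sum_mem fun a _ => ?_
  rw [map_smul]
  exact G.smul_mem (hc a) (hq a)

theorem coeff_mul' (a b : AddMonoidAlgebra D (Fin r → ℤ)) (k : Fin r → ℤ) :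
    (a * b).coeff k = ∑ m ∈ a.coeff.support, a.coeff m * b.coeff (k - m) := by
  conv_lhs => rw [← sum_coeff_single a, Finsupp.sum, Finset.sum_mul, coeff_sum,
    Finsupp.finsetSum_apply]
  exact Finset.sum_congr rfl fun m _ => coeff_single_mul' _ _ _ _

/-- The component of degree `k` of the linear combination of the `g j` with coefficients `P j`. -/
def component {l : ℕ} (g : Fin l → N) (P : Fin l → AddMonoidAlgebra D (Fin r → ℤ))
    (k : Fin r → ℤ) : N := ∑ j, (P j).coeff k • g j

/-- A tuple `P` stands for the formal sum of its components `∑_j (P_j)_k g_j` placed in degree `k`;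
with this reading the group algebra acts in the graded way, although `N` itself is not graded. -/
theorem component_smul {l : ℕ} (g : Fin l → N) (a : AddMonoidAlgebra D (Fin r → ℤ))
    (P : Fin l → AddMonoidAlgebra D (Fin r → ℤ)) (k : Fin r → ℤ) :
    component g (fun j => a * P j) k =
      ∑ m ∈ a.coeff.support, a.coeff m • component g P (k - m) := by
  simp only [component, coeff_mul', Finset.smul_sum, Finset.sum_smul, mul_smul]
  exact Finset.sum_comm

theorem component_add {l : ℕ} (g : Fin l → N)
    (P Q : Fin l → AddMonoidAlgebra D (Fin r → ℤ)) (k : Fin r → ℤ) :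
    component g (fun j => P j + Q j) k = component g P k + component g Q k := by
  simp only [component, coeff_add, Finsupp.add_apply, add_smul, Finset.sum_add_distrib]

theorem component_sum {l : ℕ} (g : Fin l → N) {s : ℕ}
    (P : Fin s → Fin l → AddMonoidAlgebra D (Fin r → ℤ)) (k : Fin r → ℤ) :
    component g (fun j => ∑ i, P i j) k = ∑ i, component g (P i) k := by
  simp only [component, coeff_sum, Finsupp.finsetSum_apply, Finset.sum_smul]
  exact Finset.sum_comm

/-- The combinations of the `g j`, with coefficients in the Rees ring, all of whose components lie
in the submodule `S`. -/
def reesComb (R : Subring (AddMonoidAlgebra D (Fin r → ℤ))) {l : ℕ} (g : Fin l → N)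
    (S : Submodule D N) : Submodule R (Fin l → R) where
  carrier := {P | ∀ k, component g (fun j => (P j).1) k ∈ S}
  zero_mem' k := by
    have : component g (fun j => ((0 : Fin l → R) j).1) k = 0 := by simp [component]
    rw [this]
    exact zero_mem _
  add_mem' {P Q} hP hQ k := by
    have := component_add g (fun j => (P j).1) (fun j => (Q j).1) k
    change component g (fun j => (P j).1 + (Q j).1) k ∈ S
    rw [this]
    exact add_mem (hP k) (hQ k)
  smul_mem' a P hP k := by
    change component g (fun j => a.1 * (P j).1) k ∈ S
    rw [component_smul]
    exact sum_mem fun m _ => S.smul_mem _ (hP _)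

/-- The filtration induced on the image of a linear map agrees with the image of the filtration, up
to a shift. -/
theorem exists_mem_map (h1 : (1 : D) ∈ V 0)
    (hmul : ∀ {k l P Q}, P ∈ V k → Q ∈ V l → P * Q ∈ V (k + l))
    [IsNoetherianRing (reesRing V h1 hmul)] (F : GoodFamily V M) (G : GoodFamily V N)
    (f : M →ₗ[D] N) :
    ∃ B : ℝ, ∀ p, ∀ m, f m ∈ G.F p → ∃ m' ∈ F.F (p - fun _ => B), f m' = f m := by
  classical
  obtain ⟨l, g, C, hg⟩ := G.generated
  -- Artin-Rees: the tuples with all components in the image of `f` form a submodule of a free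
  -- module of finite rank over the noetherian Rees ring, so finitely many `w i` generate them.
  obtain ⟨s, w, hw⟩ := Submodule.fg_iff_exists_fin_generating_family.1
    (IsNoetherian.noetherian (reesComb (reesRing V h1 hmul) g (LinearMap.range f)))
  have hwmem : ∀ i k, ∃ y, f y = component g (fun j => (w i j).1) k := fun i => by
    have : w i ∈ reesComb (reesRing V h1 hmul) g (LinearMap.range f) :=
      hw ▸ Submodule.subset_span ⟨i, rfl⟩
    exact this
  -- Only finitely many degrees occur in the generators, so their components can be lifted with one
  -- common `q`; in the other degrees zero is a lift.
  set S : Finset (Fin r → ℤ) := Finset.univ.biUnion fun i => Finset.univ.biUnion fun j =>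
    (w i j).1.coeff.support with hS
  have hS0 : ∀ i k, k ∉ S → component g (fun j => (w i j).1) k = 0 := by
    intro i k hk
    refine Finset.sum_eq_zero fun j _ => ?_
    have : (w i j).1.coeff k = 0 := by
      by_contra h
      exact hk (Finset.mem_biUnion.2 ⟨i, Finset.mem_univ _, Finset.mem_biUnion.2
        ⟨j, Finset.mem_univ _, Finsupp.mem_support_iff.2 h⟩⟩)
    rw [this, zero_smul]
  obtain ⟨q, hq⟩ := exists_common_of_antitone
    (fun (a : Fin s × S) q => ∃ y, y ∈ F.F ((fun i => ((a.2.1 i : ℤ) : ℝ)) + q) ∧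
      f y = component g (fun j => (w a.1 j).1) a.2.1)
    (fun a p q h ⟨y, hy, e⟩ => ⟨y, F.anti (add_le_add_right h _) hy, e⟩)
    (fun a => by
      obtain ⟨y, hy⟩ := hwmem a.1 a.2.1
      obtain ⟨p, hp⟩ := F.exhaustive y
      exact ⟨p - fun i => ((a.2.1 i : ℤ) : ℝ), y, by rwa [add_sub_cancel], hy⟩)
  have hq' : ∀ i (k : Fin r → ℤ), ∃ y, y ∈ F.F ((fun i => ((k i : ℤ) : ℝ)) + q) ∧
      f y = component g (fun j => (w i j).1) k := by
    intro i k
    by_cases hk : k ∈ S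
    · exact hq (i, ⟨k, hk⟩)
    · exact ⟨0, zero_mem _, by rw [map_zero, hS0 i k hk]⟩
  choose y hy hfy using hq'
  obtain ⟨B, hB⟩ := exists_shift C q
  refine ⟨B, fun p m hm => ?_⟩
  obtain ⟨c, hc, hcm⟩ := hg (fun i => ⌊p i⌋) (f m) (G.anti (floor_le p) hm)
  set k : Fin r → ℤ := (fun i => ⌊p i⌋) - C with hk
  -- The coefficients of `f m` are placed in the single degree `k`, so the only component that can
  -- be nonzero is `f m`, which lies in the image.
  let Q : Fin l → reesRing V h1 hmul := fun j => ⟨single k (c j), single_mem_reesRing (hc j)⟩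
  have hQk : component g (fun j => (Q j).1) k = f m := by
    simp only [component, Q, coeff_single, Finsupp.single_eq_same, hcm]
  have hQ : Q ∈ reesComb (reesRing V h1 hmul) g (LinearMap.range f) := by
    intro k'
    by_cases h : k' = k
    · rw [h, hQk]
      exact ⟨m, rfl⟩
    · have : component g (fun j => (Q j).1) k' = 0 :=
        Finset.sum_eq_zero fun j _ => by
          simp only [Q, coeff_single]
          rw [Finsupp.single_eq_of_ne (by tauto), zero_smul]
      rw [this]
      exact zero_mem _
  rw [← hw, Submodule.mem_span_range_iff_exists_fun] at hQ
  obtain ⟨b, hb⟩ := hQ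
  -- The degree `k` part of `Q = ∑ b i • w i`. The coefficient of degree `μ` lies in `V μ` and its
  -- partner lifts to step `(k - μ) + q`, so every lifted term lies in step `k + q`.
  have e : f m = ∑ i, ∑ μ ∈ (b i).1.coeff.support, (b i).1.coeff μ • f (y i (k - μ)) := by
    rw [← hQk]
    have : (fun j => (Q j).1) = fun j => ∑ i, (b i).1 * (w i j).1 := by
      funext j
      rw [← hb]
      simp
    rw [this, component_sum]
    refine Finset.sum_congr rfl fun i _ => ?_
    rw [component_smul]
    exact Finset.sum_congr rfl fun μ _ => by rw [hfy]
  refine ⟨∑ i, ∑ μ ∈ (b i).1.coeff.support, (b i).1.coeff μ • y i (k - μ), ?_, ?_⟩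
  · refine sum_mem fun i _ => sum_mem fun μ _ => F.anti (hB p) ?_
    have := F.smul_mem ((b i).2 μ) (hy i (k - μ))
    convert this using 2
    funext a
    simp [hk]
    ring
  · rw [e]
    simp only [map_sum, map_smul]

end GoodFamily

end GoodFamilies

/-! ### Stalks of good filtrations -/

noncomputable section StalkFamily

variable {n : ℕ} {X : Type u} [TopologicalSpace X] [ChartedSpace (Fin n → ℂ) X] {r : ℕ}
  {M : DModule.{u, v} n X} {D : SNCDivisor n X r}

theorem Subsheaf.exists_generators {S : Subsheaf M} (hS : S.IsFiniteTypeOver (D.vOp 0)) (x : X) :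
    ∃ (l : ℕ) (g : Fin l → SecStalk x M), ∀ m ∈ S.stalk x, ∃ c : Fin l → DiffStalk n x,
      (∀ a, c a ∈ D.vStalk x 0) ∧ ∑ a, c a • g a = m := by
  obtain ⟨U, hx, l, g, -, h⟩ := hS x
  refine ⟨l, fun a => Sec.germ hx (g a), ?_⟩
  rintro _ ⟨V, hV, s, hs, rfl⟩
  have hVU : x ∈ V ⊓ U := ⟨hV, hx⟩
  obtain ⟨W, hW, hxW, c, hc, e⟩ := h (V ⊓ U) inf_le_right (Sec.res inf_le_left s)
    (S.res_mem inf_le_left hs) x hVU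
  refine ⟨fun a => DiffOp.germ hxW (c a), fun a => ⟨W, hxW, c a, hc a, rfl⟩, ?_⟩
  have e' := congrArg (Sec.germ hxW) e
  rw [Sec.germ_res, Sec.germ_res, map_sum] at e'
  rw [e']
  refine Finset.sum_congr rfl fun a _ => ?_
  rw [← germ_smul_sec_germ, Sec.germ_res]

/-- The stalk at `x` of a good filtration. -/
def Filtration.IsGood.family {F : Filtration r M} (hF : F.IsGood D) (x : X) :
    GoodFamily (D.vStalk x) (SecStalk x M) where
  F p := (F.step p).stalk x
  anti := by
    rintro p q h _ ⟨U, hU, s, hs, rfl⟩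
    exact Subsheaf.germ_mem_stalk hU (F.antitone h U hs)
  exhaustive m := by
    obtain ⟨U, hU, s, rfl⟩ := Sec.exists_germ m
    obtain ⟨W, h, hxW, α, hα⟩ := hF.isExhaustive U s x hU
    exact ⟨α, W, hxW, _, hα, Sec.germ_res h hxW s⟩
  smul_mem := by
    rintro k p _ _ ⟨U, hU, P, hP, rfl⟩ ⟨V, hV, s, hs, rfl⟩
    have hW : x ∈ U ⊓ V := ⟨hU, hV⟩
    rw [← DiffOp.germ_res (inf_le_left : U ⊓ V ≤ U) hW, ← Sec.germ_res (inf_le_right : U ⊓ V ≤ V) hW,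
      germ_smul_sec_germ]
    exact Subsheaf.germ_mem_stalk hW (hF.smul_mem k p _ _ (D.res_mem_vOp _ hP) _
      ((F.step p).res_mem _ hs))
  generated := by
    obtain ⟨U, hxU, A, B, hAB⟩ := hF.isGenerated x
    obtain ⟨l, g, hg⟩ := Subsheaf.exists_generators (hF.isCoherent fun _ => A).2.1 x
    -- The generators of the step `(A, …, A)` serve for every `γ` in `[A, B]^r`. If `k ≤ k' + γ`
    -- with `γ ≤ B`, then `k' ≥ k - ⌈B⌉`.
    refine ⟨l, g, fun _ => ⌈B⌉, ?_⟩
    rintro k _ ⟨V, hV, s, hs, rfl⟩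
    have hVU : x ∈ V ⊓ U := ⟨hV, hxU⟩
    obtain ⟨W, hW, hxW, h⟩ := (hAB _ (V ⊓ U) inf_le_right (Sec.res inf_le_left s)).1
      ((F.step _).res_mem inf_le_left hs) x hVU
    have e : Sec.germ hV s = Sec.germ hxW (Sec.res hW (Sec.res inf_le_left s)) := by
      rw [Sec.germ_res, Sec.germ_res]
    rw [e]
    generalize Sec.res hW (Sec.res inf_le_left s) = s' at h
    clear e
    induction h using AddSubgroup.closure_induction with
    | mem t ht =>
      obtain ⟨k', γ, hγ, hk, P, hP, w, hw, rfl⟩ := ht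
      obtain ⟨c, hc, e⟩ := hg (Sec.germ hxW w) (Subsheaf.germ_mem_stalk hxW
        (F.antitone (fun i => (hγ i).1) W hw))
      refine ⟨fun a => DiffOp.germ hxW P * c a, fun a => ?_, ?_⟩
      · refine D.vStalk_anti (fun i => ?_) (D.mul_mem_vStalk ⟨W, hxW, P, hP, rfl⟩ (hc a))
        have h1 := hk i
        have h2 := (hγ i).2
        have h3 := Int.le_ceil B
        have h4 : (k i : ℝ) ≤ k' i + ⌈B⌉ := by linarith
        have h5 : k i ≤ k' i + ⌈B⌉ := by exact_mod_cast h4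
        simp only [Pi.sub_apply, Pi.add_apply, Pi.zero_apply]
        linarith
      · rw [← germ_smul_sec_germ, ← e, Finset.smul_sum]
        exact Finset.sum_congr rfl fun a _ => mul_smul _ _ _
    | zero => exact ⟨0, fun a => zero_mem _, by simp⟩
    | add s t _ _ hs ht =>
      obtain ⟨c, hc, e⟩ := hs
      obtain ⟨d, hd, e'⟩ := ht
      exact ⟨c + d, fun a => add_mem (hc a) (hd a), by
        simp [add_smul, Finset.sum_add_distrib, e, e']⟩
    | neg s _ hs =>
      obtain ⟨c, hc, e⟩ := hs
      exact ⟨-c, fun a => neg_mem (hc a), by simp [e]⟩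

end StalkFamily

/-! ### Removing the shift: Nullstellensatz, wall crossing and strictness -/

noncomputable section Comparison

/-- If a subgroup stable under commuting operators contains, for every point `z`, the image of `m`
under a polynomial in these operators not vanishing at `z`, then it contains `m`. -/
theorem mem_of_forall_eval_ne_zero {ι D E : Type*} [Finite ι] [Ring D] [AddCommGroup E] [Module D E]
    (ψ : MvPolynomial ι ℂ →+* D) (B : AddSubgroup E) (hB : ∀ g, ∀ m ∈ B, ψ g • m ∈ B) {m : E}
    (h : ∀ z : ι → ℂ, ∃ g, MvPolynomial.eval z g ≠ 0 ∧ ψ g • m ∈ B) : m ∈ B := by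
  let I : Ideal (MvPolynomial ι ℂ) :=
    { carrier := {g | ψ g • m ∈ B}
      zero_mem' := by
        change ψ 0 • m ∈ B
        rw [map_zero, zero_smul]
        exact zero_mem _
      add_mem' := fun {a b} ha hb => by
        change ψ (a + b) • m ∈ B
        rw [map_add, add_smul]
        exact add_mem ha hb
      smul_mem' := fun a b hb => by
        change ψ (a * b) • m ∈ B
        rw [map_mul, mul_smul]
        exact hB a _ hb }
  have hI : I = ⊤ := by
    by_contra hne
    obtain ⟨J, hJ, hIJ⟩ := Ideal.exists_le_maximal I hne
    obtain ⟨z, rfl⟩ := MvPolynomial.isMaximal_iff_eq_vanishingIdeal_singleton.1 hJ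
    obtain ⟨g, hg, hgm⟩ := h z
    have := MvPolynomial.mem_vanishingIdeal_iff.1 (hIJ hgm) z rfl
    rw [MvPolynomial.aeval_eq_eval] at this
    exact hg this
  have h1 : (1 : MvPolynomial ι ℂ) ∈ I := hI ▸ trivial
  have h2 : ψ 1 • m ∈ B := h1
  rwa [map_one, one_smul] at h2

section Paths

variable {ι D E E' : Type*} [Ring D] [AddCommGroup E] [Module D E] [AddCommGroup E'] [Module D E']
  {r : ℕ}

/-- For every point `z`, one can move from `A p` to `A q` by an operator not vanishing at `z`,
provided that the form of no wall takes a value at `ξ z` between its values at `p` and `q`. -/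
def HasPaths (ψ : MvPolynomial ι ℂ →+* D) (ξ : (ι → ℂ) → Fin r → ℝ)
    (A : (Fin r → ℝ) → AddSubgroup E) : Prop :=
  ∃ T : Finset ((Fin r → ℚ) × ℝ), ∀ z p q,
    (∀ a ∈ T, ¬ (slopeForm a.1 p ≤ slopeForm a.1 (ξ z) ∧ slopeForm a.1 (ξ z) < slopeForm a.1 q)) →
    ∃ g, MvPolynomial.eval z g ≠ 0 ∧ ∀ m ∈ A p, ψ g • m ∈ A q

variable {ψ : MvPolynomial ι ℂ →+* D} {ξ : (ι → ℂ) → Fin r → ℝ}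

/-- Strictness compares the image of the source filtration with the target filtration, inside the
target. A path is given by an element of `D`, so it passes to images under linear maps, and by
`HasPaths.inf` to intersections with submodules. -/
theorem HasPaths.map {A : (Fin r → ℝ) → AddSubgroup E} (h : HasPaths ψ ξ A) (f : E →ₗ[D] E') :
    HasPaths ψ ξ fun p => (A p).map f.toAddMonoidHom := by
  obtain ⟨T, hT⟩ := h
  refine ⟨T, fun z p q hpq => ?_⟩
  obtain ⟨g, hg, hg'⟩ := hT z p q hpq
  refine ⟨g, hg, ?_⟩
  rintro _ ⟨m, hm, rfl⟩
  exact ⟨ψ g • m, hg' m hm, map_smul f _ _⟩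

theorem HasPaths.inf {A : (Fin r → ℝ) → AddSubgroup E} (h : HasPaths ψ ξ A) (S : Submodule D E) :
    HasPaths ψ ξ fun p => S.toAddSubgroup ⊓ A p := by
  obtain ⟨T, hT⟩ := h
  refine ⟨T, fun z p q hpq => ?_⟩
  obtain ⟨g, hg, hg'⟩ := hT z p q hpq
  exact ⟨g, hg, fun m hm => ⟨S.smul_mem _ hm.1, hg' m hm.2⟩⟩

/-- Two filtrations having paths which are comparable up to a shift are comparable. -/
theorem HasPaths.le [Finite ι] {A B : (Fin r → ℝ) → AddSubgroup E} (hA : HasPaths ψ ξ A)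
    (hB : HasPaths ψ ξ B) (hstab : ∀ p g, ∀ m ∈ B p, ψ g • m ∈ B p) {c : ℝ}
    (hAB : ∀ p, A p ≤ B (p - fun _ => c)) (p : Fin r → ℝ) : A p ≤ B p := by
  intro m hm
  obtain ⟨T, hT⟩ := hA
  obtain ⟨T', hT'⟩ := hB
  refine mem_of_forall_eval_ne_zero ψ (B p) (hstab p) fun z => ?_
  -- `K` is large enough that, for every slope with `L(p) > L(ξ)`, the far point on the ray stays
  -- above `L(ξ)` even after the shift by `c`.
  obtain ⟨K, hK, hK0⟩ : ∃ K : ℝ, (∀ a ∈ T', 0 < slopeForm a.1 p - slopeForm a.1 (ξ z) →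
      slopeForm a.1 (fun _ => c) < (K + 1) * (slopeForm a.1 p - slopeForm a.1 (ξ z))) ∧ 0 ≤ K := by
    have : ∀ᶠ K : ℝ in Filter.atTop, ∀ a ∈ T', 0 < slopeForm a.1 p - slopeForm a.1 (ξ z) →
        slopeForm a.1 (fun _ => c) < (K + 1) * (slopeForm a.1 p - slopeForm a.1 (ξ z)) := by
      rw [Filter.eventually_all_finset]
      intro a _
      by_cases h : 0 < slopeForm a.1 p - slopeForm a.1 (ξ z)
      · have h1 : Filter.Tendsto (fun K : ℝ => K + 1) Filter.atTop Filter.atTop :=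
          Filter.tendsto_atTop_add_const_right _ _ Filter.tendsto_id
        have := (h1.atTop_mul_const h).eventually_gt_atTop (slopeForm a.1 fun _ => c)
        filter_upwards [this] with K hK _ using hK
      · exact Filter.Eventually.of_forall (fun (K : ℝ) h' => absurd h' h)
    exact (this.and (Filter.eventually_ge_atTop (0 : ℝ))).exists
  -- On the ray, `L - L(ξ)` is multiplied by `1 + K > 0`, so its sign does not change on the way
  -- out.
  obtain ⟨g, hg, hgA⟩ := hT z p (p + K • (p - ξ z)) fun a _ ⟨h1, h2⟩ => by
    rw [slopeForm_add, slopeForm_smul, slopeForm_sub] at h2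
    nlinarith
  -- On the way back, a slope with `L(p) > L(ξ)` already exceeds `L(ξ)` at the start, by the choice
  -- of `K`.
  obtain ⟨g', hg', hgB⟩ := hT' z (p + K • (p - ξ z) - (fun _ => c : Fin r → ℝ)) p fun a ha ⟨h1, h2⟩ => by
    rw [slopeForm_sub, slopeForm_add, slopeForm_smul, slopeForm_sub] at h1
    have := hK a ha (sub_pos.2 h2)
    linarith
  refine ⟨g' * g, by rw [map_mul]; exact mul_ne_zero hg' hg, ?_⟩
  rw [map_mul, mul_smul]
  exact hgB _ (hAB _ (hgA m hm))

/-- Linear maps are strict with respect to good filtrations having paths. -/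
theorem GoodFamily.strict [Finite ι] {V : (Fin r → ℤ) → AddSubgroup D} (h1 : (1 : D) ∈ V 0)
    (hmul : ∀ {k l P Q}, P ∈ V k → Q ∈ V l → P * Q ∈ V (k + l))
    (hR : IsNoetherianRing (reesRing V h1 hmul)) (F : GoodFamily V E) (G : GoodFamily V E')
    (hψ : ∀ g, ψ g ∈ V 0) (hF : HasPaths ψ ξ F.F) (hG : HasPaths ψ ξ G.F) (f : E →ₗ[D] E')
    (p : Fin r → ℝ) :
    (∀ m ∈ F.F p, f m ∈ G.F p) ∧ ∀ m, f m ∈ G.F p → ∃ m' ∈ F.F p, f m' = f m := by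
  have hsF : ∀ p g, ∀ m ∈ F.F p, ψ g • m ∈ F.F p := fun p g m hm => by
    have := F.smul_mem (hψ g) hm
    convert this using 1
    simp [Pi.add_def]
  have hsG : ∀ p g, ∀ m ∈ G.F p, ψ g • m ∈ G.F p := fun p g m hm => by
    have := G.smul_mem (hψ g) hm
    convert this using 1
    simp [Pi.add_def]
  constructor
  · obtain ⟨c, hc⟩ := F.exists_map_mem G f
    intro m hm
    refine (hF.map f).le hG hsG (c := c) ?_ p ⟨m, hm, rfl⟩
    rintro p _ ⟨m, hm, rfl⟩
    exact hc p m hm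
  · obtain ⟨c, hc⟩ := F.exists_mem_map h1 hmul G f
    intro m hm
    -- The roles are exchanged: the target filtration, cut down to the image of `f`, is compared
    -- with the image of the source filtration, using the Artin-Rees shift.
    refine (hG.inf (LinearMap.range f)).le (hF.map f) ?_ (c := c) ?_ p ⟨⟨m, rfl⟩, hm⟩
    · rintro p g _ ⟨m, hm, rfl⟩
      exact ⟨ψ g • m, hsF p g m hm, map_smul f _ _⟩
    · rintro p _ ⟨⟨m, rfl⟩, hm⟩
      exact hc p m hm

end Paths

theorem WeylData.del_mul_z_comm {n : ℕ} {O D : Type*} [CommRing O] [Ring D] [Module D O]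
    (W : WeylData n O D) (i j : Fin n) :
    W.del i * W.mul (W.z i) * (W.del j * W.mul (W.z j)) =
      W.del j * W.mul (W.z j) * (W.del i * W.mul (W.z i)) := by
  by_cases h : i = j
  · rw [h]
  have h1 : Commute (W.del i) (W.mul (W.z j)) := by
    rw [Commute, SemiconjBy, W.del_mul_z, if_neg h, add_zero]
  have h2 : Commute (W.del j) (W.mul (W.z i)) := by
    rw [Commute, SemiconjBy, W.del_mul_z, if_neg (Ne.symm h), add_zero]
  have h3 : Commute (W.mul (W.z i)) (W.mul (W.z j)) := by
    rw [Commute, SemiconjBy, ← map_mul, mul_comm, map_mul]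
  have h4 : Commute (W.del i) (W.del j) := W.del_comm i j
  exact (h4.mul_right h1).mul_left (h2.symm.mul_right h3)

section Stalk

variable {n : ℕ} {X : Type u} [TopologicalSpace X] [ChartedSpace (Fin n → ℂ) X] {r : ℕ}
  [IsManifold 𝓘(ℂ, Fin n → ℂ) ω X] {D : SNCDivisor n X r} {x : X} (c : AdaptedChart n D.comp x)

/-- The germ of the operator `s_i`. -/
def AdaptedChart.sGerm (i : {i : Fin r // x ∈ D.comp i}) : DiffStalk n x :=
  -(delStalk c.mem_maximalAtlas c.mem_source (c.idx i) * mulStalk x (c.zGerm c.mem_source (c.idx i)))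

theorem AdaptedChart.germ_sOp {U : Opens X} (hU : (U : Set X) ⊆ c.chart.source) (hx : x ∈ U)
    (i : {i : Fin r // x ∈ D.comp i}) : DiffOp.germ hx (c.sOp hU i) = c.sGerm i := by
  rw [sOp, map_neg, map_mul, germ_partialOp, ← mulStalk_germ, germ_coord]
  rfl

theorem AdaptedChart.sGerm_comm (i j : {i : Fin r // x ∈ D.comp i}) :
    c.sGerm i * c.sGerm j = c.sGerm j * c.sGerm i := by
  rw [sGerm, sGerm, neg_mul_neg, neg_mul_neg]
  exact (weylData c.mem_maximalAtlas c.mem_source).del_mul_z_comm _ _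

/-- The derivation loses one order along the component and the coordinate regains it. Hence
polynomials in the `s_i` preserve every step of a good filtration. -/
theorem AdaptedChart.sGerm_mem (i : {i : Fin r // x ∈ D.comp i}) : c.sGerm i ∈ D.vStalk x 0 := by
  have := D.mul_mem_vStalk (c.delStalk_mem (c.idx i)) (c.mulStalk_zGerm_mem i)
  rw [c.delDeg_idx, neg_add_cancel] at this
  exact neg_mem this

/-- Polynomials in the operators `s_i`. -/
def AdaptedChart.polyHom : MvPolynomial {i : Fin r // x ∈ D.comp i} ℂ →ₐ[ℂ] DiffStalk n x :=
  (exists_algHom_of_commute c.sGerm c.sGerm_comm).choose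

theorem AdaptedChart.polyHom_X (i : {i : Fin r // x ∈ D.comp i}) :
    c.polyHom (MvPolynomial.X i) = c.sGerm i :=
  (exists_algHom_of_commute (R := ℂ) c.sGerm c.sGerm_comm).choose_spec i

theorem algebraMap_mem_vStalk (D : SNCDivisor n X r) (a : ℂ) :
    algebraMap ℂ (DiffStalk n x) a ∈ D.vStalk x 0 :=
  mulStalk_mem_vStalk_zero D (Hol.germ (U := ⊤) trivial (algebraMap ℂ _ a))

theorem AdaptedChart.polyHom_mem (g : MvPolynomial {i : Fin r // x ∈ D.comp i} ℂ) :
    c.polyHom g ∈ D.vStalk x 0 := by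
  induction g using MvPolynomial.induction_on with
  | C a =>
    rw [← MvPolynomial.algebraMap_eq, AlgHom.commutes]
    exact algebraMap_mem_vStalk D a
  | add p q hp hq => rw [map_add]; exact add_mem hp hq
  | mul_X p i hp =>
    rw [map_mul, polyHom_X]
    have := D.mul_mem_vStalk hp (c.sGerm_mem i)
    rwa [add_zero] at this

open Classical in
/-- The polynomial `L(s) + γ`. -/
def slopePoly (D : SNCDivisor n X r) (x : X) (L : Fin r → ℚ) (γ : ℂ) :
    MvPolynomial {i : Fin r // x ∈ D.comp i} ℂ :=
  ∑ i, (L i.1 : ℂ) • MvPolynomial.X i + algebraMap ℂ _ γ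

theorem AdaptedChart.germ_slopeOp {U : Opens X} (hU : (U : Set X) ⊆ c.chart.source) (hx : x ∈ U)
    (L : Fin r → ℚ) (γ : ℂ) : DiffOp.germ hx (c.slopeOp hU L + algebraMap ℂ _ γ) =
      c.polyHom (slopePoly D x L γ) := by
  rw [slopePoly, slopeOp, map_add, map_add, map_sum, map_sum, AlgHom.commutes, AlgHom.commutes]
  congr 1
  refine Finset.sum_congr rfl fun i _ => ?_
  rw [map_smul, map_smul, polyHom_X, germ_sOp]

open Classical in
/-- The point of `ℝ^r` with coordinates `-Re z_i`. -/
def negRe (D : SNCDivisor n X r) (x : X) (z : {i : Fin r // x ∈ D.comp i} → ℂ) (i : Fin r) : ℝ :=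
  -- The sign is chosen so that `L(s) + γ_j` can vanish at `z` only when `L(ξ) = Re γ_j`. Components
  -- missing `x` contribute no operator, whence the value zero.
  if h : x ∈ D.comp i then -(z ⟨i, h⟩).re else 0

omit [IsManifold 𝓘(ℂ, Fin n → ℂ) ω X] in
theorem re_eval_slopePoly (L : Fin r → ℚ) (γ : ℂ) (z : {i : Fin r // x ∈ D.comp i} → ℂ) :
    (MvPolynomial.eval z (slopePoly D x L γ)).re = γ.re - slopeForm L (negRe D x z) := by
  classical
  have e1 : slopeForm L (negRe D x z) =
      ∑ i : {i : Fin r // x ∈ D.comp i}, (L i.1 : ℝ) * -(z i).re := by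
    have e2 : ∀ i : {i : Fin r // x ∈ D.comp i},
        (L i.1 : ℝ) * -(z i).re = (L i.1 : ℝ) * negRe D x z i.1 := fun i => by
      rw [negRe, dif_pos i.2]
    rw [Finset.sum_congr rfl fun i _ => e2 i,
      ← Finset.sum_subtype (Finset.univ.filter fun i => x ∈ D.comp i) (by simp)
        fun i => (L i : ℝ) * negRe D x z i]
    refine (Finset.sum_filter_of_ne fun i _ hi => ?_).symm
    by_contra h'
    rw [negRe, dif_neg h', mul_zero] at hi
    exact hi rfl
  rw [e1, slopePoly, map_add, map_sum]
  simp only [MvPolynomial.smul_eval, MvPolynomial.eval_X, MvPolynomial.algebraMap_eq,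
    MvPolynomial.eval_C, Complex.add_re, Complex.re_sum, mul_neg, Finset.sum_neg_distrib,
    sub_neg_eq_add]
  rw [add_comm]
  congr 1
  refine Finset.sum_congr rfl fun i _ => ?_
  rw [← Complex.ofReal_ratCast, Complex.re_ofReal_mul]

/-- The stalks of a multivariate `V`-filtration have paths. -/
theorem Filtration.IsMultivariateV.hasPaths {M : DModule.{u, v} n X} {F : Filtration r M}
    (hF : F.IsMultivariateV D) :
    HasPaths c.polyHom.toRingHom (negRe D x) (hF.isGood.family x).F := by
  obtain ⟨U, hx, 𝒲, hW⟩ := hF.isGood.isWallAndChamber x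
  obtain ⟨T, hT, hT𝒲⟩ := hW.1.exists_finset
  refine ⟨T, fun z p q hpq => ?_⟩
  -- The relation is transitive because polynomials may be multiplied and nonvanishing at `z` is
  -- multiplicative.
  refine rel_of_not_crossed hT hT𝒲 (negRe D x z) (R := fun p q => ∃ g,
    MvPolynomial.eval z g ≠ 0 ∧ ∀ m ∈ (F.step p).stalk x, c.polyHom g • m ∈ (F.step q).stalk x)
    ?_ ?_ ?_ ?_ hpq
  · rintro p q s ⟨g, hg, h⟩ ⟨g', hg', h'⟩
    refine ⟨g' * g, by rw [map_mul]; exact mul_ne_zero hg' hg, fun m hm => ?_⟩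
    rw [map_mul, mul_smul]
    exact h' _ (h m hm)
  · intro p q h
    refine ⟨1, by simp, fun m hm => ?_⟩
    rw [map_one, one_smul]
    exact (hF.isGood.family x).anti h hm
  · intro p q h
    obtain ⟨σ, hσ, hp, hq⟩ := h.exists_chamber
    refine ⟨1, by simp, ?_⟩
    rintro _ ⟨V, hV, s, hs, rfl⟩
    have hVU : x ∈ V ⊓ U := ⟨hV, hx⟩
    rw [map_one, one_smul, ← Sec.germ_res (inf_le_left : V ⊓ U ≤ V) hVU]
    refine Subsheaf.germ_mem_stalk hVU ?_
    rw [← hW.2 σ hσ p hp q hq (V ⊓ U) inf_le_right]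
    exact (F.step p).res_mem _ hs
  · intro p q L γ hle hL hmem hsep huniq hne
    obtain ⟨U', hU', hc, hx', γs, hγs, h⟩ := hF.eigenvalue U 𝒲 hW p q L γ hle hL hmem hsep huniq x hx c
    refine ⟨(γs.map (slopePoly D x L)).prod, ?_, ?_⟩
    · rw [map_list_prod, List.map_map]
      -- Every factor has real part `γ - L(ξ)` at `z`, which is nonzero because the wall does not
      -- contain `ξ`.
      refine List.prod_ne_zero fun h0 => ?_
      obtain ⟨w, hw, e⟩ := List.mem_map.1 h0
      have e' := congrArg Complex.re e
      rw [Function.comp_apply, re_eval_slopePoly, hγs w hw, Complex.zero_re, sub_eq_zero] at e'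
      exact hne e'.symm
    · rintro _ ⟨V, hV, s, hs, rfl⟩
      have hVU : x ∈ V ⊓ U' := ⟨hV, hx'⟩
      have h2 := Subsheaf.germ_mem_stalk hVU (h (V ⊓ U') inf_le_right (Sec.res inf_le_left s)
        ((F.step p).res_mem _ hs))
      rw [← germ_smul_sec_germ, Sec.germ_res, DiffOp.germ_res, map_list_prod, List.map_map] at h2
      rw [map_list_prod, List.map_map]
      convert h2 using 4
      funext w
      exact (c.germ_slopeOp hc hx' L w).symm

/-- Morphisms are strict on stalks. -/
theorem stalkMap_strict {M N : DModule.{u, v} n X} (f : M ⟶ N) {F : Filtration r M}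
    {G : Filtration r N} (hF : F.IsMultivariateV D) (hG : G.IsMultivariateV D) (x : X)
    (p : Fin r → ℝ) :
    (∀ m ∈ (F.step p).stalk x, stalkMap f x m ∈ (G.step p).stalk x) ∧
      ∀ m, stalkMap f x m ∈ (G.step p).stalk x →
        ∃ m' ∈ (F.step p).stalk x, stalkMap f x m' = stalkMap f x m := by
  obtain ⟨c⟩ := D.exists_adaptedChart x
  exact GoodFamily.strict c.vData.one_mem c.vData.mul_mem c.rees_isNoetherianRing
    (hF.isGood.family x) (hG.isGood.family x) c.polyHom_mem (hF.hasPaths c) (hG.hasPaths c)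
    (stalkMap f x) p

theorem map_step_eq {M N : DModule.{u, v} n X} (f : M ⟶ N) {F : Filtration r M}
    {G : Filtration r N} (hF : F.IsMultivariateV D) (hG : G.IsMultivariateV D) (p : Fin r → ℝ) :
    (F.step p).map f = (⊤ : Subsheaf M).map f ⊓ G.step p := by
  ext U t
  change _ ↔ t ∈ ((⊤ : Subsheaf M).map f).sections U ∧ t ∈ (G.step p).sections U
  rw [Subsheaf.mem_map_sections_iff, Subsheaf.mem_map_sections_iff, Subsheaf.mem_sections_iff]
  constructor
  · intro h
    refine ⟨fun x hx => ?_, fun x hx => ?_⟩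
    · obtain ⟨_, ⟨V, hV, s, -, rfl⟩, e⟩ := h x hx
      exact ⟨_, Subsheaf.germ_mem_stalk hV trivial, e⟩
    · obtain ⟨a, ha, e⟩ := h x hx
      rw [← e]
      exact (stalkMap_strict f hF hG x p).1 a ha
  · rintro ⟨h, h'⟩ x hx
    obtain ⟨a, -, e⟩ := h x hx
    obtain ⟨a', ha', e'⟩ := (stalkMap_strict f hF hG x p).2 a (e ▸ h' x hx)
    exact ⟨a', ha', e'.trans e⟩

/-- Strictness for the identity morphism, regarded as a map between two filtrations of the same
module. -/
theorem step_le {M : DModule.{u, v} n X} {F G : Filtration r M} (hF : F.IsMultivariateV D)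
    (hG : G.IsMultivariateV D) (p : Fin r → ℝ) (U : Opens X) :
    (F.step p).sections U ≤ (G.step p).sections U := by
  intro s hs
  rw [Subsheaf.mem_sections_iff] at hs ⊢
  exact fun x hx => (stalkMap_strict (𝟙 M) hF hG x p).1 _ (hs x hx)

/-- Multivariate `V`-filtrations are unique. -/
theorem Filtration.IsMultivariateV.unique {M : DModule.{u, v} n X} {F G : Filtration r M}
    (hF : F.IsMultivariateV D) (hG : G.IsMultivariateV D) : F = G := by
  ext p U s
  exact ⟨fun h => step_le hF hG p U h, fun h => step_le hG hF p U h⟩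

end Stalk

end Comparison

end MultiV

theorem mainTheorem6 (n : ℕ) (X : Type u) [TopologicalSpace X] [ChartedSpace (Fin n → ℂ) X]
    [IsManifold 𝓘(ℂ, Fin n → ℂ) ω X] (r : ℕ) (D : MultiV.SNCDivisor n X r) :
    (∀ M : MultiV.DModule.{u, v} n X, MultiV.IsCoherentDModule M →
      ∀ F G : MultiV.Filtration r M, F.IsMultivariateV D → G.IsMultivariateV D → F = G) ∧
    (∀ M N : MultiV.DModule.{u, v} n X, MultiV.IsCoherentDModule M → MultiV.IsCoherentDModule N →
      ∀ (f : M ⟶ N) (F : MultiV.Filtration r M) (G : MultiV.Filtration r N),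
        F.IsMultivariateV D → G.IsMultivariateV D →
        ∀ α : Fin r → ℝ, (F.step α).map f = (⊤ : MultiV.Subsheaf M).map f ⊓ G.step α) := by
  exact ⟨fun _ _ _ _ hF hG => hF.unique hG, fun _ _ _ _ f _ _ hF hG α => MultiV.map_step_eq f hF hG α⟩
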